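/- For integers $d\ge 1$ and $k_1,\dots,k_d\ge 1$ with $k_d\ge 2$, let $\zeta(k_1,\dots,k_d)=\sum_{0<m_1<\cdots<m_d} m_1^{-k_1}\cdots m_d^{-k_d}$, and for $w\ge 1$ let $\mathcal Z_w$ be the $\mathbb Q$-linear span of all such multiple zeta values with $k_1+\cdots+k_d=w$. Let $r\ge 1$. For $\mathbf u=(u_1,\dots,u_r)\in\mathbb C^r$ and $\mathbf b\in\mathbb Z_{\ge 0}^r$ with $b_1\ge 1$, let $\mathrm{Li}_{\mathbf u}(z_1,\dots,z_r;\mathbf b)$ denote the analytic continuation to $(z_1,\dots,z_r)\in(\mathbb C\setminus\mathbb R_{\ge 1})^r$ of $$\sum_{l_j\ge b_j\ (j=1,\dots,r)}\ \prod_{j=1}^r\frac{z_j^{l_j}}{(l_1+\cdots+l_j)^{u_j}}\qquad(|z_1|,\dots,|z_r|<1).$$ For $\mathbf u,\mathbf s\in\mathbb C^r$ with positive real parts, a permutation $\sigma\in\mathfrak S_r$ and $\mathbf a,\mathbf b\in\mathbb Z_{\ge0}^r$, write $T_j=t_j+t_{j+1}+\cdots+t_r$ and put $$\eta(\mathbf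 u;\mathbf s;\sigma;\mathbf a;\mathbf b)=\prod_{j=1}^r\frac1{\Gamma(s_j)}\int_{(0,\infty)^r}\Big(\prod_{j=1}^r t_j^{s_j-1}e^{(1-a_j)T_j}\Big)\frac{\mathrm{Li}_{\mathbf u}\big(1-e^{T_{\sigma(1)}},\dots,1-e^{T_{\sigma(r)}};\mathbf b\big)}{\prod_{j=1}^r\big(1-e^{T_{\sigma(j)}}\big)^{b_j}}\,dt_1\cdots dt_r ,$$ $$\eta^{\star}(\mathbf u;\mathbf s;\sigma;\mathbf a)=\eta(\mathbf u;\mathbf s;\sigma;\mathbf a;1,\dots,1),\qquad \eta^{\star\star}(\mathbf u;\mathbf s;\sigma;\mathbf b)=\eta(\mathbf u;\mathbf s;\sigma;1,\dots,1;\mathbf b).$$ **Theorem.** Let $\mathbf k,\mathbf n\in\mathbb Z_{\ge1}^r$, $\sigma\in\mathfrak S_r$ and $\mathbf a\in\{0,1\}^r$ with $a_1=a_{\sigma^{-1}(1)}=1$. Then $\eta^{\star}(\mathbf k;\mathbf n;\sigma;\mathbf a)$ and $\eta^{\star\star}(\mathbf k;\mathbf n;\sigma;\mathbf a)$ are well defined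 (the analytic continuations exist and the integrals converge absolutely), and $$\eta^{\star}(\mathbf k;\mathbf n;\sigma;\mathbf a),\ \eta^{\star\star}(\mathbf k;\mathbf n;\sigma;\mathbf a)\in\mathcal Z_{k_1+\cdots+k_r+n_1+\cdots+n_r}.$$ -/

import Mathlib

noncomputable section

namespace ArakawaKaneko

/-! ### Multiple zeta values -/

/-- The multiple zeta value `ζ(k₁,…,k_d) = ∑_{0 < m₁ < ⋯ < m_d} 1 / (m₁^k₁ ⋯ m_d^k_d)`. -/
def multipleZeta {d : ℕ} (k : Fin d → ℕ) : ℝ :=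
  ∑' m : {m : Fin d → ℕ // StrictMono m ∧ ∀ i, 0 < m i},
    ∏ i, 1 / ((m.1 i : ℝ) ^ k i)

/-- Admissible indices: all entries are positive and the last one is at least `2`. -/
def Admissible {d : ℕ} (k : Fin d → ℕ) : Prop :=
  (∀ i, 1 ≤ k i) ∧ ∀ i : Fin d, (i : ℕ) + 1 = d → 2 ≤ k i

/-- The `ℚ`-linear span, inside `ℂ`, of all multiple zeta values of admissible indices of
weight `w`. -/
def mzvSpan (w : ℕ) : Submodule ℚ ℂ :=
  Submodule.span ℚ {x : ℂ | ∃ (d : ℕ) (k : Fin d → ℕ),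
    Admissible k ∧ ∑ i, k i = w ∧ x = (multipleZeta k : ℂ)}

/-! ### The multiple polylogarithm of shuffle type -/

variable {r : ℕ}

/-- The series `∑_{l_j ≥ b_j} z₁^l₁ ⋯ z_r^l_r / (l₁^u₁ ⋯ (l₁+⋯+l_r)^u_r)`. -/
def liSeries (u : Fin r → ℂ) (b : Fin r → ℕ) (z : Fin r → ℂ) : ℂ :=
  ∑' l : {l : Fin r → ℕ // ∀ j, b j ≤ l j},
    ∏ j, z j ^ l.1 j / (((∑ i ∈ Finset.Iic j, l.1 i : ℕ) : ℂ) ^ u j)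

/-- The region `(ℂ ∖ ℝ_{≥ 1})^r`. -/
def slitDomain (r : ℕ) : Set (Fin r → ℂ) :=
  {z | ∀ j, ∀ x : ℝ, 1 ≤ x → z j ≠ (x : ℂ)}

/-- `F` is an analytic continuation to `(ℂ ∖ ℝ_{≥ 1})^r` of the function given by the series on
the open unit polydisc. -/
def IsLiContinuation (u : Fin r → ℂ) (b : Fin r → ℕ) (F : (Fin r → ℂ) → ℂ) : Prop :=
  AnalyticOnNhd ℂ F (slitDomain r) ∧ ∀ z : Fin r → ℂ, (∀ j, ‖z j‖ < 1) → F z = liSeries u b z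

lemma starConvex_slitDomain (r : ℕ) : StarConvex ℝ 0 (slitDomain r) := by
  rw [starConvex_zero_iff]
  intro z hz c hc0 hc1 j x hx h
  have hc : 0 < c := by
    rcases hc0.lt_or_eq with h0 | h0
    · exact h0
    · subst h0
      simp only [Pi.smul_apply, zero_smul] at h
      have : x = 0 := by exact_mod_cast h.symm
      linarith
  apply hz j (x / c)
  · rw [le_div_iff₀ hc]; linarith
  · simp only [Pi.smul_apply, Complex.real_smul] at h
    have hcc : (c : ℂ) ≠ 0 := by exact_mod_cast hc.ne'
    push_cast
    rw [eq_div_iff hcc, ← h, mul_comm]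

/-- The analytic continuation is unique on `(ℂ ∖ ℝ_{≥ 1})^r`. -/
lemma IsLiContinuation.eqOn {u : Fin r → ℂ} {b : Fin r → ℕ} {F G : (Fin r → ℂ) → ℂ}
    (hF : IsLiContinuation u b F) (hG : IsLiContinuation u b G) :
    Set.EqOn F G (slitDomain r) := by
  have h0 : (0 : Fin r → ℂ) ∈ slitDomain r := by
    intro j x hx h
    have hx0 : x = 0 := Complex.ofReal_eq_zero.mp h.symm
    linarith
  refine hF.1.eqOn_of_preconnected_of_eventuallyEq hG.1
    ((starConvex_slitDomain r).isPathConnected h0).isConnected.isPreconnected h0 ?_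
  filter_upwards [Metric.ball_mem_nhds (0 : Fin r → ℂ) one_pos] with z hz
  have hz' : ∀ j, ‖z j‖ < 1 := fun j =>
    (norm_le_pi_norm z j).trans_lt (by simpa using hz)
  rw [hF.2 z hz', hG.2 z hz']

open Classical in
/-- The multiple polylogarithm `Li(z₁,…,z_r; b₁,…,b_r)` of shuffle type with index `u`, on
`(ℂ ∖ ℝ_{≥ 1})^r`: the analytic continuation of the series (unique there), whenever it exists. -/
def multiLi (u : Fin r → ℂ) (b : Fin r → ℕ) : (Fin r → ℂ) → ℂ :=
  if h : ∃ F, IsLiContinuation u b F then h.choose else 0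

lemma multiLi_spec {u : Fin r → ℂ} {b : Fin r → ℕ} (h : ∃ F, IsLiContinuation u b F) :
    IsLiContinuation u b (multiLi u b) := by
  rw [multiLi, dif_pos h]
  exact h.choose_spec

/-! ### The Arakawa–Kaneko type `η` function -/

/-- The tail sum `t_j + t_{j+1} + ⋯ + t_r`. -/
def tailSum (t : Fin r → ℝ) (j : Fin r) : ℝ := ∑ i ∈ Finset.Ici j, t i

/-- The integrand of the `η` function at `t ∈ (0,∞)^r`. -/
def etaIntegrand (u s : Fin r → ℂ) (σ : Equiv.Perm (Fin r)) (a b : Fin r → ℕ)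
    (t : Fin r → ℝ) : ℂ :=
  (∏ j, (t j : ℂ) ^ (s j - 1) * (Real.exp ((1 - (a j : ℝ)) * tailSum t j) : ℂ)) *
    (multiLi u b (fun j => 1 - (Real.exp (tailSum t (σ j)) : ℂ)) /
      ∏ j, (1 - (Real.exp (tailSum t (σ j)) : ℂ)) ^ b j)

/-- The open orthant `(0,∞)^r`. -/
def orthant (r : ℕ) : Set (Fin r → ℝ) := {t | ∀ j, 0 < t j}

/-- The function `η(u; s; σ; a; b)`, defined by its integral over `(0,∞)^r`. -/
def eta (u s : Fin r → ℂ) (σ : Equiv.Perm (Fin r)) (a b : Fin r → ℕ) : ℂ :=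
  (∏ j, 1 / Complex.Gamma (s j)) *
    ∫ t in orthant r, etaIntegrand u s σ a b t

/-- The integral defining `η(u; s; σ; a; b)` is meaningful: the polylogarithm in its integrand has
an analytic continuation to `(ℂ ∖ ℝ_{≥ 1})^r`, and the integral converges absolutely. -/
def EtaConverges (u s : Fin r → ℂ) (σ : Equiv.Perm (Fin r)) (a b : Fin r → ℕ) : Prop :=
  (∃ F, IsLiContinuation u b F) ∧
    MeasureTheory.IntegrableOn (etaIntegrand u s σ a b) (orthant r)

/-- `η⋆(u; s; σ; a) = η(u; s; σ; a; 1,…,1)`. -/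
def etaStar (u s : Fin r → ℂ) (σ : Equiv.Perm (Fin r)) (a : Fin r → ℕ) : ℂ :=
  eta u s σ a (fun _ => 1)

/-- `η⋆⋆(u; s; σ; b) = η(u; s; σ; 1,…,1; b)`. -/
def etaStarStar (u s : Fin r → ℂ) (σ : Equiv.Perm (Fin r)) (b : Fin r → ℕ) : ℂ :=
  eta u s σ (fun _ => 1) b

end ArakawaKaneko

end

/-! Put `T_j = t_j + ⋯ + t_r` and `X_j = x_j + ⋯ + x_r`. Writing each `1/(l_1+⋯+l_j)^{k_j}` as a
Gamma integral and summing geometric series gives `Li(z; b) = ∏ z_j^{b_j} ∫ w(x) ∏ (1 - z_j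
e^{-X_j})⁻¹ dx`, which also continues `Li` to the slit domain (`isLiContinuation_liIntegral`). At
`z_j = 1 - e^{T_σ(j)}` one has `1 - z_j e^{-X_j} = e^{T_σ(j)} (1 - (1 - e^{-X_j})(1 -
e^{-T_σ(j)}))`. Hence `η` is an integral of a nonnegative function over two orthants
(`eta_eq_doubleIntegral`), so absolute convergence amounts to its finiteness. The integrand is
symmetric under exchanging `(k, b, x)` with `(n, a, t)` and `σ` with `σ⁻¹` (`doubleIntegral_symm`),
so that only `b = (1, …, 1)` remains (`doubleIntegral_mem`).

In the variables `1 - e^{-X}`, the form `dx/(1-x)` becomes `dX`, and a power of a difference `X_j -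
X_{j+1}` becomes a block of such letters. The `x`-integral is therefore the value at 1 of one
iterated integral (a "word") with letters `y dx/(1 - yx)`, `y = 1 - e^{-T_i}`, and `dx/(1-x)`; its
length is `∑ k_j` (`letterIntegral_eq`). What remains is to integrate this function of points `1 >
y_1 > ⋯ > y_r > 0` against powers of the differences `T_j - T_{j+1}` and the forms `dy/y` (`a_j =
1`) or `dy/y + dy/(1-y)` (`a_j = 0`).

The points are eliminated one at a time, the smallest first. The tool is `exists_expansion`:
differentiating a word in a parameter `u` and using partial fractions on neighbouring letters yields
shorter words, so by induction on the length the word is an integer combination of products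
(iterated integral up to `u`) × (word without `u`), homogeneous in length. It is used twice: to
write a word as iterated integrals up to the smallest point with poles at the others
(`word_mem_hyperlogSpan`), and, after that point has been integrated up to the next one, to treat
iterated integrals whose endpoint is also a pole (`diagonal_mem_hyperlogSpan`). The shuffle product
makes the resulting spaces `hyperlogSpan` multiplicative, with lengths adding up.

Integration against `dy/y` requires that nothing constant survives as `y → 0`. The integrand is at
most linear in each point (`Sublinear`), which forces the constant part of the expansion to vanish
(`constant_eq_zero`, `exists_nest_expansion`). For the last point, on the whole of `(0, 1)`, the
condition `a_1 = 1` supplies a leading `dx/x`; the resulting words in `dx/x` and `dx/(1-x)` are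
admissible, and their values lie in the span of multiple zeta values of the same weight
(`lintegral_nest_mem`, `ofReal_mem_mzvSpan`). -/

noncomputable section

namespace ArakawaKaneko

open PowerSeries

/-! ### Generating series of words -/

section Words

variable {R : Type*} [CommRing R]

/-- The series `∑_{n ≥ 1} β^n z^n = βz / (1 - βz)`. -/
def geom (β : R) : R⟦X⟧ := PowerSeries.mk fun n => if n = 0 then 0 else β ^ n

/-- The series attached to a letter: `none` is the form `dx/x`, and `some β` the form
`β dx / (1 - βx)`. -/
def letterSeries : Option R → R⟦X⟧
  | none => 1
  | some β => geom β

@[simp] lemma coeff_geom (β : R) (n : ℕ) :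
    coeff n (geom β) = if n = 0 then 0 else β ^ n := by simp [geom]

lemma geom_eq (β : R) : geom β = C β * X + C β * X * geom β := by
  ext n
  rcases n with _ | n
  · simp [mul_assoc]
  · rcases n with _ | n
    · simp [mul_assoc, coeff_succ_X_mul]
    · simp [mul_assoc, coeff_succ_X_mul, pow_succ']

lemma one_sub_mul_geom (β : R) : (1 - C β * X) * geom β = C β * X := by
  linear_combination geom_eq β

lemma isUnit_one_sub (β : R) : IsUnit (1 - C β * X : R⟦X⟧) := by
  rw [PowerSeries.isUnit_iff_constantCoeff]; simp

/-- The Euler derivation `z d/dz`. -/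
def theta : Derivation R R⟦X⟧ R⟦X⟧ := (X : R⟦X⟧) • derivative R

lemma coeff_theta (f : R⟦X⟧) (n : ℕ) : coeff n (theta f) = n * coeff n f := by
  rw [theta, Derivation.smul_apply, smul_eq_mul]
  rcases n with _ | n
  · simp
  · rw [coeff_succ_X_mul, coeff_derivative]; push_cast; ring

/-- Partial fractions for a product of two geometric series. -/
lemma geom_mul_geom (b y k : R) (h : k * (b - y) = y) :
    geom y * geom b = C k * geom b - (1 + C k) * geom y := by
  have hb := one_sub_mul_geom b
  have hy := one_sub_mul_geom y
  have hC : C k * (C b - C y) = (C y : R⟦X⟧) := by rw [← map_sub, ← map_mul, h]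
  have hu := (isUnit_one_sub b).mul (isUnit_one_sub y)
  apply hu.mul_left_cancel
  linear_combination (C y * X - (1 - C y * X) * C k) * hb +
    (geom b * (1 - C b * X) + (1 - C b * X) * (1 + C k)) * hy + (-X) * hC

variable [Algebra ℚ R]

/-- The formal primitive for the Euler derivation, with vanishing constant term. -/
def primitive (f : R⟦X⟧) : R⟦X⟧ := PowerSeries.mk fun n => ((n : ℚ)⁻¹) • coeff n f

/-- The generating series of the iterated sums (iterated integrals) attached to a word. -/
def wordSeries : List (Option R) → R⟦X⟧
  | [] => 1
  | a :: w => primitive (letterSeries a * wordSeries w)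

/-- The last letter of the word is not `none`. -/
def GoodEnd {α : Type*} : List (Option α) → Prop
  | [] => True
  | a :: w => (w = [] → a ≠ none) ∧ GoodEnd w

@[simp] lemma goodEnd_nil {α : Type*} : GoodEnd ([] : List (Option α)) := trivial

lemma goodEnd_cons {α : Type*} {a : Option α} {w : List (Option α)} :
    GoodEnd (a :: w) ↔ (w = [] → a ≠ none) ∧ GoodEnd w := Iff.rfl

lemma GoodEnd.map {α β : Type*} (f : α → β) {w : List (Option α)} (h : GoodEnd w) :
    GoodEnd (w.map (Option.map f)) := by
  induction w with
  | nil => trivial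
  | cons a w ih => exact ⟨by simpa using h.1, ih h.2⟩

@[simp] lemma coeff_zero_wordSeries_cons (a : Option R) (w : List (Option R)) :
    coeff 0 (wordSeries (a :: w)) = 0 := by
  simp [wordSeries, primitive]

lemma theta_primitive {f : R⟦X⟧} (hf : coeff 0 f = 0) : theta (primitive f) = f := by
  ext n
  rw [coeff_theta, primitive, coeff_mk]
  rcases n with _ | n
  · rw [hf]; simp
  · have : (((n + 1 : ℕ) : R)) = algebraMap ℚ R ((n + 1 : ℕ) : ℚ) := by simp
    rw [this, ← Algebra.smul_def, smul_smul, mul_inv_cancel₀ (by positivity), one_smul]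

/-- `primitive` inverts the Euler derivation only on series without constant term. A last letter
that is not `dx/x` ensures this at every stage. -/
lemma theta_wordSeries_cons {a : Option R} {w : List (Option R)} (h : GoodEnd (a :: w)) :
    theta (wordSeries (a :: w)) = letterSeries a * wordSeries w := by
  apply theta_primitive
  rcases w with _ | ⟨b, w⟩
  · rcases a with _ | β
    · exact absurd rfl (h.1 rfl)
    · simp [wordSeries, letterSeries]
  · have h0 := coeff_zero_wordSeries_cons b w
    rw [coeff_zero_eq_constantCoeff] at h0 ⊢
    rw [map_mul, h0, mul_zero]

/-- Positive integers are invertible in a `ℚ`-algebra, so the Euler derivation kills only constants.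
Identities between words are proved by differentiating and comparing constant terms. -/
lemma eq_of_theta_eq {f g : R⟦X⟧} (h : theta f = theta g) (h0 : coeff 0 f = coeff 0 g) :
    f = g := by
  ext n
  rcases n with _ | n
  · exact h0
  · have := congrArg (coeff (n + 1)) h
    rw [coeff_theta, coeff_theta] at this
    have hc : (((n + 1 : ℕ) : R)) = algebraMap ℚ R ((n + 1 : ℕ) : ℚ) := by simp
    rw [hc, ← Algebra.smul_def, ← Algebra.smul_def] at this
    have h2 := congrArg (fun x => (((n + 1 : ℕ) : ℚ))⁻¹ • x) this
    simpa only [smul_smul, inv_mul_cancel₀ (show (((n + 1 : ℕ) : ℚ)) ≠ 0 by positivity),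
      one_smul] using h2

/-- Base change lets one word be read with real, polynomial or power series parameters. -/
lemma wordSeries_map {S : Type*} [CommRing S] [Algebra ℚ S] (f : R →ₐ[ℚ] S)
    (w : List (Option R)) :
    wordSeries (w.map (Option.map f)) = PowerSeries.map (f : R →+* S) (wordSeries w) := by
  induction w with
  | nil => simp [wordSeries]
  | cons a w ih =>
    have hl : letterSeries (Option.map f a) = PowerSeries.map (f : R →+* S) (letterSeries a) := by
      rcases a with _ | β
      · simp [letterSeries]
      · ext n
        by_cases hn : n = 0 <;> simp [letterSeries, hn]
    rw [List.map_cons, wordSeries, wordSeries, ih, hl]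
    ext n
    rw [← map_mul (PowerSeries.map (f : R →+* S))]
    simp only [primitive, coeff_mk, coeff_map]
    exact (map_smul f _ _).symm

/-! ### The shuffle product -/

/-- All shuffles of two words. -/
def shuffle {α : Type*} : List α → List α → List (List α)
  | [], v => [v]
  | a :: u, [] => [a :: u]
  | a :: u, b :: v => (shuffle u (b :: v)).map (a :: ·) ++ (shuffle (a :: u) v).map (b :: ·)

lemma length_of_mem_shuffle {α : Type*} {u v w : List α} (h : w ∈ shuffle u v) :
    w.length = u.length + v.length := by
  induction u, v using shuffle.induct generalizing w with
  | case1 v => simp_all [shuffle]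
  | case2 a u => simp_all [shuffle]
  | case3 a u b v ih1 ih2 =>
    simp only [shuffle, List.mem_append, List.mem_map] at h
    rcases h with ⟨x, hx, rfl⟩ | ⟨x, hx, rfl⟩
    · simp [ih1 hx]; omega
    · simp [ih2 hx]; omega

lemma goodEnd_of_mem_shuffle {α : Type*} {u v w : List (Option α)} (h : w ∈ shuffle u v)
    (hu : GoodEnd u) (hv : GoodEnd v) : GoodEnd w := by
  induction u, v using shuffle.induct generalizing w with
  | case1 v => simp_all [shuffle]
  | case2 a u => simp_all [shuffle]
  | case3 a u b v ih1 ih2 =>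
    simp only [shuffle, List.mem_append, List.mem_map] at h
    rcases h with ⟨x, hx, rfl⟩ | ⟨x, hx, rfl⟩
    · refine ⟨fun h => ?_, ih1 hx hu.2 hv⟩
      have := length_of_mem_shuffle hx
      simp [h] at this
    · refine ⟨fun h => ?_, ih2 hx hu hv.2⟩
      have := length_of_mem_shuffle hx
      simp only [h, List.length_nil, List.length_cons] at this
      omega

lemma head?_of_mem_shuffle {α : Type*} {u v w : List α} (h : w ∈ shuffle u v) :
    w.head? = u.head? ∨ w.head? = v.head? := by
  induction u, v using shuffle.induct generalizing w with
  | case1 v => simp_all [shuffle]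
  | case2 a u => simp_all [shuffle]
  | case3 a u b v ih1 ih2 =>
    simp only [shuffle, List.mem_append, List.mem_map] at h
    rcases h with ⟨x, hx, rfl⟩ | ⟨x, hx, rfl⟩ <;> simp

lemma shuffle_map {α β : Type*} (f : α → β) (u v : List α) :
    shuffle (u.map f) (v.map f) = (shuffle u v).map (List.map f) := by
  induction u, v using shuffle.induct with
  | case1 v => simp [shuffle]
  | case2 a u => simp [shuffle]
  | case3 a u b v ih1 ih2 =>
    simp only [List.map_cons] at ih1 ih2
    simp [shuffle, ih1, ih2, Function.comp_def]

/-- The Leibniz rule removes the first letter of either factor, which is the recursion defining the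
shuffle product. -/
lemma wordSeries_mul {u v : List (Option R)} (hu : GoodEnd u) (hv : GoodEnd v) :
    wordSeries u * wordSeries v = ((shuffle u v).map wordSeries).sum := by
  induction u, v using shuffle.induct with
  | case1 v => simp [shuffle, wordSeries]
  | case2 a u => simp [shuffle, wordSeries]
  | case3 a u b v ih1 ih2 =>
    have key : ∀ (a : Option R) (l : List (List (Option R))), (∀ w ∈ l, GoodEnd (a :: w)) →
        theta ((l.map (fun w => wordSeries (a :: w))).sum) =
          letterSeries a * (l.map wordSeries).sum := by
      intro a l hl
      induction l with
      | nil => simp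
      | cons w l ih =>
        simp only [List.map_cons, List.sum_cons, map_add, mul_add]
        rw [theta_wordSeries_cons (hl w (by simp)), ih fun w hw => hl w (by simp [hw])]
    have h0 : ∀ (a : Option R) (l : List (List (Option R))),
        coeff 0 ((l.map (fun w => wordSeries (a :: w))).sum) = 0 := by
      intro a l
      induction l with
      | nil => simp
      | cons w l ih => simp only [List.map_cons, List.sum_cons, map_add, ih, add_zero,
          coeff_zero_wordSeries_cons]
    rw [shuffle, List.map_append, List.sum_append, List.map_map, List.map_map]
    apply eq_of_theta_eq
    · rw [Derivation.leibniz, theta_wordSeries_cons hu, theta_wordSeries_cons hv, map_add]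
      have e1 := key a (shuffle u (b :: v)) fun w hw =>
        ⟨fun h => by have := length_of_mem_shuffle hw; simp [h] at this,
          goodEnd_of_mem_shuffle hw hu.2 hv⟩
      have e2 := key b (shuffle (a :: u) v) fun w hw =>
        ⟨fun h => by
          have := length_of_mem_shuffle hw
          simp only [h, List.length_nil, List.length_cons] at this
          omega, goodEnd_of_mem_shuffle hw hu hv.2⟩
      simp only [Function.comp_def]
      rw [e1, e2, ← ih1 hu.2 hv, ← ih2 hu hv.2]
      simp only [smul_eq_mul]
      ring
    · rw [map_add]
      have e1 := h0 a (shuffle u (b :: v))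
      have e2 := h0 b (shuffle (a :: u) v)
      simp only [Function.comp_def]
      rw [e1, e2]
      have h3 := coeff_zero_wordSeries_cons a u
      rw [coeff_zero_eq_constantCoeff] at h3 ⊢
      rw [map_mul, h3, zero_mul, add_zero]

end Words

end ArakawaKaneko

end

noncomputable section

namespace ArakawaKaneko

open PowerSeries

/-! ### Convergence of the sums attached to words -/

lemma coeff_wordSeries_cons (a : Option ℝ) (w : List (Option ℝ)) (m : ℕ) :
    coeff m (wordSeries (a :: w)) = (m : ℝ)⁻¹ * coeff m (letterSeries a * wordSeries w) := by
  simp [wordSeries, primitive, Rat.smul_def]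

/-- The substitution `z ↦ sz` fixes `dz/z` and multiplies each parameter by `s`. Iterated integrals
up to `s` thus become values at 1. -/
lemma wordSeries_scale {R : Type*} [CommRing R] [Algebra ℚ R] (s : R) (w : List (Option R)) :
    wordSeries (w.map (Option.map (s * ·))) = rescale s (wordSeries w) := by
  induction w with
  | nil => simp [wordSeries]
  | cons a w ih =>
    have hl : letterSeries (Option.map (s * ·) a) = rescale s (letterSeries a) := by
      rcases a with _ | β
      · simp [letterSeries]
      · ext n
        by_cases hn : n = 0 <;> simp [letterSeries, hn, mul_pow]
    rw [List.map_cons, wordSeries, wordSeries, ih, hl, ← map_mul]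
    ext n
    simp only [primitive, coeff_mk, coeff_rescale, mul_smul_comm]

/-- All the parameters of the word lie in `[0, 1]`. -/
def UnitWord (w : List (Option ℝ)) : Prop := ∀ β, some β ∈ w → 0 ≤ β ∧ β ≤ 1

lemma UnitWord.tail {a : Option ℝ} {w : List (Option ℝ)} (h : UnitWord (a :: w)) :
    UnitWord w := fun β hβ => h β (List.mem_cons_of_mem _ hβ)

lemma coeff_wordSeries_nonneg {w : List (Option ℝ)} (hw : ∀ β, some β ∈ w → 0 ≤ β) (m : ℕ) :
    0 ≤ coeff m (wordSeries w) := by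
  induction w generalizing m with
  | nil => rw [wordSeries, coeff_one]; split_ifs <;> norm_num
  | cons a w ih =>
    have ih' := ih fun β hβ => hw β (List.mem_cons_of_mem _ hβ)
    rw [coeff_wordSeries_cons, coeff_mul]
    refine mul_nonneg (by positivity) (Finset.sum_nonneg fun p _ => mul_nonneg ?_ (ih' _))
    rcases a with _ | β
    · rw [letterSeries, coeff_one]; split_ifs <;> norm_num
    · rw [letterSeries, coeff_geom]
      split_ifs
      · exact le_rfl
      · exact pow_nonneg (hw β (by simp)) _

lemma sum_inv_sqrt_le (m : ℕ) :
    ∑ j ∈ Finset.range m, 1 / Real.sqrt (j + 1) ≤ 2 * Real.sqrt m := by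
  induction m with
  | zero => simp
  | succ m ih =>
    rw [Finset.sum_range_succ]
    push_cast
    have h1 := Real.sq_sqrt (show (0 : ℝ) ≤ m by positivity)
    have h2 := Real.sq_sqrt (show (0 : ℝ) ≤ m + 1 by positivity)
    have h3 : 0 < Real.sqrt ((m : ℝ) + 1) := Real.sqrt_pos.2 (by positivity)
    have h4 := Real.sqrt_nonneg (m : ℝ)
    have : 1 / Real.sqrt ((m : ℝ) + 1) ≤ 2 * Real.sqrt (m + 1) - 2 * Real.sqrt m := by
      rw [div_le_iff₀ h3]
      nlinarith [sq_nonneg (Real.sqrt ((m : ℝ) + 1) - Real.sqrt m)]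
    linarith

lemma coeff_geom_mul_le {β : ℝ} (h0 : 0 ≤ β) (h1 : β ≤ 1) {f : ℝ⟦X⟧}
    (hf : ∀ m, 0 ≤ coeff m f) (m : ℕ) :
    coeff m (geom β * f) ≤ ∑ j ∈ Finset.range m, coeff j f := by
  rw [mul_comm, coeff_mul, Finset.Nat.sum_antidiagonal_eq_sum_range_succ
    (fun i j => coeff i f * coeff j (geom β)), Finset.sum_range_succ]
  simp only [Nat.sub_self, coeff_geom, if_true, mul_zero, add_zero]
  refine Finset.sum_le_sum fun j _ => ?_
  split_ifs
  · simpa using hf j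
  · exact mul_le_of_le_one_right (hf j) (pow_le_one₀ h0 h1)

/-- The order `m^{-1/2}` is crude but stable under every letter: `dx/x` only divides by `m`, and a
geometric letter yields at most `(1/m) ∑_{j<m} K/√(j+1) ≤ 2K/√m`. This avoids tracking powers of
logarithms. -/
lemma exists_coeff_wordSeries_le {w : List (Option ℝ)} (hw : UnitWord w) :
    ∃ K : ℝ, 0 ≤ K ∧ ∀ m, coeff m (wordSeries w) ≤ K / Real.sqrt (m + 1) := by
  induction w with
  | nil =>
    refine ⟨1, zero_le_one, fun m => ?_⟩
    rw [wordSeries, coeff_one]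
    split_ifs with h
    · simp [h]
    · positivity
  | cons a w ih =>
    obtain ⟨K, hK, h⟩ := ih hw.tail
    have hnn := coeff_wordSeries_nonneg (fun β hβ => (hw.tail β hβ).1)
    refine ⟨4 * K, by positivity, fun m => ?_⟩
    rcases m with _ | m
    · rw [coeff_zero_wordSeries_cons]; positivity
    rw [coeff_wordSeries_cons]
    set M : ℝ := ((m + 1 : ℕ) : ℝ) with hM
    have hM1 : 1 ≤ M := by rw [hM]; push_cast; linarith [(Nat.cast_nonneg m : (0 : ℝ) ≤ m)]
    have hs : 0 < Real.sqrt (M + 1) := Real.sqrt_pos.2 (by linarith)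
    have hs0 : 0 < Real.sqrt M := Real.sqrt_pos.2 (by linarith)
    rcases a with _ | β
    · rw [letterSeries, one_mul]
      have h1 : M⁻¹ ≤ 1 := inv_le_one_of_one_le₀ hM1
      calc M⁻¹ * coeff (m + 1) (wordSeries w) ≤ 1 * coeff (m + 1) (wordSeries w) :=
            mul_le_mul_of_nonneg_right h1 (hnn _)
        _ ≤ K / Real.sqrt (M + 1) := by rw [one_mul]; exact h _
        _ ≤ 4 * K / Real.sqrt (M + 1) := by gcongr; linarith
    · obtain ⟨hβ0, hβ1⟩ := hw β (by simp)
      have h1 : coeff (m + 1) (geom β * wordSeries w) ≤ K * (2 * Real.sqrt M) := by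
        refine (coeff_geom_mul_le hβ0 hβ1 hnn _).trans ?_
        refine (Finset.sum_le_sum fun j _ => h j).trans ?_
        have := mul_le_mul_of_nonneg_left (sum_inv_sqrt_le (m + 1)) hK
        rw [Finset.mul_sum] at this
        simpa [div_eq_mul_inv, hM] using this
      rw [letterSeries]
      calc M⁻¹ * coeff (m + 1) (geom β * wordSeries w) ≤ M⁻¹ * (K * (2 * Real.sqrt M)) := by
            gcongr
        _ = 2 * K / Real.sqrt M := by
            have := Real.mul_self_sqrt (show (0 : ℝ) ≤ M by linarith)
            rw [eq_div_iff hs0.ne']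
            field_simp
            nlinarith
        _ ≤ 4 * K / Real.sqrt (M + 1) := by
            rw [div_le_div_iff₀ hs0 hs]
            have h5 : Real.sqrt (M + 1) ≤ 2 * Real.sqrt M := by
              rw [Real.sqrt_le_left (by positivity), mul_pow, Real.sq_sqrt (by linarith)]
              linarith
            nlinarith

lemma tendsto_coeff_wordSeries {w : List (Option ℝ)} (hw : UnitWord w) :
    Filter.Tendsto (fun m => coeff m (wordSeries w)) Filter.atTop (nhds 0) := by
  obtain ⟨K, hK, h⟩ := exists_coeff_wordSeries_le hw
  refine squeeze_zero (coeff_wordSeries_nonneg fun β hβ => (hw β hβ).1) h ?_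
  refine Filter.Tendsto.div_atTop tendsto_const_nhds ?_
  exact Real.tendsto_sqrt_atTop.comp
    (Filter.tendsto_atTop_add_const_right _ _ tendsto_natCast_atTop_atTop)

lemma summable_coeff_wordSeries_div {w : List (Option ℝ)} (hw : UnitWord w) :
    Summable fun m : ℕ => ((m : ℝ) + 1)⁻¹ * coeff m (wordSeries w) := by
  obtain ⟨K, hK, h⟩ := exists_coeff_wordSeries_le hw
  have hs : Summable fun m : ℕ => 1 / ((m : ℝ) + 1) ^ (3 / 2 : ℝ) := by
    have := (summable_nat_add_iff 1).2
      (Real.summable_one_div_nat_rpow.2 (show (1 : ℝ) < 3 / 2 by norm_num))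
    simpa using this
  refine Summable.of_nonneg_of_le (fun m => mul_nonneg (by positivity)
    (coeff_wordSeries_nonneg (fun β hβ => (hw β hβ).1) m)) (fun m => ?_) (hs.mul_left K)
  have hm : (0 : ℝ) < (m : ℝ) + 1 := by positivity
  calc ((m : ℝ) + 1)⁻¹ * coeff m (wordSeries w)
      ≤ ((m : ℝ) + 1)⁻¹ * (K / Real.sqrt (m + 1)) := by gcongr; exact h m
    _ = K * (1 / ((m : ℝ) + 1) ^ (3 / 2 : ℝ)) := by
      rw [show (3 / 2 : ℝ) = 1 + 1 / 2 by norm_num, Real.rpow_add hm, Real.rpow_one,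
        ← Real.sqrt_eq_rpow]
      field_simp

/-- Words whose series converges at `1`: the parameters lie in `[0, 1]`, the first letter is not
`dx / (1 - x)` and the last one is not `dx / x`. -/
structure Convergent (w : List (Option ℝ)) : Prop where
  unit : UnitWord w
  head : ∀ β, w.head? = some (some β) → β < 1
  goodEnd : GoodEnd w

/-- A first letter `dx/x` supplies a factor `1/m`, enough for coefficients of order `m^{-1/2}`. A
first letter with `β < 1` gives a convolution with a geometric sequence. -/
lemma summable_coeff_wordSeries {w : List (Option ℝ)} (hw : UnitWord w)
    (hhead : ∀ β, w.head? = some (some β) → β < 1) :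
    Summable fun m => coeff m (wordSeries w) := by
  rcases w with _ | ⟨a, w⟩
  · refine summable_of_ne_finset_zero (s := {0}) fun m hm => ?_
    rw [wordSeries, coeff_one, if_neg (by simpa using hm)]
  have hs := summable_coeff_wordSeries_div hw.tail
  have hnn := coeff_wordSeries_nonneg (fun β hβ => (hw.tail β hβ).1)
  have hnn' := coeff_wordSeries_nonneg (fun β hβ => (hw β hβ).1)
  rcases a with _ | β
  · refine Summable.of_nonneg_of_le hnn' (fun m => ?_) (hs.mul_left 2)
    rw [coeff_wordSeries_cons, letterSeries, one_mul, ← mul_assoc]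
    refine mul_le_mul_of_nonneg_right ?_ (hnn m)
    rcases m with _ | m
    · simp
    · have : (0 : ℝ) < (m : ℝ) + 1 := by positivity
      push_cast
      rw [← div_eq_mul_inv, inv_eq_one_div, div_le_div_iff₀ (by positivity) (by positivity)]
      linarith
  · obtain ⟨hβ0, hβ1⟩ := hw β (by simp)
    have hβ2 : β < 1 := hhead β rfl
    have hg := summable_geometric_of_lt_one hβ0 hβ2
    have hp := summable_norm_sum_mul_antidiagonal_of_summable_norm hg.norm hs.norm
    refine Summable.of_nonneg_of_le hnn' (fun m => ?_) hp
    refine le_trans ?_ (Real.le_norm_self _)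
    rw [coeff_wordSeries_cons, letterSeries, coeff_mul, Finset.mul_sum]
    refine Finset.sum_le_sum fun p hp => ?_
    rw [Finset.HasAntidiagonal.mem_antidiagonal] at hp
    rw [coeff_geom]
    split_ifs with h
    · rw [zero_mul, mul_zero]
      exact mul_nonneg (pow_nonneg hβ0 _) (mul_nonneg (by positivity) (hnn _))
    · rw [← mul_assoc, ← mul_assoc, mul_comm (β ^ p.1)]
      refine mul_le_mul_of_nonneg_right (mul_le_mul_of_nonneg_right ?_ (pow_nonneg hβ0 _)) (hnn _)
      -- Here `p.1 ≠ 0`, so `p.2 + 1 ≤ m`, and the factor `1/m` can be moved onto the second factor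
      -- of the convolution.
      apply inv_anti₀ (by positivity)
      have : p.2 + 1 ≤ m := by omega
      exact_mod_cast this

lemma Convergent.summable {w : List (Option ℝ)} (hw : Convergent w) :
    Summable fun m => coeff m (wordSeries w) :=
  summable_coeff_wordSeries hw.unit hw.head

/-- The value at `1` of the series attached to a word. -/
def total (w : List (Option ℝ)) : ℝ := ∑' m, coeff m (wordSeries w)

@[simp] lemma total_nil : total [] = 1 := by
  rw [total, tsum_eq_single 0]
  · simp [wordSeries]
  · intro m hm
    rw [wordSeries, coeff_one, if_neg hm]

lemma total_nonneg {w : List (Option ℝ)} (hw : ∀ β, some β ∈ w → 0 ≤ β) : 0 ≤ total w :=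
  tsum_nonneg (coeff_wordSeries_nonneg hw)

lemma mem_of_mem_shuffle {α : Type*} {u v w : List α} (h : w ∈ shuffle u v) {a : α} (ha : a ∈ w) :
    a ∈ u ∨ a ∈ v := by
  induction u, v using shuffle.induct generalizing w with
  | case1 v => simp_all [shuffle]
  | case2 a u => simp_all [shuffle]
  | case3 a u b v ih1 ih2 =>
    simp only [shuffle, List.mem_append, List.mem_map] at h
    rcases h with ⟨x, hx, rfl⟩ | ⟨x, hx, rfl⟩
    · have := @ih1 x hx
      simp only [List.mem_cons] at ha this ⊢
      tauto
    · have := @ih2 x hx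
      simp only [List.mem_cons] at ha this ⊢
      tauto

lemma Convergent.of_mem_shuffle {u v w : List (Option ℝ)} (hu : Convergent u) (hv : Convergent v)
    (h : w ∈ shuffle u v) : Convergent w where
  unit β hβ := (mem_of_mem_shuffle h hβ).elim (hu.unit β) (hv.unit β)
  head β hβ := (head?_of_mem_shuffle h).elim (fun e => hu.head β (e ▸ hβ))
    (fun e => hv.head β (e ▸ hβ))
  goodEnd := goodEnd_of_mem_shuffle h hu.goodEnd hv.goodEnd

/-- The formal shuffle identity summed by a Cauchy product; the first letter of a shuffle comes from
one of the factors, so convergence is preserved. -/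
lemma total_mul {u v : List (Option ℝ)} (hu : Convergent u) (hv : Convergent v) :
    total u * total v = ((shuffle u v).map total).sum := by
  rw [total, total, tsum_mul_tsum_eq_tsum_sum_antidiagonal_of_summable_norm
    hu.summable.norm hv.summable.norm]
  have h1 : ∀ m, ∑ kl ∈ Finset.HasAntidiagonal.antidiagonal m, coeff kl.1 (wordSeries u) *
      coeff kl.2 (wordSeries v) = ((shuffle u v).map fun w => coeff m (wordSeries w)).sum := by
    intro m
    rw [← coeff_mul, wordSeries_mul hu.goodEnd hv.goodEnd, map_list_sum, List.map_map]
    rfl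
  simp only [h1]
  have h2 : ∀ l : List (List (Option ℝ)), (∀ w ∈ l, Convergent w) →
      HasSum (fun m => (l.map fun w => coeff m (wordSeries w)).sum) ((l.map total).sum) := by
    intro l hl
    induction l with
    | nil => simp
    | cons w l ih =>
      simp only [List.map_cons, List.sum_cons]
      exact (hl w (by simp)).summable.hasSum.add (ih fun x hx => hl x (by simp [hx]))
  exact (h2 _ fun w hw => hu.of_mem_shuffle hv hw).tsum_eq

end ArakawaKaneko

end

noncomputable section

namespace ArakawaKaneko

open PowerSeries

/-! ### Differentiating a word with respect to a parameter -/

section Coefficientwise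

lemma theta_mul {R : Type*} [CommRing R] (f g : R⟦X⟧) :
    theta (f * g) = f * theta g + theta f * g := by
  rw [Derivation.leibniz, smul_eq_mul, smul_eq_mul, mul_comm g]

variable {R : Type*} [CommRing R] [Algebra ℚ R]

/-- The coefficientwise extension of a derivation to power series. -/
def mapDeriv (δ : Derivation ℚ R R) : R⟦X⟧ →+ R⟦X⟧ where
  toFun f := PowerSeries.mk fun n => δ (coeff n f)
  map_zero' := by ext; simp
  map_add' f g := by ext; simp

@[simp] lemma coeff_mapDeriv (δ : Derivation ℚ R R) (f : R⟦X⟧) (n : ℕ) :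
    coeff n (mapDeriv δ f) = δ (coeff n f) := by simp [mapDeriv]

lemma mapDeriv_mul (δ : Derivation ℚ R R) (f g : R⟦X⟧) :
    mapDeriv δ (f * g) = f * mapDeriv δ g + mapDeriv δ f * g := by
  ext n
  simp only [coeff_mapDeriv, coeff_mul, map_add, map_sum, Derivation.leibniz, smul_eq_mul]
  rw [← Finset.sum_add_distrib]
  exact Finset.sum_congr rfl fun p _ => by ring

lemma theta_mapDeriv (δ : Derivation ℚ R R) (f : R⟦X⟧) :
    theta (mapDeriv δ f) = mapDeriv δ (theta f) := by
  ext n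
  simp [coeff_theta, Derivation.leibniz]

lemma mapDeriv_one (δ : Derivation ℚ R R) : mapDeriv δ (1 : R⟦X⟧) = 0 := by
  ext n
  rw [coeff_mapDeriv, coeff_one]
  split_ifs <;> simp

lemma mapDeriv_geom_of_eq_zero (δ : Derivation ℚ R R) {β : R} (h : δ β = 0) :
    mapDeriv δ (geom β) = 0 := by
  ext n
  rw [coeff_mapDeriv, coeff_geom]
  split_ifs <;> simp [h]

/-- The letter depends on `β` and `z` only through `βz`, so differentiating in the parameter is the
same as differentiating in `z`. -/
lemma mapDeriv_geom_of_eq_self (δ : Derivation ℚ R R) {β : R} (h : δ β = β) :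
    mapDeriv δ (geom β) = theta (geom β) := by
  ext n
  rw [coeff_mapDeriv, coeff_geom, coeff_theta, coeff_geom]
  split_ifs with hn
  · simp
  · rw [Derivation.leibniz_pow, h, smul_eq_mul, nsmul_eq_mul, ← pow_succ,
      Nat.sub_add_cancel (Nat.pos_of_ne_zero hn)]

end Coefficientwise

section Expansion

variable {ι κ : Type*}

/-- Letters depending on constants `b i` and on multiples `c j * u` of a formal variable `u`. -/
def formalLetter (b : ι → ℝ) (c : κ → ℝ) : ι ⊕ κ → ℝ⟦X⟧ :=
  Sum.elim (fun i => C (b i)) (fun j => C (c j) * X)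

/-- The word series with coefficients in the power series in the variable `u`. -/
def formalSeries (b : ι → ℝ) (c : κ → ℝ) (w : List (Option (ι ⊕ κ))) : ℝ⟦X⟧⟦X⟧ :=
  wordSeries (w.map (Option.map (formalLetter b c)))

/-- A term `± κ * (word)` in the derivative of a word; `none` stands for the coefficient `1` and
`some (j, i)` for the coefficient `c j u / (b i - c j u)`. -/
abbrev Term (ι κ : Type*) := ℤ × Option (κ × ι) × List (Option (ι ⊕ κ))

/-- The terms arising from a pair of neighbouring letters. -/
def pairTerms : Option (ι ⊕ κ) → Option (ι ⊕ κ) → List (Option (ι ⊕ κ)) → List (Term ι κ)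
  | some (.inr j), some (.inl i), w =>
    [(-1, some (j, i), some (.inl i) :: w), (1, none, some (.inr j) :: w),
      (1, some (j, i), some (.inr j) :: w)]
  | some (.inl i), some (.inr j), w =>
    [(1, some (j, i), some (.inl i) :: w), (-1, none, some (.inr j) :: w),
      (-1, some (j, i), some (.inr j) :: w)]
  | some (.inr j), none, w => [(-1, none, some (.inr j) :: w)]
  | none, some (.inr j), w => [(1, none, some (.inr j) :: w)]
  | _, _, _ => []

/-- Prepend a letter to the word of a term. -/
def Term.cons (a : Option (ι ⊕ κ)) (t : Term ι κ) : Term ι κ := (t.1, t.2.1, a :: t.2.2)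

/-- The terms arising from all pairs of neighbouring letters of a word. -/
def innerTerms : List (Option (ι ⊕ κ)) → List (Term ι κ)
  | [] => []
  | [_] => []
  | a :: a' :: w => pairTerms a a' w ++ (innerTerms (a' :: w)).map (Term.cons a)

/-- The coefficient of a term, as a series in `u`. -/
def termCoeff (b : ι → ℝ) (c : κ → ℝ) (k : Option (κ × ι)) : ℝ⟦X⟧ :=
  letterSeries (k.map fun p => c p.1 / b p.2)

/-- The formal value of a term. -/
def termSeries (b : ι → ℝ) (c : κ → ℝ) (t : Term ι κ) : ℝ⟦X⟧⟦X⟧ :=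
  C ((t.1 : ℝ⟦X⟧) * termCoeff b c t.2.1) * formalSeries b c t.2.2

/-- The term arising from differentiating the first letter. -/
def headSeries (b : ι → ℝ) (c : κ → ℝ) : List (Option (ι ⊕ κ)) → ℝ⟦X⟧⟦X⟧
  | some (.inr j) :: w => geom (C (c j) * X) * formalSeries b c w
  | _ => 0

/-- The Euler derivation `u d/du`. -/
def delta : Derivation ℚ ℝ⟦X⟧ ℝ⟦X⟧ := (theta (R := ℝ)).restrictScalars ℚ

lemma delta_apply (f : ℝ⟦X⟧) : delta f = theta f := rfl

lemma delta_C (x : ℝ) : delta (C x : ℝ⟦X⟧) = 0 := by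
  ext n
  rw [delta_apply, coeff_theta, coeff_C]
  split_ifs with h <;> simp [h]

lemma delta_C_mul_X (x : ℝ) : delta (C x * X : ℝ⟦X⟧) = C x * X := by
  ext n
  rw [delta_apply, coeff_theta, coeff_C_mul, coeff_X]
  split_ifs with h <;> simp [h]

/-- The partial fraction coefficient `cu/(b - cu)`, expanded in `u`, is itself the geometric letter
with parameter `c/b`. For this reason the expansion of a word again consists of words. -/
lemma geom_div_mul {b : ℝ} (c : ℝ) (hb : b ≠ 0) :
    geom (c / b) * (C b - C c * X) = (C c * X : ℝ⟦X⟧) := by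
  have h := one_sub_mul_geom (c / b)
  have hC : (C (c / b) * C b : ℝ⟦X⟧) = C c := by rw [← map_mul, div_mul_cancel₀ _ hb]
  linear_combination C b * h + (1 + geom (c / b)) * X * hC

lemma formalSeries_cons (b : ι → ℝ) (c : κ → ℝ) (a : Option (ι ⊕ κ)) (w) :
    formalSeries b c (a :: w) =
      primitive (letterSeries (Option.map (formalLetter b c) a) * formalSeries b c w) := rfl

lemma theta_formalSeries_cons (b : ι → ℝ) (c : κ → ℝ) {a : Option (ι ⊕ κ)} {w}
    (h : GoodEnd (a :: w)) : theta (formalSeries b c (a :: w)) =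
      letterSeries (Option.map (formalLetter b c) a) * formalSeries b c w :=
  theta_wordSeries_cons (GoodEnd.map _ h)

lemma theta_C_mul (r : ℝ⟦X⟧) (f : ℝ⟦X⟧⟦X⟧) : theta (C r * f) = C r * theta f := by
  ext1 n
  rw [coeff_theta, coeff_C_mul, coeff_C_mul, coeff_theta]
  ring

lemma goodEnd_of_mem_pairTerms {a a' : Option (ι ⊕ κ)} {w} (h : GoodEnd (a' :: w))
    {t : Term ι κ} (ht : t ∈ pairTerms a a' w) : GoodEnd t.2.2 := by
  have hw := h.2
  rcases a with _ | i | j <;> rcases a' with _ | i' | j' <;> simp [pairTerms] at ht <;>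
    (try rcases ht with rfl | rfl | rfl) <;> exact ⟨by simp, hw⟩

lemma goodEnd_of_mem_innerTerms {w : List (Option (ι ⊕ κ))} (h : GoodEnd w)
    {t : Term ι κ} (ht : t ∈ innerTerms w) : GoodEnd t.2.2 ∧ t.2.2 ≠ [] := by
  induction w generalizing t with
  | nil => simp [innerTerms] at ht
  | cons a w ih =>
    rcases w with _ | ⟨a', w⟩
    · simp [innerTerms] at ht
    · rw [innerTerms, List.mem_append, List.mem_map] at ht
      rcases ht with ht | ⟨t, ht, rfl⟩
      · refine ⟨goodEnd_of_mem_pairTerms h.2 ht, ?_⟩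
        rcases a with _ | i | j <;> rcases a' with _ | i' | j' <;> simp [pairTerms] at ht <;>
          (try rcases ht with rfl | rfl | rfl) <;> simp
      · have := ih h.2 ht
        exact ⟨⟨fun e => absurd e this.2, this.1⟩, by simp [Term.cons]⟩

/-- `1` if the letter depends on the variable `u`, and `0` otherwise. -/
def isVar : Option (ι ⊕ κ) → ℝ⟦X⟧⟦X⟧
  | some (.inr _) => 1
  | _ => 0

/-- Only `isVar a' - isVar a` matters: two constant or two variable neighbours contribute nothing,
and in the mixed cases the product of the two letters is resolved by partial fractions. -/
lemma theta_pairTerms {b : ι → ℝ} (c : κ → ℝ) (hb : ∀ i, b i ≠ 0) (a a' : Option (ι ⊕ κ)) (w)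
    (h : GoodEnd (a' :: w)) :
    theta (((pairTerms a a' w).map (termSeries b c)).sum) =
      (isVar a' - isVar a) * (letterSeries (Option.map (formalLetter b c) a) *
        (letterSeries (Option.map (formalLetter b c) a') * formalSeries b c w)) := by
  have hgg := fun i j => geom_mul_geom (R := ℝ⟦X⟧) (C (b i)) (C (c j) * X) (geom (c j / b i))
    (geom_div_mul (c j) (hb i))
  have hth : ∀ x : ι ⊕ κ, theta (formalSeries b c (some x :: w)) =
      geom (formalLetter b c x) * formalSeries b c w := fun x =>
    theta_formalSeries_cons b c ⟨by simp, h.2⟩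
  rcases a with _ | i | j <;> rcases a' with _ | i' | j' <;>
    simp only [pairTerms, List.map_cons, List.map_nil, List.sum_cons, List.sum_nil, isVar,
      termSeries, map_add, theta_C_mul, hth, formalLetter, Sum.elim_inl, Sum.elim_inr,
      letterSeries, termCoeff, Option.map_some, Option.map_none, map_zero, map_one,
      sub_self, zero_mul, sub_zero, zero_sub, one_mul, mul_one, Int.cast_one, Int.cast_neg, map_neg,
      neg_mul]
  · ring
  · linear_combination (-formalSeries b c w) * hgg i j'
  · ring
  · linear_combination formalSeries b c w * hgg i' j

lemma isVar_mul_letter (b : ι → ℝ) (c : κ → ℝ) (a : Option (ι ⊕ κ)) :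
    mapDeriv delta (letterSeries (Option.map (formalLetter b c) a)) =
      isVar a * theta (letterSeries (Option.map (formalLetter b c) a)) := by
  rcases a with _ | i | j
  · simp [letterSeries, mapDeriv_one, isVar]
  · simp [letterSeries, isVar, formalLetter, mapDeriv_geom_of_eq_zero _ (delta_C (b i))]
  · simp [letterSeries, isVar, formalLetter, mapDeriv_geom_of_eq_self _ (delta_C_mul_X (c j))]

lemma headSeries_cons (b : ι → ℝ) (c : κ → ℝ) (a : Option (ι ⊕ κ)) (w) :
    headSeries b c (a :: w) =
      isVar a * (letterSeries (Option.map (formalLetter b c) a) * formalSeries b c w) := by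
  rcases a with _ | i | j <;> simp [headSeries, isVar, letterSeries, formalLetter]

lemma theta_isVar_mul (a : Option (ι ⊕ κ)) (f : ℝ⟦X⟧⟦X⟧) :
    theta (isVar a * f) = isVar a * theta f := by
  rcases a with _ | i | j <;> simp [isVar]

lemma coeff_zero_isVar_mul (a : Option (ι ⊕ κ)) {f : ℝ⟦X⟧⟦X⟧} (h : coeff 0 f = 0) :
    coeff 0 (isVar a * f) = 0 := by
  rcases a with _ | i | j <;> simp_all [isVar]

lemma coeff_zero_letter_mul (b : ι → ℝ) (c : κ → ℝ) {a : Option (ι ⊕ κ)} {w}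
    (h : GoodEnd (a :: w)) :
    coeff 0 (letterSeries (Option.map (formalLetter b c) a) * formalSeries b c w) = 0 := by
  rw [← theta_formalSeries_cons b c h, coeff_theta]
  simp

lemma coeff_zero_sum_termSeries (b : ι → ℝ) (c : κ → ℝ) (l : List (Term ι κ))
    (h : ∀ t ∈ l, t.2.2 ≠ []) : coeff 0 ((l.map (termSeries b c)).sum) = 0 := by
  induction l with
  | nil => simp
  | cons t l ih =>
    rw [List.map_cons, List.sum_cons, map_add, ih fun t ht => h t (by simp [ht]), add_zero,
      termSeries, coeff_C_mul]
    obtain ⟨a, w, hw⟩ := List.exists_cons_of_ne_nil (h t (by simp))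
    rw [hw, formalSeries, List.map_cons, coeff_zero_wordSeries_cons, mul_zero]

/-- The derivative of a word. -/
lemma mapDeriv_formalSeries {b : ι → ℝ} (c : κ → ℝ) (hb : ∀ i, b i ≠ 0)
    {w : List (Option (ι ⊕ κ))} (h : GoodEnd w) :
    mapDeriv delta (formalSeries b c w) =
      headSeries b c w + ((innerTerms w).map (termSeries b c)).sum := by
  induction w with
  | nil => simp [formalSeries, wordSeries, mapDeriv_one, headSeries, innerTerms]
  | cons a w ih =>
    have ihw := ih h.2
    have e0 : coeff 0 (mapDeriv delta (formalSeries b c (a :: w))) = 0 := by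
      rw [coeff_mapDeriv, formalSeries, List.map_cons, coeff_zero_wordSeries_cons, map_zero]
    have e1 : coeff 0 (headSeries b c (a :: w) +
        ((innerTerms (a :: w)).map (termSeries b c)).sum) = 0 := by
      rw [map_add, headSeries_cons, coeff_zero_isVar_mul _ (coeff_zero_letter_mul b c h),
        coeff_zero_sum_termSeries b c _ fun t ht => (goodEnd_of_mem_innerTerms h ht).2, add_zero]
    apply eq_of_theta_eq _ (e0.trans e1.symm)
    -- The `u`-derivative of the first letter is traded for its `z`-derivative; the product rule
    -- then moves that derivative to the rest of the word, where it meets the second letter.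
    rw [theta_mapDeriv, theta_formalSeries_cons b c h, mapDeriv_mul, isVar_mul_letter, ihw,
      map_add, headSeries_cons, theta_isVar_mul, theta_mul]
    rcases w with _ | ⟨a', w⟩
    · have h1 : theta (formalSeries b c ([] : List (Option (ι ⊕ κ)))) = 0 := by
        simp [formalSeries, wordSeries]
      simp only [h1, headSeries, innerTerms, List.map_nil, List.sum_nil, map_zero]
      ring
    · rw [theta_formalSeries_cons b c h.2, headSeries_cons, innerTerms, List.map_append,
        List.sum_append, map_add, theta_pairTerms c hb _ _ _ h.2]
      have h2 : theta (((List.map (Term.cons a) (innerTerms (a' :: w))).map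
          (termSeries b c)).sum) = letterSeries (Option.map (formalLetter b c) a) *
            ((innerTerms (a' :: w)).map (termSeries b c)).sum := by
        have hl := fun t ht => goodEnd_of_mem_innerTerms (t := t) h.2 ht
        generalize innerTerms (a' :: w) = l at hl
        induction l with
        | nil => simp
        | cons t l ihl =>
          simp only [List.map_cons, List.sum_cons, map_add, mul_add]
          rw [ihl fun t ht => hl t (by simp [ht])]
          congr 1
          obtain ⟨ht1, ht2⟩ := hl t (by simp)
          rw [termSeries, termSeries, theta_C_mul, Term.cons,
            theta_formalSeries_cons b c ⟨fun e => absurd e ht2, ht1⟩]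
          ring
      rw [h2]
      ring

end Expansion

end ArakawaKaneko

end

/-! ### The derivative of the value of a word at `z = 1`. -/

noncomputable section

namespace ArakawaKaneko

open PowerSeries Filter Topology

section Expansion

variable {ι κ : Type*}

/-- A letter with constant `1` is not the first letter of the word. -/
def Admits (one : ι → Prop) (w : List (Option (ι ⊕ κ))) : Prop :=
  ∀ i, w.head? = some (some (.inl i)) → ¬ one i

/-- The word contains a letter depending on the variable. -/
def HasVar (w : List (Option (ι ⊕ κ))) : Prop := ∃ j, some (.inr j) ∈ w

open Classical in
/-- The terms in the derivative of the value at `1` of a word. -/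
def derivTerms (one : ι → Prop) (i₀ : ι) : List (Option (ι ⊕ κ)) → List (Term ι κ)
  | some (.inr j) :: w =>
    if Admits one w then (1, some (j, i₀), w) :: innerTerms (some (.inr j) :: w)
    -- If `w` begins with the pole 1, the term of the first letter would be divergent. It cancels
    -- against the first term of the first pair, equally divergent, so both are omitted.
    else (innerTerms (some (.inr j) :: w)).tail
  | w => innerTerms w

/-- Admissible parameters for evaluating words. -/
structure Params (one : ι → Prop) (b : ι → ℝ) (c : κ → ℝ) (u : ℝ) : Prop where
  b_pos : ∀ i, 0 < b i
  b_one : ∀ i, one i → b i = 1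
  b_lt : ∀ i, ¬ one i → b i < 1
  c_pos : ∀ j, 0 < c j
  u_pos : 0 < u
  lt : ∀ i j, c j * u < b i

/-- The error term in differentiating a partial sum. -/
def errorSeries (i₀ : ι) (b : ι → ℝ) (c : κ → ℝ) : List (Option (ι ⊕ κ)) → ℝ⟦X⟧⟦X⟧
  | some (.inr j) :: w =>
    C (1 + geom (c j / b i₀)) * (geom (C (c j) * X) * formalSeries b c w)
  | _ => 0

section Terms

variable {one : ι → Prop} {i₀ : ι}

lemma length_of_mem_innerTerms {w : List (Option (ι ⊕ κ))} {t : Term ι κ}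
    (ht : t ∈ innerTerms w) : t.2.2.length + 1 = w.length := by
  induction w generalizing t with
  | nil => simp [innerTerms] at ht
  | cons a w ih =>
    rcases w with _ | ⟨a', w⟩
    · simp [innerTerms] at ht
    · rw [innerTerms, List.mem_append, List.mem_map] at ht
      rcases ht with ht | ⟨t, ht, rfl⟩
      · rcases a with _ | i | j <;> rcases a' with _ | i' | j' <;> simp [pairTerms] at ht <;>
          (try rcases ht with rfl | rfl | rfl) <;> simp
      · simpa [Term.cons] using ih ht

/-- A term with coefficient 1 is going to prepend `du/u`, which is harmless only if what follows
vanishes at `u = 0`; a variable letter guarantees that. -/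
lemma hasVar_of_mem_innerTerms {w : List (Option (ι ⊕ κ))} {t : Term ι κ}
    (ht : t ∈ innerTerms w) (hn : t.2.1 = none) : HasVar t.2.2 := by
  induction w generalizing t with
  | nil => simp [innerTerms] at ht
  | cons a w ih =>
    rcases w with _ | ⟨a', w⟩
    · simp [innerTerms] at ht
    · rw [innerTerms, List.mem_append, List.mem_map] at ht
      rcases ht with ht | ⟨t, ht, rfl⟩
      · rcases a with _ | i | j <;> rcases a' with _ | i' | j' <;> simp [pairTerms] at ht <;>
          (try rcases ht with rfl | rfl | rfl) <;> first | exact ⟨_, List.mem_cons_self⟩ | simp at hn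
      · obtain ⟨j, hj⟩ := ih ht hn
        exact ⟨j, List.mem_cons_of_mem _ hj⟩

lemma not_admits_iff {w : List (Option (ι ⊕ κ))} :
    ¬ Admits one w ↔ ∃ i w', one i ∧ w = some (.inl i) :: w' := by
  rcases w with _ | ⟨a, w⟩
  · simp [Admits]
  · simp only [Admits, List.head?_cons, Option.some.injEq, List.cons.injEq]
    push Not
    constructor
    · rintro ⟨i, rfl, h⟩; exact ⟨i, w, h, rfl, rfl⟩
    · rintro ⟨i, w', h, rfl, rfl⟩; exact ⟨i, rfl, h⟩

/-- The invariants of the induction on length: every surviving term is again evaluable at 1 and has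
lost exactly one letter. -/
lemma derivTerms_spec {w : List (Option (ι ⊕ κ))} (hg : GoodEnd w) (ha : Admits one w)
    {t : Term ι κ} (ht : t ∈ derivTerms one i₀ w) :
    GoodEnd t.2.2 ∧ Admits one t.2.2 ∧ t.2.2.length + 1 = w.length ∧
      (t.2.1 = none → HasVar t.2.2) := by
  have cons_admits : ∀ (a : Option (ι ⊕ κ)) (w w' : List (Option (ι ⊕ κ))),
      Admits one (a :: w) → Admits one (a :: w') := fun a w w' h i hi => h i (by simpa using hi)
  have inr_admits : ∀ (j : κ) (w : List (Option (ι ⊕ κ))), Admits one (some (.inr j) :: w) :=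
    fun j w i hi => by simp at hi
  have inner : t ∈ innerTerms w → Admits one t.2.2 → GoodEnd t.2.2 ∧ Admits one t.2.2 ∧
      t.2.2.length + 1 = w.length ∧ (t.2.1 = none → HasVar t.2.2) := fun h h' =>
    ⟨(goodEnd_of_mem_innerTerms hg h).1, h', length_of_mem_innerTerms h,
      hasVar_of_mem_innerTerms h⟩
  rcases w with _ | ⟨a, w⟩
  · simp [derivTerms, innerTerms] at ht
  have hcase : (∃ j, a = some (.inr j)) ∨ derivTerms one i₀ (a :: w) = innerTerms (a :: w) := by
    rcases a with _ | i | j <;> simp [derivTerms]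
  rcases hcase with ⟨j, rfl⟩ | h
  · rw [derivTerms] at ht
    split_ifs at ht with hw
    · rw [List.mem_cons] at ht
      rcases ht with rfl | ht
      · exact ⟨hg.2, hw, by simp, by simp⟩
      · refine inner ht ?_
        rcases w with _ | ⟨a', w⟩
        · simp [innerTerms] at ht
        rw [innerTerms, List.mem_append, List.mem_map] at ht
        rcases ht with ht | ⟨t, ht, rfl⟩
        · rcases a' with _ | i' | j' <;> simp [pairTerms] at ht
          · subst ht; exact inr_admits _ _
          · rcases ht with rfl | rfl | rfl
            · exact cons_admits _ _ _ hw
            · exact inr_admits _ _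
            · exact inr_admits _ _
        · exact inr_admits _ _
    · refine inner (List.mem_of_mem_tail ht) ?_
      obtain ⟨i, w', hi, rfl⟩ := not_admits_iff.1 hw
      simp only [innerTerms, pairTerms, List.cons_append, List.nil_append, List.tail_cons,
        List.mem_cons, List.mem_map] at ht
      rcases ht with rfl | rfl | ⟨t, ht, rfl⟩
      · exact inr_admits _ _
      · exact inr_admits _ _
      · exact inr_admits _ _
  · rw [h] at ht
    refine inner ht ?_
    rcases w with _ | ⟨a', w⟩
    · simp [innerTerms] at ht
    rw [innerTerms, List.mem_append, List.mem_map] at ht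
    rcases ht with ht | ⟨t, ht, rfl⟩
    · rcases a with _ | i | j
      · rcases a' with _ | i' | j' <;> simp [pairTerms] at ht
        subst ht; exact inr_admits _ _
      · rcases a' with _ | i' | j' <;> simp [pairTerms] at ht
        rcases ht with rfl | rfl | rfl
        · exact cons_admits _ _ _ ha
        · exact inr_admits _ _
        · exact inr_admits _ _
      · rcases a' with _ | i' | j' <;> simp [pairTerms] at ht
        · subst ht; exact inr_admits _ _
        · exfalso
          simp only [derivTerms] at h
          split_ifs at h
          · have := congrArg List.length h
            simp at this
          · have := congrArg List.length h
            simp [innerTerms, pairTerms] at this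
    · exact cons_admits _ _ _ ha

/-- Multiplication by `geom 1` turns coefficients into partial sums at `z = 1`. It thereby puts a
pole 1 in front of the word, and partial fractions with the first letter leave an evaluable term
plus an error that disappears in the limit. -/
lemma geom_mul_mapDeriv {b : ι → ℝ} (c : κ → ℝ) (hb : ∀ i, b i ≠ 0) (hone : ∀ i, one i → b i = 1)
    (hi₀ : one i₀) {w : List (Option (ι ⊕ κ))} (h : GoodEnd w) :
    mapDeriv delta (geom 1 * formalSeries b c w) =
      geom 1 * ((derivTerms one i₀ w).map (termSeries b c)).sum - errorSeries i₀ b c w := by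
  rw [mapDeriv_mul, mapDeriv_geom_of_eq_zero _ (by simp), zero_mul, add_zero,
    mapDeriv_formalSeries c hb h]
  rcases w with _ | ⟨a, w⟩
  · simp [derivTerms, headSeries, errorSeries]
  by_cases ha : ∃ j, a = some (.inr j)
  · obtain ⟨j, rfl⟩ := ha
    have hg := geom_mul_geom (R := ℝ⟦X⟧) (C (b i₀)) (C (c j) * X) (geom (c j / b i₀))
      (geom_div_mul (c j) (hb i₀))
    rw [hone _ hi₀, map_one] at hg
    rw [derivTerms, errorSeries, headSeries]
    split_ifs with hw
    · rw [List.map_cons, List.sum_cons, termSeries]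
      simp only [termCoeff, Option.map_some, letterSeries, Int.cast_one, one_mul, hone _ hi₀,
        map_add, map_one]
      linear_combination formalSeries b c w * hg
    · obtain ⟨i, w', hi, rfl⟩ := not_admits_iff.1 hw
      simp only [innerTerms, pairTerms, List.cons_append, List.nil_append, List.tail_cons,
        List.map_cons, List.sum_cons, termSeries]
      simp only [termCoeff, Option.map_some, letterSeries, Int.cast_one, one_mul, hone _ hi₀,
        hone _ hi, map_add, map_one, map_mul, map_neg, Int.cast_neg, Option.map_none]
      linear_combination formalSeries b c (some (.inl i) :: w') * hg
  · have h1 : derivTerms one i₀ (a :: w) = innerTerms (a :: w) := by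
      rcases a with _ | i | j
      · rfl
      · rfl
      · exact absurd ⟨j, rfl⟩ ha
    have h2 : headSeries b c (a :: w) = 0 := by
      rcases a with _ | i | j
      · rfl
      · rfl
      · exact absurd ⟨j, rfl⟩ ha
    have h3 : errorSeries i₀ b c (a :: w) = 0 := by
      rcases a with _ | i | j
      · rfl
      · rfl
      · exact absurd ⟨j, rfl⟩ ha
    rw [h1, h2, h3, zero_add, sub_zero]

end Terms

/-! ### Evaluating the variable -/

/-- The value of a letter at `u`. -/
def evalLetter (b : ι → ℝ) (c : κ → ℝ) (u : ℝ) : ι ⊕ κ → ℝ := Sum.elim b (fun j => c j * u)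

/-- The coefficient of `z^m u^l` in the series of a word. -/
def wordCoeff (b : ι → ℝ) (c : κ → ℝ) (w : List (Option (ι ⊕ κ))) (m l : ℕ) : ℝ :=
  coeff l (coeff m (formalSeries b c w))

/-- The coefficient of `u^l` in the value at `z = 1` of a word. -/
def valueCoeff (b : ι → ℝ) (c : κ → ℝ) (w : List (Option (ι ⊕ κ))) (l : ℕ) : ℝ :=
  ∑' m, wordCoeff b c w m l

/-- The formal word and its evaluation at `u` are two images of one word over `ℝ[u]`, so each
coefficient in `z` is a polynomial in `u`. -/
lemma exists_polynomial (b : ι → ℝ) (c : κ → ℝ) (w : List (Option (ι ⊕ κ))) (m : ℕ) :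
    ∃ p : Polynomial ℝ, (∀ l, wordCoeff b c w m l = p.coeff l) ∧
      ∀ u, coeff m (wordSeries (w.map (Option.map (evalLetter b c u)))) = p.eval u := by
  let lp : ι ⊕ κ → Polynomial ℝ :=
    Sum.elim (fun i => Polynomial.C (b i)) (fun j => Polynomial.C (c j) * Polynomial.X)
  refine ⟨coeff m (wordSeries (w.map (Option.map lp))), fun l => ?_, fun u => ?_⟩
  · have h := wordSeries_map (Polynomial.coeToPowerSeries.ringHom (R := ℝ)).toRatAlgHom
      (w.map (Option.map lp))
    rw [List.map_map, Option.map_comp_map] at h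
    have e : (⇑(Polynomial.coeToPowerSeries.ringHom (R := ℝ)).toRatAlgHom) ∘ lp =
        formalLetter b c := by
      ext x : 1
      rcases x with i | j <;> simp [lp, formalLetter]
    rw [e] at h
    rw [wordCoeff, formalSeries, h, coeff_map]
    simp
  · have h := wordSeries_map (Polynomial.evalRingHom u).toRatAlgHom (w.map (Option.map lp))
    rw [List.map_map, Option.map_comp_map] at h
    have e : (⇑(Polynomial.evalRingHom u).toRatAlgHom) ∘ lp = evalLetter b c u := by
      ext x : 1
      rcases x with i | j <;> simp [lp, evalLetter]
    rw [e] at h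
    rw [h, coeff_map]
    simp

lemma hasSum_wordCoeff (b : ι → ℝ) (c : κ → ℝ) (w : List (Option (ι ⊕ κ))) (m : ℕ) (u : ℝ) :
    HasSum (fun l => wordCoeff b c w m l * u ^ l)
      (coeff m (wordSeries (w.map (Option.map (evalLetter b c u))))) := by
  obtain ⟨p, h1, h2⟩ := exists_polynomial b c w m
  simp only [h1, h2, Polynomial.eval_eq_sum]
  exact hasSum_sum_of_ne_finset_zero fun l hl => by
    rw [Polynomial.notMem_support_iff.1 hl, zero_mul]

lemma coeff_formal_nonneg {b : ι → ℝ} {c : κ → ℝ} (hb : ∀ i, 0 < b i) (hc : ∀ j, 0 < c j)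
    (w : List (Option (ι ⊕ κ))) (m l : ℕ) : 0 ≤ wordCoeff b c w m l := by
  induction w generalizing m l with
  | nil =>
    rw [wordCoeff, formalSeries, List.map_nil, wordSeries, coeff_one]
    split_ifs
    · rw [coeff_one]; split_ifs <;> norm_num
    · simp
  | cons a w ih =>
    rw [wordCoeff, formalSeries_cons, primitive, coeff_mk, coeff_mul]
    rw [map_rat_smul (coeff l), map_sum, Rat.smul_def]
    refine mul_nonneg (by positivity) (Finset.sum_nonneg fun p _ => ?_)
    rw [coeff_mul]
    refine Finset.sum_nonneg fun q _ => mul_nonneg ?_ (ih _ _)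
    rcases a with _ | i | j
    · simp only [Option.map_none, letterSeries, coeff_one]
      split_ifs
      · rw [coeff_one]; split_ifs <;> norm_num
      · simp
    · simp only [Option.map_some, letterSeries, coeff_geom, formalLetter, Sum.elim_inl]
      split_ifs
      · simp
      · rw [← map_pow, coeff_C]
        split_ifs
        · exact pow_nonneg (hb i).le _
        · exact le_rfl
    · simp only [Option.map_some, letterSeries, coeff_geom, formalLetter, Sum.elim_inr]
      split_ifs
      · simp
      · rw [mul_pow, ← map_pow, coeff_C_mul, coeff_X_pow]
        refine mul_nonneg (pow_nonneg (hc j).le _) ?_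
        split_ifs <;> norm_num

variable {one : ι → Prop} {b : ι → ℝ} {c : κ → ℝ} {u : ℝ}

lemma Params.b_le (h : Params one b c u) (i : ι) : b i ≤ 1 := by
  by_cases hi : one i
  · exact (h.b_one i hi).le
  · exact (h.b_lt i hi).le

lemma Params.unitWord (h : Params one b c u) (hι : Nonempty ι) (w : List (Option (ι ⊕ κ))) :
    UnitWord (w.map (Option.map (evalLetter b c u))) := by
  intro β hβ
  rw [List.mem_map] at hβ
  obtain ⟨a, -, ha⟩ := hβ
  obtain ⟨i₁⟩ := hι
  rcases a with _ | i | j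
  · simp at ha
  · simp only [Option.map_some, evalLetter, Sum.elim_inl, Option.some.injEq] at ha
    exact ha ▸ ⟨(h.b_pos i).le, h.b_le i⟩
  · simp only [Option.map_some, evalLetter, Sum.elim_inr, Option.some.injEq] at ha
    exact ha ▸ ⟨(mul_pos (h.c_pos j) h.u_pos).le, ((h.lt i₁ j).trans_le (h.b_le i₁)).le⟩

lemma Params.head_lt (h : Params one b c u) (hι : Nonempty ι) {w : List (Option (ι ⊕ κ))}
    (hw : Admits one w) (β : ℝ)
    (hβ : (w.map (Option.map (evalLetter b c u))).head? = some (some β)) : β < 1 := by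
  obtain ⟨i₁⟩ := hι
  rcases w with _ | ⟨_ | i | j, w⟩
  · simp at hβ
  · simp at hβ
  · simp only [List.map_cons, List.head?_cons, Option.map_some, evalLetter, Sum.elim_inl,
      Option.some.injEq] at hβ
    exact hβ ▸ h.b_lt i (hw i rfl)
  · simp only [List.map_cons, List.head?_cons, Option.map_some, evalLetter, Sum.elim_inr,
      Option.some.injEq] at hβ
    exact hβ ▸ (h.lt i₁ j).trans_le (h.b_le i₁)

/-- All coefficients are nonnegative, so one term is at most the whole sum. Estimates for real words
thus pass to each power of `u`. -/
lemma Params.wordCoeff_le (h : Params one b c u) (w : List (Option (ι ⊕ κ))) (m l : ℕ) :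
    wordCoeff b c w m l ≤ coeff m (wordSeries (w.map (Option.map (evalLetter b c u)))) / u ^ l := by
  rw [le_div_iff₀ (pow_pos h.u_pos l)]
  exact le_hasSum (hasSum_wordCoeff b c w m u) l fun i _ =>
    mul_nonneg (coeff_formal_nonneg h.b_pos h.c_pos w m i) (pow_nonneg h.u_pos.le _)

lemma Params.tendsto_wordCoeff (h : Params one b c u) (hι : Nonempty ι)
    (w : List (Option (ι ⊕ κ))) (l : ℕ) :
    Tendsto (fun m => wordCoeff b c w m l) atTop (𝓝 0) := by
  refine squeeze_zero (fun m => coeff_formal_nonneg h.b_pos h.c_pos w m l)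
    (fun m => h.wordCoeff_le w m l) ?_
  simpa using (tendsto_coeff_wordSeries (h.unitWord hι w)).div_const (u ^ l)

lemma Params.summable_wordCoeff (h : Params one b c u) (hι : Nonempty ι)
    {w : List (Option (ι ⊕ κ))} (hw : Admits one w) (l : ℕ) :
    Summable fun m => wordCoeff b c w m l :=
  Summable.of_nonneg_of_le (fun m => coeff_formal_nonneg h.b_pos h.c_pos w m l)
    (fun m => h.wordCoeff_le w m l)
    ((summable_coeff_wordSeries (h.unitWord hι w) (h.head_lt hι hw)).div_const _)

/-- The total of a word is the power series in `u` with coefficients `valueCoeff`. -/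
lemma Params.hasSum_valueCoeff (h : Params one b c u) (hι : Nonempty ι)
    {w : List (Option (ι ⊕ κ))} (hw : Admits one w) :
    HasSum (fun l => valueCoeff b c w l * u ^ l)
      (total (w.map (Option.map (evalLetter b c u)))) := by
  -- Nonnegativity makes the double series in `z` and `u` summable, and hence its two orders of
  -- summation interchangeable.
  have hs : Summable fun p : ℕ × ℕ => wordCoeff b c w p.1 p.2 * u ^ p.2 := by
    rw [summable_prod_of_nonneg fun p =>
      mul_nonneg (coeff_formal_nonneg h.b_pos h.c_pos w _ _) (pow_nonneg h.u_pos.le _)]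
    refine ⟨fun m => (hasSum_wordCoeff b c w m u).summable, ?_⟩
    simp only [(hasSum_wordCoeff b c w _ u).tsum_eq]
    exact summable_coeff_wordSeries (h.unitWord hι w) (h.head_lt hι hw)
  have h1 := hs.prod_symm.hasSum
  have h2 : HasSum (fun l => valueCoeff b c w l * u ^ l)
      (∑' p : ℕ × ℕ, wordCoeff b c w p.swap.1 p.swap.2 * u ^ p.swap.2) := by
    refine h1.prod_fiberwise fun l => ?_
    exact (h.summable_wordCoeff hι hw l).hasSum.mul_right (u ^ l)
  convert h2 using 1
  rw [total, show (∑' p : ℕ × ℕ, wordCoeff b c w p.swap.1 p.swap.2 * u ^ p.swap.2) = _ from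
    (Equiv.prodComm ℕ ℕ).tsum_eq (fun p : ℕ × ℕ => wordCoeff b c w p.1 p.2 * u ^ p.2),
    hs.tsum_prod]
  simp only [(hasSum_wordCoeff b c w _ u).tsum_eq]

end Expansion

end ArakawaKaneko

end

/-! ### The limit of the partial sums and the expansion of a word in its variable. -/

noncomputable section

namespace ArakawaKaneko

open PowerSeries Filter Topology

section Expansion

variable {ι κ : Type*} {one : ι → Prop} {b : ι → ℝ} {c : κ → ℝ} {u : ℝ}

lemma coeff_geom_one_mul {R : Type*} [CommRing R] (f : R⟦X⟧) (M : ℕ) :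
    coeff M (geom 1 * f) = ∑ m ∈ Finset.range M, coeff m f := by
  rw [mul_comm, coeff_mul, Finset.Nat.sum_antidiagonal_eq_sum_range_succ
    (fun i j => coeff i f * coeff j (geom 1)), Finset.sum_range_succ]
  simp only [Nat.sub_self, coeff_geom, if_true, mul_zero, add_zero, one_pow]
  refine Finset.sum_congr rfl fun j hj => ?_
  rw [Finset.mem_range] at hj
  rw [if_neg (by omega), mul_one]

lemma Params.tendsto_partial (h : Params one b c u) (hι : Nonempty ι)
    {w : List (Option (ι ⊕ κ))} (hw : Admits one w) (l : ℕ) :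
    Tendsto (fun M => coeff l (coeff M (geom 1 * formalSeries b c w))) atTop
      (𝓝 (valueCoeff b c w l)) := by
  simp only [coeff_geom_one_mul, map_sum]
  exact (h.summable_wordCoeff hι hw l).hasSum.tendsto_sum_nat

lemma Params.tendsto_partial_term (h : Params one b c u) (hι : Nonempty ι) (t : Term ι κ)
    (ht : Admits one t.2.2) (l : ℕ) :
    Tendsto (fun M => coeff l (coeff M (geom 1 * termSeries b c t))) atTop
      (𝓝 (t.1 * coeff l (termCoeff b c t.2.1 * PowerSeries.mk (valueCoeff b c t.2.2)))) := by
  have e : ∀ M, coeff l (coeff M (geom 1 * termSeries b c t)) =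
      t.1 * ∑ p ∈ Finset.HasAntidiagonal.antidiagonal l, coeff p.1 (termCoeff b c t.2.1) *
        coeff p.2 (coeff M (geom 1 * formalSeries b c t.2.2)) := by
    intro M
    rw [termSeries, mul_left_comm, coeff_C_mul, mul_assoc, ← coeff_mul,
      show ((t.1 : ℤ) : ℝ⟦X⟧) = C (t.1 : ℝ) by simp, coeff_C_mul]
  rw [tendsto_congr e, coeff_mul l]
  simp only [coeff_mk]
  exact Tendsto.const_mul _ (tendsto_finsetSum _ fun p _ =>
    Tendsto.const_mul _ (h.tendsto_partial hι ht p.2))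

/-- From `geom y · f = yz (f + geom y · f)` with `y = cu`, each step in `z` costs a power of `u`.
Induction on the exponent of `u` reduces the claim to the decay of the coefficients of `f`. -/
lemma Params.tendsto_error (h : Params one b c u) (hι : Nonempty ι) (i₀ : ι)
    (w : List (Option (ι ⊕ κ))) (l : ℕ) :
    Tendsto (fun M => coeff l (coeff M (errorSeries i₀ b c w))) atTop (𝓝 0) := by
  by_cases hw : ∃ j w', w = some (.inr j) :: w'
  · obtain ⟨j, w, rfl⟩ := hw
    have key : ∀ l, Tendsto (fun M => coeff l (coeff M
        (geom (C (c j) * X) * formalSeries b c w))) atTop (𝓝 0) := by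
      have hrec : ∀ M, coeff (M + 1) (geom (C (c j) * X) * formalSeries b c w) =
          C (c j) * (X * (coeff M (formalSeries b c w) +
            coeff M (geom (C (c j) * X) * formalSeries b c w))) := by
        intro M
        conv_lhs => rw [geom_eq]
        have : (C (C (c j) * X) * X + C (C (c j) * X) * X * geom (C (c j) * X)) *
            formalSeries b c w = C (C (c j) * X) * (X * (formalSeries b c w +
              geom (C (c j) * X) * formalSeries b c w)) := by ring
        rw [this, coeff_C_mul, coeff_succ_X_mul, map_add, mul_assoc]
      intro l
      induction l with
      | zero =>
        rw [← tendsto_add_atTop_iff_nat 1]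
        simp only [hrec]
        simp
      | succ l ih =>
        rw [← tendsto_add_atTop_iff_nat 1]
        simp only [hrec, coeff_C_mul, coeff_succ_X_mul, map_add]
        have := ((h.tendsto_wordCoeff hι w l).add ih).const_mul (c j)
        rwa [add_zero, mul_zero] at this
    simp only [errorSeries, coeff_C_mul, coeff_mul l]
    rw [← Finset.sum_const_zero (s := Finset.HasAntidiagonal.antidiagonal l)]
    refine tendsto_finsetSum _ fun p _ => ?_
    have := (key p.2).const_mul (coeff p.1 (1 + geom (c j / b i₀)))
    rwa [mul_zero] at this
  · have : errorSeries i₀ b c w = 0 := by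
      rcases w with _ | ⟨_ | i | j, w⟩
      · rfl
      · rfl
      · rfl
      · exact absurd ⟨j, w, rfl⟩ hw
    simp [this]

/-- The derivative in `u` of the value at `1` of a word, coefficientwise. -/
lemma Params.mul_valueCoeff (h : Params one b c u) {i₀ : ι} (hi₀ : one i₀)
    {w : List (Option (ι ⊕ κ))} (hg : GoodEnd w) (hw : Admits one w) (l : ℕ) :
    l * valueCoeff b c w l = ((derivTerms one i₀ w).map fun t : Term ι κ =>
      t.1 * coeff l (termCoeff b c t.2.1 * PowerSeries.mk (valueCoeff b c t.2.2))).sum := by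
  have hι : Nonempty ι := ⟨i₀⟩
  have h1 : Tendsto (fun M => coeff l (coeff M (mapDeriv delta (geom 1 * formalSeries b c w))))
      atTop (𝓝 (l * valueCoeff b c w l)) := by
    simp only [coeff_mapDeriv, delta_apply, coeff_theta]
    exact (h.tendsto_partial hι hw l).const_mul _
  refine tendsto_nhds_unique h1 ?_
  rw [geom_mul_mapDeriv c (fun i => (h.b_pos i).ne') h.b_one hi₀ hg]
  simp only [map_sub]
  refine Tendsto.mono_right ?_ (congrArg 𝓝 (sub_zero _)).le
  refine Tendsto.sub ?_ (h.tendsto_error hι i₀ w l)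
  have hl : ∀ t ∈ derivTerms one i₀ w, Admits one t.2.2 := fun t ht =>
    (derivTerms_spec hg hw ht).2.1
  generalize derivTerms one i₀ w = L at hl
  induction L with
  | nil => simp
  | cons t L ih =>
    simp only [List.map_cons, List.sum_cons, mul_add, map_add]
    exact (h.tendsto_partial_term hι t (hl t (by simp)) l).add
      (ih fun t ht => hl t (by simp [ht]))

/-- The coefficient of `u^0` is the evaluation at `u = 0`, where a variable letter becomes the zero
form. -/
lemma wordCoeff_zero_of_hasVar (b : ι → ℝ) (c : κ → ℝ) {w : List (Option (ι ⊕ κ))}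
    (hw : HasVar w) (m : ℕ) : wordCoeff b c w m 0 = 0 := by
  have h0 : ∀ m, coeff m (wordSeries (w.map (Option.map (evalLetter b c 0)))) = 0 := by
    obtain ⟨j, hj⟩ := hw
    induction w with
    | nil => simp at hj
    | cons a w ih =>
      intro m
      rw [List.map_cons, coeff_wordSeries_cons, coeff_mul]
      rw [Finset.sum_eq_zero, mul_zero]
      intro p _
      rw [List.mem_cons] at hj
      rcases hj with rfl | hj
      · simp only [Option.map_some, evalLetter, Sum.elim_inr, mul_zero, letterSeries, coeff_geom]
        split_ifs with hp
        · rw [zero_mul]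
        · rw [zero_pow hp, zero_mul]
      · rw [ih hj, mul_zero]
  have h1 := hasSum_wordCoeff b c w m 0
  rw [h0] at h1
  have h2 := hasSum_single (f := fun l => wordCoeff b c w m l * 0 ^ l) 0 fun l hl => by
    simp [hl]
  simpa using h2.unique h1

/-- An expansion of a word into products of words in the letters `c / b` and words in the
letters `b`. -/
abbrev Expansion (ι κ : Type*) := List (ℤ × List (Option (κ × ι)) × List (Option ι))

/-- The words of the expansion are convergent and of the right length. -/
def Expansion.Valid (one : ι → Prop) (w : List (Option (ι ⊕ κ))) (L : Expansion ι κ) : Prop :=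
  ∀ t ∈ L, GoodEnd t.2.1 ∧ GoodEnd t.2.2 ∧ (∀ i, t.2.2.head? = some (some i) → ¬ one i) ∧
    t.2.1.length + t.2.2.length = w.length ∧ (HasVar w → t.2.1 ≠ [])

/-- The ratio of two parameters. -/
def ratio (b : ι → ℝ) (c : κ → ℝ) (p : κ × ι) : ℝ := c p.1 / b p.2

/-- The series in `u` of an expansion, coefficientwise. -/
def Expansion.coeffs (b : ι → ℝ) (c : κ → ℝ) (L : Expansion ι κ) (l : ℕ) : ℝ :=
  (L.map fun t => (t.1 : ℝ) * (coeff l (wordSeries (t.2.1.map (Option.map (ratio b c)))) *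
    total (t.2.2.map (Option.map b)))).sum

/-- Multiplying by a coefficient series and dividing by `l` is the recursion defining words:
integrating the derivative prepends a letter to the word in `u`. -/
lemma coeff_mul_mk_coeffs (b : ι → ℝ) (c : κ → ℝ) (L : Expansion ι κ) (s : ℤ)
    (k : Option (κ × ι)) {l : ℕ} (hl : l ≠ 0) :
    s * coeff l (termCoeff b c k * PowerSeries.mk (L.coeffs b c)) =
      l * Expansion.coeffs b c (L.map fun t => (s * t.1, k :: t.2.1, t.2.2)) l := by
  have hl' : (l : ℝ) ≠ 0 := by exact_mod_cast hl
  induction L with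
  | nil =>
    have : PowerSeries.mk (Expansion.coeffs b c ([] : Expansion ι κ)) = 0 := by
      ext; simp [Expansion.coeffs]
    rw [this]
    simp [Expansion.coeffs]
  | cons t L ih =>
    have e : PowerSeries.mk (Expansion.coeffs b c (t :: L)) =
        C (t.1 * total (t.2.2.map (Option.map b))) *
          wordSeries (t.2.1.map (Option.map (ratio b c))) +
            PowerSeries.mk (Expansion.coeffs b c L) := by
      ext n
      simp only [Expansion.coeffs, List.map_cons, List.sum_cons, coeff_mk, map_add, coeff_C_mul]
      ring
    have e2 : Expansion.coeffs b c ((t :: L).map fun t => (s * t.1, k :: t.2.1, t.2.2)) l =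
        s * t.1 * (coeff l (wordSeries ((k :: t.2.1).map (Option.map (ratio b c)))) *
          total (t.2.2.map (Option.map b))) +
        Expansion.coeffs b c (L.map fun t => (s * t.1, k :: t.2.1, t.2.2)) l := by
      simp [Expansion.coeffs]
    rw [e, e2, mul_add, map_add, mul_add, ih, mul_add, List.map_cons, coeff_wordSeries_cons,
      mul_left_comm, coeff_C_mul]
    congr 1
    change _ = (l : ℝ) * (s * t.1 * ((l : ℝ)⁻¹ * coeff l (termCoeff b c k * _) * _))
    field_simp

lemma Expansion.coeffs_flatMap {α : Type*} (b : ι → ℝ) (c : κ → ℝ) (T : List α)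
    (f : α → Expansion ι κ) (l : ℕ) :
    Expansion.coeffs b c (T.flatMap f) l = (T.map fun t => Expansion.coeffs b c (f t) l).sum := by
  induction T with
  | nil => simp [Expansion.coeffs]
  | cons t T ih =>
    rw [List.flatMap_cons, List.map_cons, List.sum_cons, ← ih]
    simp [Expansion.coeffs]

lemma Expansion.coeffs_zero (b : ι → ℝ) (c : κ → ℝ) (L : Expansion ι κ)
    (h : ∀ t ∈ L, t.2.1 ≠ []) : L.coeffs b c 0 = 0 := by
  induction L with
  | nil => simp [Expansion.coeffs]
  | cons t L ih =>
    have := ih fun t ht => h t (by simp [ht])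
    rw [Expansion.coeffs] at this ⊢
    rw [List.map_cons, List.sum_cons, this]
    obtain ⟨a, v, hv⟩ := List.exists_cons_of_ne_nil (h t (by simp))
    rw [hv, List.map_cons, coeff_zero_wordSeries_cons]
    simp

/-- A word without variable letters has a trivial expansion. -/
lemma exists_expansion_of_not_hasVar (i₀ : ι) {w : List (Option (ι ⊕ κ))} (hg : GoodEnd w)
    (ha : Admits one w) (hw : ¬ HasVar w) : ∃ L : Expansion ι κ, L.Valid one w ∧
      ∀ b c l, valueCoeff b c w l = L.coeffs b c l := by
  set g : ι ⊕ κ → ι := Sum.elim id fun _ => i₀ with hgdef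
  have hval : ∀ (b : ι → ℝ) (c : κ → ℝ), w.map (Option.map (formalLetter b c)) =
      (((w.map (Option.map g)).map (Option.map b)).map
        (Option.map ((C : ℝ →+* ℝ⟦X⟧).toRatAlgHom))) := by
    intro b c
    rw [List.map_map, List.map_map]
    refine List.map_congr_left fun a ha => ?_
    rcases a with _ | i | j
    · rfl
    · simp [formalLetter, hgdef]
    · exact absurd ⟨j, ha⟩ hw
  refine ⟨[(1, [], w.map (Option.map g))], ?_, fun b c l => ?_⟩
  · intro t ht
    rw [List.mem_singleton] at ht
    subst ht
    refine ⟨goodEnd_nil, hg.map g, fun i hi => ?_, by simp, fun h => absurd h hw⟩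
    rcases w with _ | ⟨_ | i' | j, w⟩
    · simp at hi
    · simp at hi
    · simp only [List.map_cons, Option.map_some, List.head?_cons, Option.some.injEq] at hi
      exact hi ▸ ha i' rfl
    · exact absurd ⟨j, by simp⟩ hw
  · have hs : ∀ m, wordCoeff b c w m l =
        if l = 0 then coeff m (wordSeries ((w.map (Option.map g)).map (Option.map b))) else 0 := by
      intro m
      rw [wordCoeff, formalSeries, hval, wordSeries_map, coeff_map]
      exact coeff_C _ _
    simp only [valueCoeff, hs, Expansion.coeffs, List.map_cons, List.map_nil, List.sum_cons,
      List.sum_nil, wordSeries, coeff_one]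
    split_ifs <;> simp [total]

/-- Every word expands into products of words in the variable with constant words. -/
theorem exists_expansion {i₀ : ι} (hi₀ : one i₀) {w : List (Option (ι ⊕ κ))} (hg : GoodEnd w)
    (ha : Admits one w) : ∃ L : Expansion ι κ, L.Valid one w ∧
      ∀ b c u, Params one b c u → ∀ l, valueCoeff b c w l = L.coeffs b c l := by
  -- The expansion is built from the word alone, before `b`, `c`, `u` are chosen. This uniformity
  -- turns it into an identity of functions of the points.
  induction hn : w.length using Nat.strong_induction_on generalizing w with
  | _ n ih =>
  subst hn
  by_cases hw : HasVar w
  swap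
  · obtain ⟨L, h1, h2⟩ := exists_expansion_of_not_hasVar i₀ hg ha hw
    exact ⟨L, h1, fun b c _ _ => h2 b c⟩
  have hterm : ∀ t : Term ι κ, t ∈ derivTerms one i₀ w → ∃ L : Expansion ι κ,
      L.Valid one t.2.2 ∧ ∀ b c u, Params one b c u → ∀ l,
        valueCoeff b c t.2.2 l = L.coeffs b c l := fun t ht => by
    obtain ⟨h1, h2, h3, -⟩ := derivTerms_spec hg ha ht
    exact ih _ (by omega) h1 h2 rfl
  choose! F hF1 hF2 using hterm
  have hvalid : Expansion.Valid one w ((derivTerms one i₀ w).flatMap fun t =>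
      (F t).map fun x => (t.1 * x.1, t.2.1 :: x.2.1, x.2.2)) := by
    intro x hx
    rw [List.mem_flatMap] at hx
    obtain ⟨t, ht, hx⟩ := hx
    rw [List.mem_map] at hx
    obtain ⟨y, hy, rfl⟩ := hx
    obtain ⟨h1, h2, h3, h4⟩ := derivTerms_spec hg ha ht
    obtain ⟨k1, k2, k3, k4, k5⟩ := hF1 t ht y hy
    -- A new letter `du/u` cannot be the last one: its term still contains a variable, so the word
    -- behind it is nonempty.
    refine ⟨⟨fun e1 e2 => k5 (h4 e2) e1, k1⟩, k2, k3, ?_, by simp⟩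
    simp only [List.length_cons]
    omega
  refine ⟨_, hvalid, fun b c u h l => ?_⟩
  -- The differential equation determines the coefficients except at `l = 0`, where both sides
  -- vanish.
  rcases eq_or_ne l 0 with rfl | hl
  · rw [Expansion.coeffs_zero _ _ _ fun t ht => (hvalid t ht).2.2.2.2 hw, valueCoeff]
    simp only [wordCoeff_zero_of_hasVar b c hw, tsum_zero]
  · have hl' : (l : ℝ) ≠ 0 := by exact_mod_cast hl
    apply mul_left_cancel₀ hl'
    rw [h.mul_valueCoeff hi₀ hg ha, Expansion.coeffs_flatMap, ← List.sum_map_mul_left]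
    congr 1
    refine List.map_congr_left fun t ht => ?_
    rw [← coeff_mul_mk_coeffs b c (F t) t.1 t.2.1 hl,
      show valueCoeff b c t.2.2 = Expansion.coeffs b c (F t) from
        funext (hF2 t ht b c u h)]

lemma Params.convergent_left (h : Params one b c u)
    {v : List (Option (κ × ι))} (hv : GoodEnd v) :
    Convergent (v.map (Option.map fun p => u * ratio b c p)) := by
  have key : ∀ p : κ × ι, 0 ≤ u * ratio b c p ∧ u * ratio b c p < 1 := fun p =>
    ⟨mul_nonneg h.u_pos.le (div_nonneg (h.c_pos _).le (h.b_pos _).le), by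
      rw [ratio, ← mul_div_assoc, div_lt_one (h.b_pos _), mul_comm]; exact h.lt _ _⟩
  refine ⟨fun β hβ => ?_, fun β hβ => ?_, hv.map _⟩
  · rw [List.mem_map] at hβ
    obtain ⟨a, -, ha⟩ := hβ
    rcases a with _ | p
    · simp at ha
    · simp only [Option.map_some, Option.some.injEq] at ha
      exact ha ▸ ⟨(key p).1, (key p).2.le⟩
  · rcases v with _ | ⟨_ | p, v⟩
    · simp at hβ
    · simp at hβ
    · simp only [List.map_cons, Option.map_some, List.head?_cons, Option.some.injEq] at hβ
      exact hβ ▸ (key p).2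

/-- The expansion of the value at `1` of a word. -/
lemma Params.total_eq (h : Params one b c u) (hι : Nonempty ι) {w : List (Option (ι ⊕ κ))}
    (ha : Admits one w) {L : Expansion ι κ} (hL : L.Valid one w)
    (hc : ∀ l, valueCoeff b c w l = L.coeffs b c l) :
    total (w.map (Option.map (evalLetter b c u))) =
      (L.map fun t => (t.1 : ℝ) * (total (t.2.1.map (Option.map fun p => u * ratio b c p)) *
        total (t.2.2.map (Option.map b)))).sum := by
  refine (h.hasSum_valueCoeff hι ha).unique ?_
  simp only [hc, Expansion.coeffs]
  clear hc ha
  induction L with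
  | nil => simp
  | cons t L ih =>
    simp only [List.map_cons, List.sum_cons, add_mul]
    refine HasSum.add ?_ (ih fun t ht => hL t (by simp [ht]))
    have h1 := (h.convergent_left (hL t (by simp)).1).summable.hasSum
    have h2 : t.2.1.map (Option.map fun p => u * ratio b c p) =
        (t.2.1.map (Option.map (ratio b c))).map (Option.map (u * ·)) := by
      rw [List.map_map, Option.map_comp_map]; rfl
    have h3 := (h1.mul_right (total (t.2.2.map (Option.map b)))).mul_left (t.1 : ℝ)
    refine (congrArg (HasSum · _) (funext fun l => ?_)).mpr h3
    rw [h2, wordSeries_scale, coeff_rescale]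
    ring

end Expansion

end ArakawaKaneko

end

noncomputable section

namespace ArakawaKaneko

/-! ### The graded algebras of iterated integrals -/

/-- The value of a convergent word in the letters `dx/x` and `dx/(1-x)`. -/
def unitTotal (w : List (Option Unit)) : ℝ := total (w.map (Option.map fun _ => (1 : ℝ)))

/-- Admissible words in the letters `dx/x` and `dx/(1-x)`. -/
def AdmissibleWord (w : List (Option Unit)) : Prop := GoodEnd w ∧ w.head? ≠ some (some ())

/-- The span of the values of the admissible words of a given length. -/
def wordSpan (n : ℕ) : Submodule ℚ ℝ :=
  Submodule.span ℚ {x | ∃ w, AdmissibleWord w ∧ w.length = n ∧ x = unitTotal w}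

lemma AdmissibleWord.convergent {w : List (Option Unit)} (h : AdmissibleWord w) :
    Convergent (w.map (Option.map fun _ => (1 : ℝ))) := by
  refine ⟨fun β hβ => ?_, fun β hβ => ?_, h.1.map _⟩
  · rw [List.mem_map] at hβ
    obtain ⟨_ | a, -, ha⟩ := hβ
    · simp at ha
    · simp at ha; subst ha; norm_num
  · rcases w with _ | ⟨_ | a, w⟩
    · simp at hβ
    · simp at hβ
    · exact absurd rfl h.2

lemma wordSpan_mul {m n : ℕ} {x y : ℝ} (hx : x ∈ wordSpan m) (hy : y ∈ wordSpan n) :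
    x * y ∈ wordSpan (m + n) := by
  induction hx, hy using Submodule.span_induction₂ with
  | mem_mem x y hx hy =>
    obtain ⟨u, hu, rfl, rfl⟩ := hx
    obtain ⟨v, hv, rfl, rfl⟩ := hy
    rw [unitTotal, unitTotal, total_mul hu.convergent hv.convergent, shuffle_map, List.map_map]
    refine list_sum_mem fun x hx => ?_
    rw [List.mem_map] at hx
    obtain ⟨w, hw, rfl⟩ := hx
    refine Submodule.subset_span ⟨w, ⟨goodEnd_of_mem_shuffle hw hu.1 hv.1, ?_⟩,
      length_of_mem_shuffle hw, rfl⟩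
    rcases head?_of_mem_shuffle hw with e | e <;> rw [e]
    · exact hu.2
    · exact hv.2
  | zero_left y hy => simp
  | zero_right x hx => simp
  | add_left x y z _ _ _ h1 h2 => rw [add_mul]; exact add_mem h1 h2
  | add_right x y z _ _ _ h1 h2 => rw [mul_add]; exact add_mem h1 h2
  | smul_left r x y _ _ h => rw [smul_mul_assoc]; exact Submodule.smul_mem _ _ h
  | smul_right r x y _ _ h => rw [mul_smul_comm]; exact Submodule.smul_mem _ _ h

/-! ### Functions of several points spanned by iterated integrals. -/

/-- Increasing lists of points of `(0, 1)`. -/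
def Chain (l : List ℝ) : Prop := l.Pairwise (· < ·) ∧ ∀ y ∈ l, 0 < y ∧ y < 1

lemma Chain.tail {y : ℝ} {l : List ℝ} (h : Chain (y :: l)) : Chain l :=
  ⟨(List.pairwise_cons.1 h.1).2, fun x hx => h.2 x (List.mem_cons_of_mem _ hx)⟩

lemma Chain.head_lt {y : ℝ} {l : List ℝ} (h : Chain (y :: l)) (i : ℕ) : y < l.getD i 1 := by
  by_cases hi : i < l.length
  · rw [List.getD_eq_getElem _ _ hi]
    exact (List.pairwise_cons.1 h.1).1 _ (List.getElem_mem hi)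
  · rw [List.getD_eq_default _ _ (by omega)]
    exact (h.2 y (by simp)).2

lemma Chain.head_pos {y : ℝ} {l : List ℝ} (h : Chain (y :: l)) : 0 < y := (h.2 y (by simp)).1

lemma Chain.getD_pos {l : List ℝ} (h : Chain l) (i : ℕ) : 0 < l.getD i 1 := by
  by_cases hi : i < l.length
  · rw [List.getD_eq_getElem _ _ hi]; exact (h.2 _ (List.getElem_mem hi)).1
  · rw [List.getD_eq_default _ _ (by omega)]; norm_num

/-- The iterated integral up to the first point of the list, with poles at the other ones. -/
def hyperlog (v : List (Option ℕ)) (l : List ℝ) : ℝ :=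
  total (v.map (Option.map fun i => l.headD 0 / l.tail.getD i 1))

/-- The functions of `j` points spanned by products of iterated integrals of total length `n`. -/
def hyperlogSpan : ℕ → ℕ → Submodule ℚ (List ℝ → ℝ)
  | 0, n => (wordSpan n).comap (LinearMap.proj [])
  | j + 1, n => Submodule.span ℚ {F | ∃ (v : List (Option ℕ)) (m : ℕ) (G : List ℝ → ℝ),
      GoodEnd v ∧ v.length + m = n ∧ G ∈ hyperlogSpan j m ∧
        ∀ y l, Chain (y :: l) → l.length = j → F (y :: l) = hyperlog v (y :: l) * G l}

lemma hyperlog_convergent {v : List (Option ℕ)} (hv : GoodEnd v) {y : ℝ} {l : List ℝ}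
    (h : Chain (y :: l)) :
    Convergent (v.map (Option.map fun i => y / l.getD i 1)) := by
  have key : ∀ i, 0 ≤ y / l.getD i 1 ∧ y / l.getD i 1 < 1 := fun i =>
    ⟨div_nonneg h.head_pos.le (h.tail.getD_pos i).le, (div_lt_one (h.tail.getD_pos i)).2
      (h.head_lt i)⟩
  refine ⟨fun β hβ => ?_, fun β hβ => ?_, hv.map _⟩
  · rw [List.mem_map] at hβ
    obtain ⟨_ | a, -, ha⟩ := hβ
    · simp at ha
    · simp only [Option.map_some, Option.some.injEq] at ha
      exact ha ▸ ⟨(key a).1, (key a).2.le⟩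
  · rcases v with _ | ⟨_ | a, v⟩
    · simp at hβ
    · simp at hβ
    · simp only [List.map_cons, Option.map_some, List.head?_cons, Option.some.injEq] at hβ
      exact hβ ▸ (key a).2

@[simp] lemma hyperlog_nil (l : List ℝ) : hyperlog [] l = 1 := by simp [hyperlog]

/-- Generators are constrained only on chains of the right length, so a difference vanishing there
is itself a generator, with second factor 0. -/
lemma hyperlogSpan_congr {j n : ℕ} {F G : List ℝ → ℝ} (hF : F ∈ hyperlogSpan j n)
    (h : ∀ l, Chain l → l.length = j → F l = G l) : G ∈ hyperlogSpan j n := by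
  rcases j with _ | j
  · have := h [] ⟨List.Pairwise.nil, by simp⟩ rfl
    simpa [hyperlogSpan, this] using hF
  · have hz : G - F ∈ hyperlogSpan (j + 1) n := by
      refine Submodule.subset_span ⟨[], n, 0, trivial, by simp, Submodule.zero_mem _, ?_⟩
      intro y l hc hl
      simp [h (y :: l) hc (by simp [hl])]
    simpa using add_mem hz hF

lemma mem_hyperlogSpan_succ {j m n : ℕ} {v : List (Option ℕ)} {F G : List ℝ → ℝ}
    (hv : GoodEnd v) (hn : v.length + m = n) (hG : G ∈ hyperlogSpan j m)
    (h : ∀ y l, Chain (y :: l) → l.length = j → F (y :: l) = hyperlog v (y :: l) * G l) :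
    F ∈ hyperlogSpan (j + 1) n :=
  Submodule.subset_span ⟨v, m, G, hv, hn, hG, h⟩

lemma const_mem_hyperlogSpan {n : ℕ} {x : ℝ} (hx : x ∈ wordSpan n) (j : ℕ) :
    (fun _ => x) ∈ hyperlogSpan j n := by
  induction j with
  | zero => exact hx
  | succ j ih => exact mem_hyperlogSpan_succ (v := []) trivial (by simp) ih (by simp)

lemma sum_map_apply {α β : Type*} (L : List α) (f : α → β → ℝ) (x : β) :
    (L.map f).sum x = (L.map fun t => f t x).sum := by
  induction L with
  | nil => rfl
  | cons t L ih => simp [ih]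

/-- The shuffle product handles the iterated integrals up to the smallest point; induction on the
number of points handles the other factors. -/
lemma hyperlogSpan_mul {j m n : ℕ} {F G : List ℝ → ℝ} (hF : F ∈ hyperlogSpan j m)
    (hG : G ∈ hyperlogSpan j n) : F * G ∈ hyperlogSpan j (m + n) := by
  induction j generalizing m n F G with
  | zero => exact wordSpan_mul hF hG
  | succ j ih =>
    induction hF, hG using Submodule.span_induction₂ with
    | mem_mem F G hF hG =>
      obtain ⟨u, m', F', hu, rfl, hF', hFe⟩ := hF
      obtain ⟨v, n', G', hv, rfl, hG', hGe⟩ := hG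
      have hs : ((shuffle u v).map fun w => hyperlog w * fun l => F' l.tail * G' l.tail).sum ∈
          hyperlogSpan (j + 1) (u.length + m' + (v.length + n')) := by
        refine list_sum_mem fun x hx => ?_
        rw [List.mem_map] at hx
        obtain ⟨w, hw, rfl⟩ := hx
        exact mem_hyperlogSpan_succ (goodEnd_of_mem_shuffle hw hu hv)
          (by rw [length_of_mem_shuffle hw]; omega) (ih hF' hG') (fun y l _ _ => rfl)
      refine hyperlogSpan_congr hs fun l hc hl => ?_
      rcases l with _ | ⟨y, l⟩
      · simp at hl
      rw [Pi.mul_apply, hFe y l hc (by simpa using hl), hGe y l hc (by simpa using hl)]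
      have e := total_mul (hyperlog_convergent hu hc) (hyperlog_convergent hv hc)
      rw [shuffle_map, List.map_map] at e
      have e2 : ((shuffle u v).map fun w =>
          hyperlog w * fun l : List ℝ => F' l.tail * G' l.tail).sum (y :: l) =
          ((shuffle u v).map fun w => hyperlog w (y :: l)).sum * (F' l * G' l) := by
        rw [sum_map_apply, ← List.sum_map_mul_right]
        rfl
      rw [e2]
      have e3 : hyperlog u (y :: l) * hyperlog v (y :: l) =
          ((shuffle u v).map fun w => hyperlog w (y :: l)).sum := e
      rw [← e3]
      ring
    | zero_left y hy => simp
    | zero_right x hx => simp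
    | add_left x y z _ _ _ h1 h2 => rw [add_mul]; exact add_mem h1 h2
    | add_right x y z _ _ _ h1 h2 => rw [mul_add]; exact add_mem h1 h2
    | smul_left r x y _ _ h => rw [smul_mul_assoc]; exact Submodule.smul_mem _ _ h
    | smul_right r x y _ _ h => rw [mul_smul_comm]; exact Submodule.smul_mem _ _ h

/-- Sums of products in `hyperlogSpan`, pointwise form. -/
lemma sum_mem_hyperlogSpan {α : Type*} {j n : ℕ} (L : List α) (f : α → List ℝ → ℝ) (s : α → ℤ)
    (h : ∀ t ∈ L, f t ∈ hyperlogSpan j n) :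
    (fun l => (L.map fun t => (s t : ℝ) * f t l).sum) ∈ hyperlogSpan j n := by
  have : (fun l => (L.map fun t => (s t : ℝ) * f t l).sum) = (L.map fun t => s t • f t).sum := by
    ext l
    rw [sum_map_apply]
    simp
  rw [this]
  refine list_sum_mem fun x hx => ?_
  rw [List.mem_map] at hx
  obtain ⟨t, ht, rfl⟩ := hx
  exact zsmul_mem (h t ht) _

/-- The words with parameters the points of the list (and `1`) lie in `hyperlogSpan`. -/
theorem word_mem_hyperlogSpan (j : ℕ) {w : List (Option ℕ)} (hg : GoodEnd w)
    (hh : ∀ i, w.head? = some (some i) → i < j) :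
    (fun l : List ℝ => total (w.map (Option.map fun i => l.getD i 1))) ∈
      hyperlogSpan j w.length := by
  induction j generalizing w with
  | zero =>
    refine Submodule.subset_span ⟨w.map (Option.map fun _ => ()), ⟨hg.map _, ?_⟩, by simp, ?_⟩
    · rcases w with _ | ⟨_ | i, w⟩
      · simp
      · simp
      · exact absurd (hh i rfl) (by omega)
    · rw [unitTotal, List.map_map, Option.map_comp_map]
      simp [Function.comp_def]
  | succ j ih =>
    -- The smallest point (position 0) becomes the variable `u`. The other positions are constants,
    -- and those from `j` on carry the default value 1.
    let split : ℕ → ℕ ⊕ Unit := fun i => Nat.casesOn i (.inr ()) .inl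
    set w' := w.map (Option.map split) with hw'
    have hg' : GoodEnd w' := hg.map _
    have ha' : Admits (fun i => j ≤ i) w' := by
      intro i hi
      rcases w with _ | ⟨_ | _ | i', w⟩
      · simp [hw'] at hi
      · simp [hw'] at hi
      · simp [hw', split] at hi
      · simp only [hw', List.map_cons, Option.map_some, split, List.head?_cons, Option.some.injEq,
          Sum.inl.injEq] at hi
        have := hh (i' + 1) rfl
        omega
    obtain ⟨L, hL, hc⟩ := exists_expansion (i₀ := j) (le_refl j) hg' ha'
    have hmem := sum_mem_hyperlogSpan (j := j + 1) (n := w.length) L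
      (fun t l => hyperlog (t.2.1.map (Option.map Prod.snd)) l *
        total (t.2.2.map (Option.map fun i => l.tail.getD i 1))) (fun t => t.1) (by
        intro t ht
        obtain ⟨h1, h2, h3, h4, -⟩ := hL t ht
        refine mem_hyperlogSpan_succ (h1.map _) ?_ (ih h2 fun i hi => not_le.1 (h3 i hi))
          fun y l _ _ => rfl
        simpa [hw'] using h4)
    refine hyperlogSpan_congr hmem fun l hl hlen => ?_
    rcases l with _ | ⟨y, l⟩
    · simp at hlen
    have hlen' : l.length = j := by simpa using hlen
    have hP : Params (fun i => j ≤ i) (fun i => l.getD i 1) (fun _ : Unit => 1) y :=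
      { b_pos := hl.tail.getD_pos
        b_one := fun i hi => List.getD_eq_default _ _ (by omega)
        b_lt := fun i hi => by
          rw [List.getD_eq_getElem _ _ (by omega)]
          exact (hl.2 _ (List.mem_cons_of_mem _ (List.getElem_mem _))).2
        c_pos := fun _ => one_pos
        u_pos := hl.head_pos
        lt := fun i _ => by rw [one_mul]; exact hl.head_lt i }
    have e := hP.total_eq ⟨j⟩ ha' hL fun l => hc _ _ _ hP l
    have e1 : w'.map (Option.map (evalLetter (fun i => l.getD i 1) (fun _ : Unit => 1) y)) =
        w.map (Option.map fun i => (y :: l).getD i 1) := by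
      rw [hw', List.map_map, Option.map_comp_map]
      congr 2
      ext i
      rcases i with _ | i <;> simp [evalLetter, split]
    rw [← e1, e]
    congr 1
    refine List.map_congr_left fun t _ => ?_
    rw [hyperlog, List.map_map, Option.map_comp_map]
    congr 4
    ext p
    simp [ratio, div_eq_mul_inv]

/-- Iterated integrals up to a point of the list, which may be a pole, lie in `hyperlogSpan`. -/
theorem diagonal_mem_hyperlogSpan (j : ℕ) {v : List (Option ℕ)} (hg : GoodEnd v)
    (hh : v.head? ≠ some (some 0)) :
    (fun l : List ℝ => total (v.map (Option.map fun i => l.headD 0 / l.getD i 1))) ∈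
      hyperlogSpan (j + 1) v.length := by
  -- After rescaling, the pole at the endpoint is the constant 1 and the other letters are multiples
  -- of the first point `y`. The constant words are therefore words in `dx/x` and `dx/(1-x)`.
  let split : ℕ → Unit ⊕ ℕ := fun i => Nat.casesOn i (.inl ()) .inr
  set w' := v.map (Option.map split) with hw'
  have hg' : GoodEnd w' := hg.map _
  have ha' : Admits (fun _ => True) w' := by
    intro i hi
    rcases v with _ | ⟨_ | _ | i', w⟩
    · simp [hw'] at hi
    · simp [hw'] at hi
    · simp at hh
    · simp [hw', split] at hi
  obtain ⟨L, hL, hc⟩ := exists_expansion (i₀ := ()) trivial hg' ha'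
  have hmem := sum_mem_hyperlogSpan (j := j + 1) (n := v.length) L
    (fun t l => hyperlog (t.2.1.map (Option.map Prod.fst)) l * unitTotal t.2.2)
    (fun t => t.1) (by
      intro t ht
      obtain ⟨h1, h2, h3, h4, -⟩ := hL t ht
      refine mem_hyperlogSpan_succ (h1.map _) ?_ (const_mem_hyperlogSpan
        (Submodule.subset_span ⟨t.2.2, ⟨h2, fun e => h3 () e trivial⟩, rfl, rfl⟩) j)
        fun y l _ _ => rfl
      simpa [hw'] using h4)
  refine hyperlogSpan_congr hmem fun l hl hlen => ?_
  rcases l with _ | ⟨y, l⟩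
  · simp at hlen
  have hP : Params (fun _ : Unit => True) (fun _ => 1) (fun i => 1 / l.getD i 1) y :=
    { b_pos := fun _ => one_pos
      b_one := fun i hi => rfl
      b_lt := fun i hi => absurd trivial hi
      c_pos := fun i => one_div_pos.2 (hl.tail.getD_pos i)
      u_pos := hl.head_pos
      lt := fun _ i => by
        rw [one_div_mul_eq_div, div_lt_one (hl.tail.getD_pos i)]
        exact hl.head_lt i }
  have e := hP.total_eq ⟨()⟩ ha' hL fun l => hc _ _ _ hP l
  have e1 : w'.map (Option.map (evalLetter (fun _ => 1) (fun i => 1 / l.getD i 1) y)) =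
      v.map (Option.map fun i => (y :: l).headD 0 / (y :: l).getD i 1) := by
    rw [hw', List.map_map, Option.map_comp_map]
    congr 2
    ext i
    rcases i with _ | i
    · simp [evalLetter, split, hl.head_pos.ne']
    · simp [evalLetter, split, div_eq_inv_mul]
  rw [← e1, e]
  congr 1
  refine List.map_congr_left fun t _ => ?_
  rw [hyperlog, unitTotal, List.map_map, Option.map_comp_map]
  congr 5
  ext p
  simp [ratio, div_eq_mul_inv]

end ArakawaKaneko

end

noncomputable section

namespace ArakawaKaneko

open PowerSeries
open scoped ENNReal

/-! ### Words in two letters and multiple zeta values -/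

/-- The tuples over which a multiple zeta value is summed. -/
def IsIndex {d : ℕ} (m : Fin d → ℕ) : Prop := StrictMono m ∧ ∀ i, 0 < m i

/-- The summand of a multiple zeta value. -/
def zetaTerm {d : ℕ} (k m : Fin d → ℕ) : ℝ≥0∞ := ∏ i, ((m i : ℝ≥0∞) ^ k i)⁻¹

open Classical in
/-- The sum over the tuples bounded by `N`. -/
def boundedZeta {d : ℕ} (k : Fin d → ℕ) (N : ℕ) : ℝ≥0∞ :=
  ∑' m : Fin d → ℕ, if IsIndex m ∧ ∀ i, m i < N then zetaTerm k m else 0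

/-- The sum over the tuples with largest entry `M`. -/
def topZeta : {d : ℕ} → (Fin d → ℕ) → ℕ → ℝ≥0∞
  | 0, _, M => if M = 0 then 1 else 0
  | _ + 1, k, M => if 0 < M then ((M : ℝ≥0∞) ^ k (Fin.last _))⁻¹ * boundedZeta (Fin.init k) M else 0

lemma isIndex_snoc {d : ℕ} (m : Fin d → ℕ) (M : ℕ) :
    IsIndex (Fin.snoc m M : Fin (d + 1) → ℕ) ↔ 0 < M ∧ IsIndex m ∧ ∀ i, m i < M := by
  constructor
  · rintro ⟨h1, h2⟩
    refine ⟨by simpa using h2 (Fin.last d), ⟨fun i j hij => ?_, fun i => ?_⟩, fun i => ?_⟩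
    · simpa using h1 (show i.castSucc < j.castSucc from hij)
    · simpa using h2 i.castSucc
    · simpa using h1 (Fin.castSucc_lt_last i)
  · rintro ⟨h0, ⟨h1, h2⟩, h3⟩
    refine ⟨fun i j hij => ?_, fun i => ?_⟩
    · induction j using Fin.lastCases with
      | last =>
        induction i using Fin.lastCases with
        | last => exact absurd hij (lt_irrefl _)
        | cast i => simpa using h3 i
      | cast j =>
        induction i using Fin.lastCases with
        | last => exact absurd hij (Fin.le_last _).not_gt
        | cast i => simpa using h1 (show i < j from hij)
    · induction i using Fin.lastCases with
      | last => simpa using h0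
      | cast i => simpa using h2 i

lemma zetaTerm_snoc {d : ℕ} (k : Fin (d + 1) → ℕ) (m : Fin d → ℕ) (M : ℕ) :
    zetaTerm k (Fin.snoc m M : Fin (d + 1) → ℕ) =
      ((M : ℝ≥0∞) ^ k (Fin.last _))⁻¹ * zetaTerm (Fin.init k) m := by
  rw [zetaTerm, Fin.prod_univ_castSucc, zetaTerm, mul_comm]
  simp [Fin.init]

open Classical in
-- Summation over the last, hence largest, entry is separated; in `[0, ∞]` this needs no
-- convergence.
lemma tsum_index_succ {d : ℕ} (k : Fin (d + 1) → ℕ) (p : ℕ → Prop) [DecidablePred p] :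
    (∑' m : Fin (d + 1) → ℕ, if IsIndex m ∧ p (m (Fin.last d)) then zetaTerm k m else 0) =
      ∑' M, if p M then topZeta k M else 0 := by
  rw [← (Fin.snocEquiv fun _ => ℕ).tsum_eq, ENNReal.tsum_prod']
  refine tsum_congr fun M => ?_
  have hs : ∀ m : Fin d → ℕ, (Fin.snocEquiv fun _ => ℕ) (M, m) =
      (Fin.snoc m M : Fin (d + 1) → ℕ) := fun m => rfl
  simp only [hs, isIndex_snoc, zetaTerm_snoc, Fin.snoc_last, topZeta, boundedZeta]
  by_cases hp : p M <;> by_cases hM : 0 < M <;> simp only [hp, hM, true_and, and_true, and_false,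
    false_and, if_true, if_false, tsum_zero]
  rw [← ENNReal.tsum_mul_left]
  simp only [mul_ite, mul_zero]

/-- The bound 0 is excluded because of the empty tuple, which satisfies every bound but sits at `M =
0` on the right. -/
lemma boundedZeta_eq_sum {d : ℕ} (k : Fin d → ℕ) {N : ℕ} (hN : 0 < N) :
    boundedZeta k N = ∑ M ∈ Finset.range N, topZeta k M := by
  classical
  rcases d with _ | d
  · have h1 : ∀ m : Fin 0 → ℕ, IsIndex m := fun m => ⟨fun i => i.elim0, fun i => i.elim0⟩
    simp [boundedZeta, topZeta, zetaTerm, h1, hN]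
  · have h : ∀ m : Fin (d + 1) → ℕ, (IsIndex m ∧ ∀ i, m i < N) ↔
        (IsIndex m ∧ m (Fin.last d) < N) := fun m =>
      ⟨fun h => ⟨h.1, h.2 _⟩, fun h => ⟨h.1, fun i => (h.1.1.monotone (Fin.le_last i)).trans_lt h.2⟩⟩
    have e : boundedZeta k N = ∑' M, if M < N then topZeta k M else 0 := by
      refine Eq.trans ?_ (tsum_index_succ k (· < N))
      exact tsum_congr fun m => if_congr (h m) rfl rfl
    rw [e, tsum_eq_sum (s := Finset.range N)]
    · exact Finset.sum_congr rfl fun M hM => if_pos (Finset.mem_range.1 hM)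
    · intro M hM
      exact if_neg (by simpa using hM)

lemma multipleZeta_eq {d : ℕ} (k : Fin d → ℕ) :
    multipleZeta k = (∑' M, topZeta k M).toReal := by
  classical
  have h1 : multipleZeta k =
      (∑' m : Fin d → ℕ, if IsIndex m then zetaTerm k m else 0).toReal := by
    have e : (∑' m : Fin d → ℕ, if IsIndex m then zetaTerm k m else 0) =
        ∑' m : {m : Fin d → ℕ // StrictMono m ∧ ∀ i, 0 < m i}, zetaTerm k m.1 := by
      refine Eq.trans ?_
        (tsum_subtype {m : Fin d → ℕ | StrictMono m ∧ ∀ i, 0 < m i} (zetaTerm k)).symm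
      refine tsum_congr fun m => ?_
      rw [Set.indicator_apply]
      exact if_congr Iff.rfl rfl rfl
    rw [e, ENNReal.tsum_toReal_eq, multipleZeta]
    · refine tsum_congr fun m => ?_
      simp [zetaTerm, ENNReal.toReal_prod]
    · intro m
      refine ENNReal.prod_ne_top fun i _ => ?_
      rw [ne_eq, ENNReal.inv_eq_top]
      have := m.2.2 i
      exact pow_ne_zero _ (by exact_mod_cast this.ne')
  rw [h1]
  congr 1
  rcases d with _ | d
  · have h1 : ∀ m : Fin 0 → ℕ, IsIndex m := fun m => ⟨fun i => i.elim0, fun i => i.elim0⟩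
    simp [topZeta, zetaTerm, h1]
  · simpa using tsum_index_succ k fun _ => True

lemma coeff_unit_none (w : List (Option ℝ)) (M : ℕ) :
    ENNReal.ofReal (coeff M (wordSeries (none :: w))) =
      if 0 < M then (M : ℝ≥0∞)⁻¹ * ENNReal.ofReal (coeff M (wordSeries w)) else 0 := by
  rcases M with _ | M
  · simp
  · rw [coeff_wordSeries_cons, letterSeries, one_mul, if_pos (Nat.succ_pos M),
      ENNReal.ofReal_mul (by positivity), ENNReal.ofReal_inv_of_pos (by positivity),
      ENNReal.ofReal_natCast]

lemma coeff_unit_some {w : List (Option ℝ)} (hw : ∀ β, some β ∈ w → 0 ≤ β) (M : ℕ) :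
    ENNReal.ofReal (coeff M (wordSeries (some 1 :: w))) = if 0 < M then
      (M : ℝ≥0∞)⁻¹ * ∑ m ∈ Finset.range M, ENNReal.ofReal (coeff m (wordSeries w)) else 0 := by
  rcases M with _ | M
  · simp
  · rw [coeff_wordSeries_cons, letterSeries, coeff_geom_one_mul, if_pos (Nat.succ_pos M),
      ENNReal.ofReal_mul (by positivity), ENNReal.ofReal_inv_of_pos (by positivity),
      ENNReal.ofReal_natCast, ENNReal.ofReal_sum_of_nonneg fun m _ => coeff_wordSeries_nonneg hw m]

/-- Every word not ending in `dx/x` is given by the nested sums of an index. -/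
lemma exists_index {w : List (Option Unit)} (hw : GoodEnd w) :
    ∃ (d : ℕ) (k : Fin d → ℕ), (∀ i, 1 ≤ k i) ∧ ∑ i, k i = w.length ∧ (d = 0 → w = []) ∧
      (w.head? ≠ some (some ()) → ∀ i : Fin d, (i : ℕ) + 1 = d → 2 ≤ k i) ∧
      ∀ M, ENNReal.ofReal (coeff M (wordSeries (w.map (Option.map fun _ => (1 : ℝ))))) =
        topZeta k M := by
  induction w with
  | nil =>
    refine ⟨0, Fin.elim0, fun i => i.elim0, by simp, fun _ => rfl, fun _ i => i.elim0, fun M => ?_⟩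
    simp only [List.map_nil, wordSeries, coeff_one, topZeta]
    split_ifs <;> simp
  | cons a w ih =>
    obtain ⟨d, k, h1, h2, h3, h4, h5⟩ := ih hw.2
    rcases a with _ | a
    -- A leading `dx/x` raises the exponent of the largest summation variable, which exists because
    -- the word is not empty behind it. In the other case a leading `dx/(1-x)` creates a new largest
    -- variable with exponent 1.
    · obtain ⟨d, rfl⟩ : ∃ e, d = e + 1 :=
        Nat.exists_eq_succ_of_ne_zero fun e => hw.1 (h3 e) rfl
      refine ⟨d + 1, Fin.snoc (Fin.init k) (k (Fin.last d) + 1), fun i => ?_, ?_, by simp,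
        fun _ i hi => ?_, fun M => ?_⟩
      · induction i using Fin.lastCases with
        | last => simp
        | cast i => simpa [Fin.init] using h1 i.castSucc
      · rw [Fin.sum_univ_castSucc] at h2 ⊢
        simp only [Fin.snoc_castSucc, Fin.snoc_last, Fin.init, List.length_cons, ← h2]
        ring
      · obtain rfl : i = Fin.last d := Fin.ext (by simpa using hi)
        have := h1 (Fin.last d)
        simp only [Fin.snoc_last]
        omega
      · rw [List.map_cons, Option.map_none, coeff_unit_none, h5, topZeta, topZeta]
        split_ifs with hM
        · have hM0 : (M : ℝ≥0∞) ≠ 0 := by exact_mod_cast hM.ne'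
          simp only [Fin.snoc_last, Fin.init_snoc]
          rw [← mul_assoc, pow_succ', ENNReal.mul_inv (Or.inl hM0) (Or.inl (by simp))]
        · rfl
    · refine ⟨d + 1, Fin.snoc k 1, fun i => ?_, ?_, by simp, fun h => absurd rfl h, fun M => ?_⟩
      · induction i using Fin.lastCases with
        | last => simp
        | cast i => simpa using h1 i
      · rw [Fin.sum_univ_castSucc]
        simp [h2]
      · rw [List.map_cons, Option.map_some, coeff_unit_some, topZeta]
        · split_ifs with hM
          · simp only [h5, Fin.snoc_last, Fin.init_snoc, pow_one, boundedZeta_eq_sum k hM]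
          · rfl
        · intro β hβ
          rw [List.mem_map] at hβ
          obtain ⟨_ | x, -, hx⟩ := hβ
          · simp at hx
          · simp at hx; subst hx; norm_num

/-- The values of admissible words are rational combinations of multiple zeta values. -/
theorem ofReal_mem_mzvSpan {n : ℕ} {x : ℝ} (hx : x ∈ wordSpan n) : (x : ℂ) ∈ mzvSpan n := by
  induction hx using Submodule.span_induction with
  | mem x hx =>
    obtain ⟨w, hw, rfl, rfl⟩ := hx
    obtain ⟨d, k, h1, h2, -, h4, h5⟩ := exists_index hw.1
    refine Submodule.subset_span ⟨d, k, ⟨h1, h4 hw.2⟩, h2, ?_⟩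
    congr 1
    rw [multipleZeta_eq, unitTotal, total]
    simp only [← h5]
    rw [ENNReal.tsum_toReal_eq fun _ => ENNReal.ofReal_ne_top]
    refine tsum_congr fun M => (ENNReal.toReal_ofReal (coeff_wordSeries_nonneg ?_ M)).symm
    exact fun β hβ => (hw.convergent.unit β hβ).1
  | zero => simp
  | add x y _ _ h1 h2 => push_cast; exact add_mem h1 h2
  | smul r x _ h =>
    have : ((r • x : ℝ) : ℂ) = r • (x : ℂ) := by
      rw [Rat.smul_def, Rat.smul_def]; push_cast; rfl
    rw [this]
    exact Submodule.smul_mem _ _ h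

end ArakawaKaneko

end

noncomputable section

namespace ArakawaKaneko

open PowerSeries MeasureTheory Set
open scoped ENNReal

/-! ### Integrating power series -/

/-- The change of variables `t ↦ 1 - exp (-t)`. -/
def oneSubExp (t : ℝ) : ℝ := 1 - Real.exp (-t)

lemma measurable_oneSubExp : Measurable oneSubExp := by unfold oneSubExp; fun_prop

lemma oneSubExp_pos {t : ℝ} (h : 0 < t) : 0 < oneSubExp t := by
  have := Real.exp_lt_exp.2 (show -t < 0 by linarith)
  rw [Real.exp_zero] at this
  unfold oneSubExp; linarith

lemma oneSubExp_lt_one (t : ℝ) : oneSubExp t < 1 := by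
  have := Real.exp_pos (-t)
  unfold oneSubExp; linarith

lemma oneSubExp_strictMono : StrictMono oneSubExp := fun a b h => by
  have := Real.exp_lt_exp.2 (show -b < -a by linarith)
  unfold oneSubExp; linarith

/-- The value of a power series, in `[0, ∞]`. -/
def evalSeries (f : ℝ⟦X⟧) (s : ℝ) : ℝ≥0∞ := ∑' m, ENNReal.ofReal (coeff m f) * ENNReal.ofReal s ^ m

lemma measurable_evalSeries (f : ℝ⟦X⟧) : Measurable (evalSeries f) := by
  unfold evalSeries; fun_prop

lemma evalSeries_one (s : ℝ) : evalSeries 1 s = 1 := by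
  rw [evalSeries, tsum_eq_single 0]
  · simp
  · intro m hm; simp [coeff_one, hm]

lemma evalSeries_mul {f g : ℝ⟦X⟧} (hf : ∀ m, 0 ≤ coeff m f) (hg : ∀ m, 0 ≤ coeff m g) (s : ℝ) :
    evalSeries (f * g) s = evalSeries f s * evalSeries g s := by
  have h1 : evalSeries f s * evalSeries g s = ∑' p : ℕ × ℕ,
      (ENNReal.ofReal (coeff p.1 f) * ENNReal.ofReal s ^ p.1) *
        (ENNReal.ofReal (coeff p.2 g) * ENNReal.ofReal s ^ p.2) := by
    rw [ENNReal.tsum_prod', evalSeries, ← ENNReal.tsum_mul_right]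
    exact tsum_congr fun m => ENNReal.tsum_mul_left.symm
  rw [h1, ← Finset.HasAntidiagonal.sigmaAntidiagonalEquivProd.tsum_eq, ENNReal.tsum_sigma']
  refine tsum_congr fun m => ?_
  rw [tsum_fintype, coeff_mul, ENNReal.ofReal_sum_of_nonneg fun p _ => mul_nonneg (hf _) (hg _),
    Finset.sum_mul, ← Finset.sum_coe_sort]
  refine Finset.sum_congr rfl fun p _ => ?_
  rw [ENNReal.ofReal_mul (hf _)]
  have hp : p.1.1 + p.1.2 = m := Finset.HasAntidiagonal.mem_antidiagonal.1 p.2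
  simp only [Finset.HasAntidiagonal.sigmaAntidiagonalEquivProd_apply]
  rw [show ENNReal.ofReal s ^ m = ENNReal.ofReal s ^ p.1.1 * ENNReal.ofReal s ^ p.1.2 by
    rw [← pow_add, hp]]
  ring

/-- The weight of a letter in the variable `t`. -/
def letterWeight (a : Option ℝ) (t : ℝ) : ℝ≥0∞ :=
  ENNReal.ofReal (Real.exp (-t) / oneSubExp t) * evalSeries (letterSeries a) (oneSubExp t)

lemma measurable_letterWeight (a : Option ℝ) : Measurable (letterWeight a) := by
  have h1 := measurable_oneSubExp
  have h2 := (measurable_evalSeries (letterSeries a)).comp h1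
  unfold letterWeight
  exact ((by fun_prop : Measurable fun t : ℝ => Real.exp (-t) / oneSubExp t).ennreal_ofReal).mul h2

lemma letterWeight_none (t : ℝ) :
    letterWeight none t = ENNReal.ofReal (Real.exp (-t) / oneSubExp t) := by
  rw [letterWeight, letterSeries, evalSeries_one, mul_one]

lemma letterWeight_some {β t : ℝ} (hβ : 0 ≤ β) (hβ' : β ≤ 1) (ht : 0 < t) :
    letterWeight (some β) t = ENNReal.ofReal (β * Real.exp (-t) / (1 - β * oneSubExp t)) := by
  have hx := oneSubExp_pos ht
  have hx1 := oneSubExp_lt_one t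
  have hlt : β * oneSubExp t < 1 := by nlinarith
  have h0 : 0 ≤ β * oneSubExp t := by positivity
  have e : evalSeries (geom β) (oneSubExp t) =
      ENNReal.ofReal (β * oneSubExp t / (1 - β * oneSubExp t)) := by
    rw [evalSeries, tsum_eq_zero_add' ENNReal.summable]
    simp only [coeff_geom, if_true, ENNReal.ofReal_zero, zero_mul, zero_add, Nat.add_eq_zero_iff,
      one_ne_zero, and_false, if_false]
    have h2 : ∀ n : ℕ, ENNReal.ofReal (β ^ (n + 1)) * ENNReal.ofReal (oneSubExp t) ^ (n + 1) =
        ENNReal.ofReal (β * oneSubExp t * (β * oneSubExp t) ^ n) := by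
      intro n
      rw [← ENNReal.ofReal_pow hx.le, ← ENNReal.ofReal_mul (by positivity), ← mul_pow, pow_succ']
    simp only [h2]
    have hs := (summable_geometric_of_lt_one h0 hlt).mul_left (β * oneSubExp t)
    rw [← ENNReal.ofReal_tsum_of_nonneg (fun n => by positivity) hs, tsum_mul_left,
      tsum_geometric_of_lt_one h0 hlt, div_eq_mul_inv]
  have hd : 1 - β * oneSubExp t ≠ 0 := by linarith
  rw [letterWeight, letterSeries, e, ← ENNReal.ofReal_mul (by positivity)]
  congr 1
  field_simp

lemma letterWeight_one {t : ℝ} (ht : 0 < t) : letterWeight (some 1) t = 1 := by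
  rw [letterWeight_some zero_le_one le_rfl ht, ← ENNReal.ofReal_one]
  congr 1
  have := Real.exp_pos (-t)
  rw [oneSubExp]
  field_simp
  ring

lemma hasDerivAt_oneSubExp_pow (n : ℕ) (t : ℝ) :
    HasDerivAt (fun t => oneSubExp t ^ (n + 1) / (n + 1)) (Real.exp (-t) * oneSubExp t ^ n) t := by
  have h1 : HasDerivAt oneSubExp (Real.exp (-t)) t := by
    exact (((hasDerivAt_neg t).exp).const_sub 1).congr_deriv (by ring)
  have h2 := (h1.pow (n + 1)).div_const ((n : ℝ) + 1)
  refine h2.congr_deriv ?_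
  have : (n : ℝ) + 1 ≠ 0 := by positivity
  push_cast
  field_simp

/-- The set `S` corresponds to the interval `(0, s)` in the variable `1 - exp (-t)`. -/
structure Represents (S : Set ℝ) (s : ℝ) : Prop where
  measurable : MeasurableSet S
  pos : ∀ t ∈ S, 0 < t
  nonneg : 0 ≤ s
  moment : ∀ n : ℕ, ∫⁻ t in S, ENNReal.ofReal (Real.exp (-t) * oneSubExp t ^ n) =
    ENNReal.ofReal (s ^ (n + 1) / (n + 1))

/-- Power series are integrated termwise, so the moments are all that is needed of the change of
variables, and they follow from the fundamental theorem of calculus. -/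
lemma represents_Ioo {T : ℝ} (hT : 0 < T) : Represents (Ioo 0 T) (oneSubExp T) := by
  refine ⟨measurableSet_Ioo, fun t ht => ht.1, (oneSubExp_pos hT).le, fun n => ?_⟩
  have hc : Continuous fun t => Real.exp (-t) * oneSubExp t ^ n := by unfold oneSubExp; fun_prop
  have h1 := intervalIntegral.integral_eq_sub_of_hasDerivAt (a := 0) (b := T)
    (fun t _ => hasDerivAt_oneSubExp_pow n t) (hc.intervalIntegrable _ _)
  rw [intervalIntegral.integral_of_le hT.le] at h1
  rw [← restrict_Ioo_eq_restrict_Ioc] at h1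
  rw [← ofReal_integral_eq_lintegral_ofReal
    ((hc.integrableOn_Icc (a := 0) (b := T)).mono_set Ioo_subset_Icc_self)]
  · rw [h1]; simp [oneSubExp]
  · refine (ae_restrict_iff' measurableSet_Ioo).2 (Filter.Eventually.of_forall fun t ht => ?_)
    have := oneSubExp_pos ht.1
    positivity

lemma represents_Ioi : Represents (Ioi 0) 1 := by
  refine ⟨measurableSet_Ioi, fun t ht => ht, zero_le_one, fun n => ?_⟩
  have hnn : ∀ t ∈ Ioi (0 : ℝ), 0 ≤ Real.exp (-t) * oneSubExp t ^ n := fun t ht => by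
    have := oneSubExp_pos ht
    positivity
  have hlim : Filter.Tendsto (fun t => oneSubExp t ^ (n + 1) / ((n : ℝ) + 1)) Filter.atTop
      (nhds (1 ^ (n + 1) / ((n : ℝ) + 1))) := by
    have h0 : Filter.Tendsto oneSubExp Filter.atTop (nhds 1) := by
      have := (Real.tendsto_exp_neg_atTop_nhds_zero).const_sub 1
      rwa [sub_zero] at this
    exact (h0.pow (n + 1)).div_const _
  rw [← ofReal_integral_eq_lintegral_ofReal (integrableOn_Ioi_deriv_of_nonneg'
    (fun t _ => hasDerivAt_oneSubExp_pow n t) hnn hlim)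
    ((ae_restrict_iff' measurableSet_Ioi).2 (Filter.Eventually.of_forall hnn)),
    integral_Ioi_of_hasDerivAt_of_nonneg' (fun t _ => hasDerivAt_oneSubExp_pow n t) hnn hlim]
  simp [oneSubExp]

lemma letterSeries_nonneg {a : Option ℝ} (ha : ∀ β, a = some β → 0 ≤ β) (m : ℕ) :
    0 ≤ coeff m (letterSeries a) := by
  rcases a with _ | β
  · rw [letterSeries, coeff_one]; split_ifs <;> norm_num
  · rw [letterSeries, coeff_geom]
    split_ifs
    · exact le_rfl
    · exact pow_nonneg (ha β rfl) _

/-- Prepending a letter to a word is an integration. -/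
lemma Represents.lintegral_letterWeight {S : Set ℝ} {s : ℝ} (hS : Represents S s)
    {a : Option ℝ} {w : List (Option ℝ)} (hg : GoodEnd (a :: w))
    (hw : ∀ β, some β ∈ a :: w → 0 ≤ β) :
    ∫⁻ t in S, letterWeight a t * evalSeries (wordSeries w) (oneSubExp t) =
      evalSeries (wordSeries (a :: w)) s := by
  have hw' : ∀ β, some β ∈ w → 0 ≤ β := fun β h => hw β (List.mem_cons_of_mem _ h)
  have ha := letterSeries_nonneg (a := a) fun β h => hw β (by simp [h])
  have h0 : coeff 0 (letterSeries a * wordSeries w) = 0 := by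
    rw [← theta_wordSeries_cons hg, coeff_theta]; simp
  have hint : ∀ t ∈ S, letterWeight a t * evalSeries (wordSeries w) (oneSubExp t) =
      ∑' m : ℕ, ENNReal.ofReal (coeff (m + 1) (letterSeries a * wordSeries w)) *
        ENNReal.ofReal (Real.exp (-t) * oneSubExp t ^ m) := by
    intro t ht
    have hx := oneSubExp_pos (hS.pos t ht)
    rw [letterWeight, mul_assoc, ← evalSeries_mul ha (coeff_wordSeries_nonneg hw'), evalSeries,
      tsum_eq_zero_add' ENNReal.summable, h0, ENNReal.ofReal_zero, zero_mul, zero_add,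
      ← ENNReal.tsum_mul_left]
    refine tsum_congr fun m => ?_
    rw [mul_left_comm, ← ENNReal.ofReal_pow hx.le, ← ENNReal.ofReal_mul (by positivity)]
    congr 2
    field_simp
    ring
  -- All terms are nonnegative, so sum and integral commute freely; the `m`-th moment supplies the
  -- factor `1/(m+1)` of `primitive`.
  rw [setLIntegral_congr_fun hS.measurable hint, lintegral_tsum]
  · rw [evalSeries, tsum_eq_zero_add' (f := fun m => ENNReal.ofReal (coeff m (wordSeries (a :: w))) *
      ENNReal.ofReal s ^ m) ENNReal.summable]
    simp only [coeff_zero_wordSeries_cons, ENNReal.ofReal_zero, zero_mul, zero_add]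
    refine tsum_congr fun m => ?_
    have hc : 0 ≤ coeff (m + 1) (letterSeries a * wordSeries w) := by
      rw [coeff_mul]
      exact Finset.sum_nonneg fun p _ => mul_nonneg (ha _) (coeff_wordSeries_nonneg hw' _)
    rw [lintegral_const_mul', hS.moment, coeff_wordSeries_cons, ← ENNReal.ofReal_pow hS.nonneg,
      ← ENNReal.ofReal_mul hc, ← ENNReal.ofReal_mul (mul_nonneg (by positivity) hc)]
    · congr 1
      push_cast
      field_simp
    · exact ENNReal.ofReal_ne_top
  · intro m
    have := measurable_oneSubExp
    fun_prop

/-! ### Powers as repeated integrals. -/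

/-- The weight `t^(n-1) / (n-1)!`. -/
def powerWeight (n : ℕ) (t : ℝ) : ℝ≥0∞ := ENNReal.ofReal (t ^ (n - 1) / (n - 1).factorial)

@[fun_prop]
lemma measurable_powerWeight (n : ℕ) : Measurable (powerWeight n) := by
  unfold powerWeight; fun_prop

lemma lintegral_powerWeight (n : ℕ) {t T : ℝ} (h : t ≤ T) :
    ∫⁻ s in Ioo t T, powerWeight (n + 1) (s - t) = powerWeight (n + 2) (T - t) := by
  have hd : ∀ s, HasDerivAt (fun s => (s - t) ^ (n + 1) / ((n + 1).factorial : ℝ))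
      ((s - t) ^ n / (n.factorial : ℝ)) s := by
    intro s
    have := (((hasDerivAt_id s).sub_const t).pow (n + 1)).div_const ((n + 1).factorial : ℝ)
    refine this.congr_deriv ?_
    rw [Nat.factorial_succ, Nat.add_sub_cancel]
    have h1 : (n.factorial : ℝ) ≠ 0 := by positivity
    push_cast
    field_simp
    simp
  have hc : Continuous fun s : ℝ => (s - t) ^ n / (n.factorial : ℝ) := by fun_prop
  have h1 := intervalIntegral.integral_eq_sub_of_hasDerivAt (a := t) (b := T)
    (fun s _ => hd s) (hc.intervalIntegrable _ _)
  rw [intervalIntegral.integral_of_le h, ← restrict_Ioo_eq_restrict_Ioc] at h1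
  simp only [powerWeight, Nat.add_sub_cancel, show n + 2 - 1 = n + 1 by omega]
  rw [← ofReal_integral_eq_lintegral_ofReal
    ((hc.integrableOn_Icc (a := t) (b := T)).mono_set Ioo_subset_Icc_self)]
  · rw [h1]; simp
  · refine (ae_restrict_iff' measurableSet_Ioo).2 (Filter.Eventually.of_forall fun s hs => ?_)
    have : 0 < s - t := by linarith [hs.1]
    positivity

lemma lintegral_swap_triangle {f : ℝ → ℝ → ℝ≥0∞} (hf : Measurable (Function.uncurry f)) (T : ℝ) :
    ∫⁻ s in Ioo 0 T, ∫⁻ t in Ioo 0 s, f s t = ∫⁻ t in Ioo 0 T, ∫⁻ s in Ioo t T, f s t := by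
  have hm : MeasurableSet {p : ℝ × ℝ | 0 < p.2 ∧ p.2 < p.1 ∧ p.1 < T} :=
    (measurableSet_lt measurable_const measurable_snd).inter
      ((measurableSet_lt measurable_snd measurable_fst).inter
        (measurableSet_lt measurable_fst measurable_const))
  have h1 : ∫⁻ s in Ioo 0 T, ∫⁻ t in Ioo 0 s, f s t =
      ∫⁻ s, ∫⁻ t, {p : ℝ × ℝ | 0 < p.2 ∧ p.2 < p.1 ∧ p.1 < T}.indicator
        (Function.uncurry f) (s, t) := by
    rw [← lintegral_indicator measurableSet_Ioo]
    refine lintegral_congr fun s => ?_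
    by_cases hs : s ∈ Ioo 0 T
    · rw [indicator_of_mem hs, ← lintegral_indicator measurableSet_Ioo]
      refine lintegral_congr fun t => ?_
      simp only [indicator_apply, mem_Ioo, mem_ofPred_eq, hs.2, and_true, Function.uncurry]
    · rw [indicator_of_notMem hs]
      symm
      rw [lintegral_eq_zero_iff' (by
        exact ((hf.indicator hm).comp measurable_prodMk_left).aemeasurable)]
      refine Filter.Eventually.of_forall fun t => indicator_of_notMem ?_ _
      rintro ⟨h1, h2, h3⟩
      exact hs ⟨h1.trans h2, h3⟩
  have h2 : ∫⁻ t in Ioo 0 T, ∫⁻ s in Ioo t T, f s t =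
      ∫⁻ t, ∫⁻ s, {p : ℝ × ℝ | 0 < p.2 ∧ p.2 < p.1 ∧ p.1 < T}.indicator
        (Function.uncurry f) (s, t) := by
    rw [← lintegral_indicator measurableSet_Ioo]
    refine lintegral_congr fun t => ?_
    by_cases ht : t ∈ Ioo 0 T
    · rw [indicator_of_mem ht, ← lintegral_indicator measurableSet_Ioo]
      refine lintegral_congr fun s => ?_
      simp only [indicator_apply, mem_Ioo, mem_ofPred_eq, ht.1, true_and, Function.uncurry]
    · rw [indicator_of_notMem ht]
      symm
      rw [lintegral_eq_zero_iff' (by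
        exact ((hf.indicator hm).comp measurable_prodMk_right).aemeasurable)]
      refine Filter.Eventually.of_forall fun t => indicator_of_notMem ?_ _
      rintro ⟨h1, h2, h3⟩
      exact ht ⟨h1, h2.trans h3⟩
  rw [h1, h2]
  exact lintegral_lintegral_swap (hf.indicator hm).aemeasurable

/-- Repeated integration is integration against a power. -/
lemma lintegral_powerWeight_succ (n : ℕ) {φ : ℝ → ℝ≥0∞} (hφ : Measurable φ) (T : ℝ) :
    ∫⁻ t in Ioo 0 T, powerWeight (n + 2) (T - t) * φ t =
      ∫⁻ s in Ioo 0 T, ∫⁻ t in Ioo 0 s, powerWeight (n + 1) (s - t) * φ t := by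
  rw [lintegral_swap_triangle (f := fun s t => powerWeight (n + 1) (s - t) * φ t)
    (by unfold Function.uncurry; fun_prop)]
  refine setLIntegral_congr_fun measurableSet_Ioo fun t ht => ?_
  rw [lintegral_mul_const _ (by fun_prop), lintegral_powerWeight n ht.2.le]

/-- Integrating against a power of `T - t` prepends letters `dx/(1-x)` to a word. -/
lemma lintegral_powerWeight_letterWeight (n : ℕ) {T : ℝ} (hT : 0 < T)
    {a : Option ℝ} {w : List (Option ℝ)} (hg : GoodEnd (a :: w))
    (hw : ∀ β, some β ∈ a :: w → 0 ≤ β) :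
    ∫⁻ t in Ioo 0 T, powerWeight (n + 1) (T - t) *
      (letterWeight a t * evalSeries (wordSeries w) (oneSubExp t)) =
        evalSeries (wordSeries (List.replicate n (some 1) ++ a :: w)) (oneSubExp T) := by
  induction n generalizing T with
  | zero =>
    simp only [powerWeight, zero_add, Nat.sub_self, pow_zero, Nat.factorial_zero, Nat.cast_one,
      div_one, ENNReal.ofReal_one, one_mul, List.replicate_zero, List.nil_append]
    exact (represents_Ioo hT).lintegral_letterWeight hg hw
  | succ n ih =>
    have hm := (measurable_letterWeight a).mul
      ((measurable_evalSeries (wordSeries w)).comp measurable_oneSubExp)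
    have hm' : Measurable fun t => letterWeight a t * evalSeries (wordSeries w) (oneSubExp t) := hm
    rw [lintegral_powerWeight_succ n hm' T]
    have hg' : GoodEnd (some (1 : ℝ) :: (List.replicate n (some 1) ++ a :: w)) := by
      have : ∀ n, GoodEnd (List.replicate n (some (1 : ℝ)) ++ a :: w) := by
        intro n
        induction n with
        | zero => exact hg
        | succ n ih => exact ⟨fun h => by simp at h, ih⟩
      exact this (n + 1)
    have hw' : ∀ β, some β ∈ some (1 : ℝ) :: (List.replicate n (some 1) ++ a :: w) → 0 ≤ β := by
      intro β hβ
      rw [List.mem_cons, List.mem_append] at hβ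
      rcases hβ with h | h | h
      · rw [Option.some.injEq] at h; rw [h]; norm_num
      · have := List.eq_of_mem_replicate h
        rw [Option.some.injEq] at this; rw [this]; norm_num
      · exact hw β h
    rw [List.replicate_succ, List.cons_append,
      ← (represents_Ioo hT).lintegral_letterWeight hg' hw']
    refine setLIntegral_congr_fun measurableSet_Ioo fun s hs => ?_
    rw [ih hs.1, letterWeight_one hs.1, one_mul]

/-- In the variable `t = -log (1 - x)` the form `dx/(1-x)` is `dt`, and its `n`-fold iterated
integral is `T^n/n!`. -/
lemma powerWeight_eq (n : ℕ) {T : ℝ} (hT : 0 < T) :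
    powerWeight (n + 1) T = evalSeries (wordSeries (List.replicate n (some 1))) (oneSubExp T) := by
  rcases n with _ | n
  · simp [powerWeight, wordSeries, evalSeries_one]
  have h := lintegral_powerWeight_letterWeight n hT (a := some 1) (w := [])
    ⟨by simp, trivial⟩ (fun β hβ => by simp at hβ; rw [hβ]; norm_num)
  rw [List.replicate_succ', ← h]
  have h2 := lintegral_powerWeight_succ n (φ := fun _ => 1) measurable_const T
  have h3 : ∀ t ∈ Ioo 0 T, powerWeight (n + 1) (T - t) *
      (letterWeight (some 1) t * evalSeries (wordSeries []) (oneSubExp t)) =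
        powerWeight (n + 1) (T - t) := by
    intro t ht
    rw [letterWeight_one ht.1, wordSeries, evalSeries_one, one_mul, mul_one]
  rw [setLIntegral_congr_fun measurableSet_Ioo h3]
  have h4 := lintegral_powerWeight n hT.le
  rw [sub_zero] at h4
  rw [← h4]
  have e := lintegral_sub_left_eq_self (μ := volume)
    (fun s => (Ioo 0 T).indicator (fun s => powerWeight (n + 1) (s - 0)) s) T
  rw [← lintegral_indicator measurableSet_Ioo, ← e, ← lintegral_indicator measurableSet_Ioo]
  refine lintegral_congr fun s => ?_
  simp only [indicator_apply, mem_Ioo, sub_zero]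
  congr 1
  rw [eq_iff_iff]
  constructor <;> rintro ⟨h1, h2⟩ <;> constructor <;> linarith

end ArakawaKaneko

end

noncomputable section

namespace ArakawaKaneko

open PowerSeries MeasureTheory Set
open scoped ENNReal

/-! ### Values of word series -/

lemma evalSeries_wordSeries_one {w : List (Option ℝ)} (hw : Convergent w) :
    evalSeries (wordSeries w) 1 = ENNReal.ofReal (total w) := by
  have hnn := coeff_wordSeries_nonneg fun β hβ => (hw.unit β hβ).1
  rw [total, ENNReal.ofReal_tsum_of_nonneg hnn hw.summable, evalSeries]
  simp

lemma evalSeries_wordSeries_scale (w : List (Option ℝ)) {s : ℝ} (hs : 0 ≤ s) :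
    evalSeries (wordSeries w) s = evalSeries (wordSeries (w.map (Option.map (s * ·)))) 1 := by
  rw [wordSeries_scale, evalSeries, evalSeries]
  refine tsum_congr fun m => ?_
  rw [coeff_rescale, ENNReal.ofReal_mul (pow_nonneg hs m), ENNReal.ofReal_pow hs,
    ENNReal.ofReal_one, one_pow, mul_one, mul_comm]

/-- The word with poles at the points of the list. -/
def poleWord (l : List ℝ) (v : List (Option ℕ)) : List (Option ℝ) :=
  v.map (Option.map fun i => 1 / l.getD i 1)

lemma poleWord_nonneg {l : List ℝ} (hl : Chain l) (v : List (Option ℕ)) (β : ℝ)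
    (hβ : some β ∈ poleWord l v) : 0 ≤ β := by
  rw [poleWord, List.mem_map] at hβ
  obtain ⟨_ | i, -, hi⟩ := hβ
  · simp at hi
  · simp only [Option.map_some, Option.some.injEq] at hi
    exact hi ▸ (one_div_pos.2 (hl.getD_pos i)).le

lemma poleWord_scale (l : List ℝ) (v : List (Option ℕ)) (s : ℝ) :
    (poleWord l v).map (Option.map (s * ·)) = v.map (Option.map fun i => s / l.getD i 1) := by
  rw [poleWord, List.map_map, Option.map_comp_map]
  congr 2
  ext i
  simp [div_eq_mul_inv]

lemma evalSeries_poleWord {v : List (Option ℕ)} (hv : GoodEnd v) {s : ℝ} {l : List ℝ}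
    (h : Chain (s :: l)) :
    evalSeries (wordSeries (poleWord l v)) s = ENNReal.ofReal (hyperlog v (s :: l)) := by
  rw [evalSeries_wordSeries_scale _ h.head_pos.le, poleWord_scale,
    evalSeries_wordSeries_one (hyperlog_convergent hv h)]
  rfl

/-- The iterated integral up to the first point of the list, which may be a pole. -/
def diagonalTotal (v : List (Option ℕ)) (l : List ℝ) : ℝ :=
  total (v.map (Option.map fun i => l.headD 0 / l.getD i 1))

lemma diagonal_convergent {v : List (Option ℕ)} (hv : GoodEnd v) (hh : v.head? ≠ some (some 0))
    {s : ℝ} {l : List ℝ} (h : Chain (s :: l)) :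
    Convergent (v.map (Option.map fun i => s / (s :: l).getD i 1)) := by
  have key : ∀ i, 0 ≤ s / (s :: l).getD i 1 ∧ s / (s :: l).getD i 1 ≤ 1 := fun i => by
    refine ⟨div_nonneg h.head_pos.le (h.getD_pos i).le, (div_le_one (h.getD_pos i)).2 ?_⟩
    rcases i with _ | i
    · simp
    · simpa using (h.head_lt i).le
  refine ⟨fun β hβ => ?_, fun β hβ => ?_, hv.map _⟩
  · rw [List.mem_map] at hβ
    obtain ⟨_ | a, -, ha⟩ := hβ
    · simp at ha
    · simp only [Option.map_some, Option.some.injEq] at ha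
      exact ha ▸ key a
  · rcases v with _ | ⟨_ | _ | a, v⟩
    · simp at hβ
    · simp at hβ
    · simp at hh
    · simp only [List.map_cons, Option.map_some, List.head?_cons, Option.some.injEq,
        List.getD_cons_succ] at hβ
      exact hβ ▸ (div_lt_one (h.tail.getD_pos a)).2 (h.head_lt a)

lemma diagonalTotal_nonneg (v : List (Option ℕ)) {s : ℝ} {l : List ℝ} (h : Chain (s :: l)) :
    0 ≤ diagonalTotal v (s :: l) := by
  refine total_nonneg fun β hβ => ?_
  rw [List.mem_map] at hβ
  obtain ⟨_ | a, -, ha⟩ := hβ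
  · simp at ha
  · simp only [Option.map_some, Option.some.injEq] at ha
    exact ha ▸ div_nonneg h.head_pos.le (h.getD_pos a).le

lemma evalSeries_diagonal {v : List (Option ℕ)} (hv : GoodEnd v) (hh : v.head? ≠ some (some 0))
    {s : ℝ} {l : List ℝ} (h : Chain (s :: l)) :
    evalSeries (wordSeries (poleWord (s :: l) v)) s =
      ENNReal.ofReal (diagonalTotal v (s :: l)) := by
  rw [evalSeries_wordSeries_scale _ h.head_pos.le, poleWord_scale,
    evalSeries_wordSeries_one (diagonal_convergent hv hh h)]
  rfl

lemma hyperlog_nonneg (v : List (Option ℕ)) {s : ℝ} {l : List ℝ} (h : Chain (s :: l)) :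
    0 ≤ hyperlog v (s :: l) := by
  refine total_nonneg fun β hβ => ?_
  rw [List.mem_map] at hβ
  obtain ⟨_ | a, -, ha⟩ := hβ
  · simp at ha
  · simp only [Option.map_some, Option.some.injEq] at ha
    exact ha ▸ div_nonneg h.head_pos.le (h.tail.getD_pos a).le

/-- A power series with nonnegative coefficients and no constant term, divided by `s`, is increasing
in `s`. -/
lemma hyperlog_le {v : List (Option ℕ)} (hv : GoodEnd v) (hne : v ≠ []) {s s₀ : ℝ} {l : List ℝ}
    (h : Chain (s :: l)) (h₀ : Chain (s₀ :: l)) (hs : s ≤ s₀) :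
    hyperlog v (s :: l) ≤ s / s₀ * hyperlog v (s₀ :: l) := by
  have hq : 0 ≤ s / s₀ := div_nonneg h.head_pos.le h₀.head_pos.le
  have hn := mul_nonneg hq (hyperlog_nonneg v h₀)
  rw [← ENNReal.ofReal_le_ofReal_iff hn, ENNReal.ofReal_mul hq, ← evalSeries_poleWord hv h,
    ← evalSeries_poleWord hv h₀, evalSeries, evalSeries, ← ENNReal.tsum_mul_left]
  refine ENNReal.tsum_le_tsum fun m => ?_
  obtain ⟨a, v, rfl⟩ := List.exists_cons_of_ne_nil hne
  rcases m with _ | m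
  · simp [poleWord]
  · rw [mul_left_comm]
    refine mul_le_mul_right ?_ _
    rw [← ENNReal.ofReal_pow h.head_pos.le, ← ENNReal.ofReal_pow h₀.head_pos.le,
      ← ENNReal.ofReal_mul hq]
    refine ENNReal.ofReal_le_ofReal ?_
    have h1 := pow_le_pow_left₀ h.head_pos.le hs m
    calc s ^ (m + 1) = s * s ^ m := pow_succ' s m
      _ ≤ s * s₀ ^ m := mul_le_mul_of_nonneg_left h1 h.head_pos.le
      _ = s / s₀ * s₀ ^ (m + 1) := by
        have := h₀.head_pos.ne'
        field_simp
        ring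

/-! ### Eliminating one variable -/

/-- The empty word is separated from the others because it alone does not vanish as the smallest
point tends to 0. -/
lemma hyperlogSpan_decomp {j n : ℕ} {F : List ℝ → ℝ} (hF : F ∈ hyperlogSpan (j + 1) n) :
    ∃ C₀ ∈ hyperlogSpan j n, ∃ L : List (List (Option ℕ) × (List ℝ → ℝ)),
      (∀ t ∈ L, t.1 ≠ [] ∧ GoodEnd t.1 ∧ ∃ m, t.1.length + m = n ∧ t.2 ∈ hyperlogSpan j m) ∧
      ∀ y l, Chain (y :: l) → l.length = j →
        F (y :: l) = C₀ l + (L.map fun t => hyperlog t.1 (y :: l) * t.2 l).sum := by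
  induction hF using Submodule.span_induction with
  | mem F hF =>
    obtain ⟨v, m, G, hv, hn, hG, hFe⟩ := hF
    rcases v with _ | ⟨a, v⟩
    · obtain rfl : m = n := by simpa using hn
      exact ⟨G, hG, [], by simp, fun y l hc hl => by simp [hFe y l hc hl]⟩
    · refine ⟨0, zero_mem _, [(a :: v, G)], ?_, fun y l hc hl => by simp [hFe y l hc hl]⟩
      intro t ht
      rw [List.mem_singleton] at ht
      subst ht
      exact ⟨by simp, hv, m, hn, hG⟩
  | zero => exact ⟨0, zero_mem _, [], by simp, by simp⟩
  | add F G _ _ hF hG =>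
    obtain ⟨C₁, h₁, L₁, h₁', e₁⟩ := hF
    obtain ⟨C₂, h₂, L₂, h₂', e₂⟩ := hG
    refine ⟨C₁ + C₂, add_mem h₁ h₂, L₁ ++ L₂, fun t ht => ?_, fun y l hc hl => ?_⟩
    · rcases List.mem_append.1 ht with h | h
      · exact h₁' t h
      · exact h₂' t h
    · rw [Pi.add_apply, e₁ y l hc hl, e₂ y l hc hl, List.map_append, List.sum_append, Pi.add_apply]
      ring
  | smul q F _ hF =>
    obtain ⟨C₁, h₁, L₁, h₁', e₁⟩ := hF
    refine ⟨q • C₁, Submodule.smul_mem _ _ h₁, L₁.map fun t => (t.1, q • t.2), fun t ht => ?_,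
      fun y l hc hl => ?_⟩
    · rw [List.mem_map] at ht
      obtain ⟨t, ht, rfl⟩ := ht
      obtain ⟨k1, k2, m, k3, k4⟩ := h₁' t ht
      exact ⟨k1, k2, m, k3, Submodule.smul_mem _ _ k4⟩
    · rw [Pi.smul_apply, e₁ y l hc hl, smul_add, Pi.smul_apply, List.map_map, Rat.smul_def,
        Rat.smul_def, ← List.sum_map_mul_left]
      congr 2
      refine List.map_congr_left fun t _ => ?_
      simp only [Function.comp_apply, Pi.smul_apply, Rat.smul_def]
      ring

/-- Nonempty words contribute `O(s)`; if the whole sum is `O(s)` too, so is the constant, and `s →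
0`. -/
lemma constant_eq_zero {L : List (List (Option ℕ) × (List ℝ → ℝ))}
    (hL : ∀ t ∈ L, t.1 ≠ [] ∧ GoodEnd t.1) {l : List ℝ} {s₀ : ℝ} (h₀ : Chain (s₀ :: l)) {x K : ℝ}
    (hb : ∀ s, 0 < s → s ≤ s₀ →
      |x + (L.map fun t => hyperlog t.1 (s :: l) * t.2 l).sum| ≤ K * s) : x = 0 := by
  have hch : ∀ s, 0 < s → s ≤ s₀ → Chain (s :: l) := fun s h0 hs => by
    refine ⟨List.pairwise_cons.2 ⟨fun a ha => hs.trans_lt ((List.pairwise_cons.1 h₀.1).1 a ha),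
      h₀.tail.1⟩, fun y hy => ?_⟩
    rcases List.mem_cons.1 hy with rfl | hy
    · exact ⟨h0, hs.trans_lt (h₀.2 s₀ (by simp)).2⟩
    · exact h₀.tail.2 y hy
  have h1 : ∃ K', ∀ s, 0 < s → s ≤ s₀ →
      |(L.map fun t => hyperlog t.1 (s :: l) * t.2 l).sum| ≤ K' * s := by
    clear hb
    induction L with
    | nil => exact ⟨0, by simp⟩
    | cons t L ih =>
      obtain ⟨K', hK'⟩ := ih fun t ht => hL t (by simp [ht])
      obtain ⟨k1, k2⟩ := hL t (by simp)
      refine ⟨hyperlog t.1 (s₀ :: l) / s₀ * |t.2 l| + K', fun s h0 hs => ?_⟩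
      rw [List.map_cons, List.sum_cons]
      refine (abs_add_le _ _).trans ?_
      rw [add_mul]
      refine add_le_add ?_ (hK' s h0 hs)
      rw [abs_mul, abs_of_nonneg (hyperlog_nonneg _ (hch s h0 hs))]
      calc hyperlog t.1 (s :: l) * |t.2 l| ≤ (s / s₀ * hyperlog t.1 (s₀ :: l)) * |t.2 l| :=
            mul_le_mul_of_nonneg_right (hyperlog_le k2 k1 (hch s h0 hs) h₀ hs) (abs_nonneg _)
        _ = _ := by ring
  obtain ⟨K', hK'⟩ := h1
  have h2 : ∀ s, 0 < s → s ≤ s₀ → |x| ≤ (K + K') * s := fun s h0 hs => by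
    have e : x = (x + (L.map fun t => hyperlog t.1 (s :: l) * t.2 l).sum) -
        (L.map fun t => hyperlog t.1 (s :: l) * t.2 l).sum := by ring
    rw [e]
    refine (abs_sub _ _).trans ?_
    rw [add_mul]
    exact add_le_add (hb s h0 hs) (hK' s h0 hs)
  have hlim : Filter.Tendsto (fun s => (K + K') * s) (nhdsWithin 0 (Ioi 0)) (nhds 0) := by
    have : Filter.Tendsto (fun s => (K + K') * s) (nhds 0) (nhds ((K + K') * 0)) :=
      (continuous_const.mul continuous_id).tendsto 0
    rw [mul_zero] at this
    exact this.mono_left nhdsWithin_le_nhds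
  have h3 : |x| ≤ 0 := ge_of_tendsto hlim (by
    filter_upwards [Ioc_mem_nhdsGT h₀.head_pos] with s hs using h2 s hs.1 hs.2)
  exact abs_nonpos_iff.1 h3

lemma integral_list_sum {α β : Type*} [MeasurableSpace α] {ν : Measure α} (L : List β)
    (h : β → α → ℝ) (c : β → ℝ) (hm : ∀ t ∈ L, AEMeasurable (h t) ν)
    (hnn : ∀ t ∈ L, 0 ≤ᵐ[ν] h t) (hfin : ∀ t ∈ L, ∫⁻ x, ENNReal.ofReal (h t x) ∂ν ≠ ⊤) :
    Integrable (fun x => (L.map fun t => h t x * c t).sum) ν ∧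
      ∫ x, (L.map fun t => h t x * c t).sum ∂ν =
        (L.map fun t => (∫⁻ x, ENNReal.ofReal (h t x) ∂ν).toReal * c t).sum := by
  induction L with
  | nil => simp
  | cons t L ih =>
    obtain ⟨h1, h2⟩ := ih (fun t ht => hm t (by simp [ht])) (fun t ht => hnn t (by simp [ht]))
      (fun t ht => hfin t (by simp [ht]))
    have hi : Integrable (h t) ν := by
      refine ⟨(hm t (by simp)).aestronglyMeasurable, ?_⟩
      rw [hasFiniteIntegral_iff_ofReal (hnn t (by simp))]
      exact (hfin t (by simp)).lt_top
    simp only [List.map_cons, List.sum_cons]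
    refine ⟨(hi.mul_const _).add h1, ?_⟩
    rw [integral_add (hi.mul_const _) h1, h2, integral_mul_const,
      integral_eq_lintegral_of_nonneg_ae (hnn t (by simp)) (hm t (by simp)).aestronglyMeasurable]

/-- Integrating a nonnegative combination of iterated integrals term by term. -/
lemma lintegral_combination {S : Set ℝ} (hS : MeasurableSet S) {K : ℝ → ℝ≥0∞} (hK : Measurable K)
    {l : List ℝ} (hch : ∀ t ∈ S, Chain (oneSubExp t :: l))
    {L : List (List (Option ℕ) × (List ℝ → ℝ))} (hL : ∀ t ∈ L, GoodEnd t.1)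
    (I : List (Option ℕ) → ℝ) (hI0 : ∀ t ∈ L, 0 ≤ I t.1)
    (hI : ∀ t ∈ L, ∫⁻ x in S, K x * evalSeries (wordSeries (poleWord l t.1)) (oneSubExp x) =
      ENNReal.ofReal (I t.1))
    {F : ℝ → ℝ≥0∞} (hF : ∀ x ∈ S, F x ≠ ⊤ ∧
      (F x).toReal = (L.map fun t => hyperlog t.1 (oneSubExp x :: l) * t.2 l).sum) :
    ∫⁻ x in S, K x * F x ≠ ⊤ ∧
      (∫⁻ x in S, K x * F x).toReal = (L.map fun t => I t.1 * t.2 l).sum := by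
  -- The coefficients may have any sign, so the sum must be split as a Bochner integral. With the
  -- kernel absorbed into the measure, each iterated integral is integrable on its own because its
  -- integral has the finite value `I`.
  set ν := (volume.restrict S).withDensity K with hν
  set h : List (Option ℕ) × (List ℝ → ℝ) → ℝ → ℝ := fun t x =>
    (evalSeries (wordSeries (poleWord l t.1)) (oneSubExp x)).toReal with hh
  have hms : ∀ t : List (Option ℕ) × (List ℝ → ℝ),
      Measurable fun x => evalSeries (wordSeries (poleWord l t.1)) (oneSubExp x) := fun t =>
    (measurable_evalSeries _).comp measurable_oneSubExp
  have hev : ∀ t ∈ L, ∀ x ∈ S, evalSeries (wordSeries (poleWord l t.1)) (oneSubExp x) =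
      ENNReal.ofReal (hyperlog t.1 (oneSubExp x :: l)) := fun t ht x hx =>
    evalSeries_poleWord (hL t ht) (hch x hx)
  have hh' : ∀ t ∈ L, ∀ x ∈ S, h t x = hyperlog t.1 (oneSubExp x :: l) := fun t ht x hx => by
    rw [hh]
    simp only
    rw [hev t ht x hx, ENNReal.toReal_ofReal (hyperlog_nonneg _ (hch x hx))]
  have hae : ∀ p : ℝ → Prop, (∀ x ∈ S, p x) → ∀ᵐ x ∂ν, p x := fun p hp =>
    (withDensity_absolutelyContinuous _ _).ae_le
      ((ae_restrict_iff' hS).2 (Filter.Eventually.of_forall hp))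
  have hlint : ∀ t ∈ L, ∫⁻ x, ENNReal.ofReal (h t x) ∂ν = ENNReal.ofReal (I t.1) := by
    intro t ht
    rw [← hI t ht, hν, lintegral_withDensity_eq_lintegral_mul _ hK
      ((hms t).ennreal_toReal.ennreal_ofReal)]
    refine setLIntegral_congr_fun hS fun x hx => ?_
    simp only [Pi.mul_apply]
    rw [ENNReal.ofReal_toReal]
    rw [hev t ht x hx]
    exact ENNReal.ofReal_ne_top
  obtain ⟨h1, h2⟩ := integral_list_sum (ν := ν) L h (fun t => t.2 l)
    (fun t _ => (hms t).ennreal_toReal.aemeasurable)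
    (fun t _ => Filter.Eventually.of_forall fun x => ENNReal.toReal_nonneg)
    (fun t ht => by rw [hlint t ht]; exact ENNReal.ofReal_ne_top)
  have hsum : ∀ x ∈ S, (L.map fun t => h t x * t.2 l).sum = (F x).toReal := fun x hx => by
    rw [(hF x hx).2]
    congr 1
    exact List.map_congr_left fun t ht => by rw [hh' t ht x hx]
  have hnn : 0 ≤ᵐ[ν] fun x => (L.map fun t => h t x * t.2 l).sum :=
    hae _ fun x hx => by
      change (0 : ℝ) ≤ (L.map fun t => h t x * t.2 l).sum
      rw [hsum x hx]
      exact ENNReal.toReal_nonneg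
  have h3 := ofReal_integral_eq_lintegral_ofReal h1 hnn
  have hmeas : Measurable fun x => (L.map fun t => h t x * t.2 l).sum := by
    clear hsum hnn h1 h2 h3 hlint hh' hev hI hI0 hL hF
    induction L with
    | nil => simp
    | cons t L ih =>
      simp only [List.map_cons, List.sum_cons]
      exact ((hms t).ennreal_toReal.mul_const _).add ih
  have h4 : ∫⁻ x in S, K x * F x =
      ∫⁻ x, ENNReal.ofReal ((L.map fun t => h t x * t.2 l).sum) ∂ν := by
    rw [hν, lintegral_withDensity_eq_lintegral_mul _ hK hmeas.ennreal_ofReal]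
    refine setLIntegral_congr_fun hS fun x hx => ?_
    simp only [Pi.mul_apply]
    rw [hsum x hx, ENNReal.ofReal_toReal (hF x hx).1]
  rw [h4, ← h3]
  refine ⟨ENNReal.ofReal_ne_top, ?_⟩
  rw [ENNReal.toReal_ofReal (integral_nonneg_of_ae hnn), h2]
  congr 1
  exact List.map_congr_left fun t ht => by
    rw [hlint t ht, ENNReal.toReal_ofReal (hI0 t ht)]

end ArakawaKaneko

end

noncomputable section

namespace ArakawaKaneko

open PowerSeries MeasureTheory Set
open scoped ENNReal

/-! ### Iterated elimination -/

/-- The weight `exp (-a t) / (1 - exp (-t))`. -/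
def omega (a : ℕ) (t : ℝ) : ℝ≥0∞ := ENNReal.ofReal (Real.exp (-(a * t)) / oneSubExp t)

lemma measurable_omega (a : ℕ) : Measurable (omega a) := by
  have := measurable_oneSubExp
  unfold omega
  fun_prop

lemma omega_ne_top (a : ℕ) (t : ℝ) : omega a t ≠ ⊤ := ENNReal.ofReal_ne_top

lemma omega_one (t : ℝ) : omega 1 t = letterWeight none t := by
  rw [omega, letterWeight_none]; simp

/-- With `x = 1 - e^{-t}` this is `dx/(x(1-x)) = dx/x + dx/(1-x)`. -/
lemma omega_zero {t : ℝ} (ht : 0 < t) : omega 0 t = letterWeight none t + letterWeight (some 1) t := by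
  have h := oneSubExp_pos ht
  rw [omega, letterWeight_none, letterWeight_one ht, ← ENNReal.ofReal_one,
    ← ENNReal.ofReal_add (by positivity) zero_le_one]
  congr 1
  have e : Real.exp (-t) = 1 - oneSubExp t := by rw [oneSubExp]; ring
  rw [e]
  field_simp
  simp

lemma powerWeight_mono (m : ℕ) {s t : ℝ} (hs : 0 ≤ s) (h : s ≤ t) :
    powerWeight (m + 1) s ≤ powerWeight (m + 1) t := by
  unfold powerWeight
  gcongr

/-- The iterated integral over `T > t₁ > t₂ > ⋯ > 0` of `G (…, oneSubExp t₁, acc)`. -/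
def nest (G : List ℝ → ℝ≥0∞) : (r : ℕ) → (Fin (r + 1) → ℕ) → (Fin r → ℕ) → ℝ → List ℝ → ℝ≥0∞
  | 0, m, _, T, acc => powerWeight (m 0 + 1) T * G acc
  | r + 1, m, a, T, acc => ∫⁻ t in Ioo 0 T, powerWeight (m 0 + 1) (T - t) *
      (omega (a 0) t * nest G r (Fin.tail m) (Fin.tail a) t (oneSubExp t :: acc))

/-- Scaling a point of a list of length `n` down by a factor decreases the function by at least
this factor. -/
def Sublinear (n : ℕ) (G : List ℝ → ℝ≥0∞) : Prop :=
  ∀ p s s₀ acc, 0 < s → s ≤ s₀ → p.length + acc.length + 1 = n →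
    G (p ++ s :: acc) ≤ ENNReal.ofReal (s / s₀) * G (p ++ s₀ :: acc)

lemma nest_le_of_sublinear {G : List ℝ → ℝ≥0∞} {N : ℕ} (hG : Sublinear N G) (r : ℕ)
    (m : Fin (r + 1) → ℕ) (a : Fin r → ℕ) (T : ℝ) {s s₀ : ℝ} (h0 : 0 < s) (hs : s ≤ s₀)
    (p acc : List ℝ) (hN : p.length + acc.length + 1 + r = N) :
    nest G r m a T (p ++ s :: acc) ≤ ENNReal.ofReal (s / s₀) * nest G r m a T (p ++ s₀ :: acc) := by
  induction r generalizing T p with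
  | zero =>
    rw [nest, nest, mul_left_comm]
    exact mul_le_mul_right (hG p s s₀ acc h0 hs hN) _
  | succ r ih =>
    rw [nest, nest, ← lintegral_const_mul' _ _ ENNReal.ofReal_ne_top]
    refine setLIntegral_mono' measurableSet_Ioo fun t _ => ?_
    have := ih (Fin.tail m) (Fin.tail a) t (oneSubExp t :: p)
      (by simp only [List.length_cons]; omega)
    exact (mul_le_mul_right (mul_le_mul_right this _) _).trans
      (le_of_eq (by simp only [List.cons_append]; ring))

lemma nest_mono (G : List ℝ → ℝ≥0∞) (r : ℕ) (m : Fin (r + 1) → ℕ) (a : Fin r → ℕ) {T T₀ : ℝ}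
    (h0 : 0 ≤ T) (hT : T ≤ T₀) (acc : List ℝ) : nest G r m a T acc ≤ nest G r m a T₀ acc := by
  rcases r with _ | r
  · exact mul_le_mul_left (powerWeight_mono _ h0 hT) _
  · rw [nest, nest]
    refine (setLIntegral_mono' measurableSet_Ioo fun t ht => ?_).trans
      (lintegral_mono_set (Ioo_subset_Ioo_right hT))
    exact mul_le_mul_left (powerWeight_mono _ (by linarith [ht.2]) (by linarith)) _

lemma exists_oneSubExp_eq {s : ℝ} (h0 : 0 < s) (h1 : s < 1) : ∃ T, 0 < T ∧ oneSubExp T = s := by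
  refine ⟨-Real.log (1 - s), ?_, ?_⟩
  · have := Real.log_neg (show 0 < 1 - s by linarith) (by linarith)
    linarith
  · rw [oneSubExp, neg_neg, Real.exp_log (by linarith)]; ring

/-- The nested integral is at most linear in its smallest remaining point, so its expansion has no
constant part. It can then be integrated against `dy/y`. -/
lemma exists_nest_expansion {G : List ℝ → ℝ≥0∞} {r j N : ℕ} (hG : Sublinear (j + 1 + r) G)
    {m : Fin (r + 1) → ℕ} {a : Fin r → ℕ} {E : List ℝ → ℝ} (hE : E ∈ hyperlogSpan (j + 1) N)
    (hval : ∀ T l, 0 < T → Chain (oneSubExp T :: l) → l.length = j →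
      nest G r m a T (oneSubExp T :: l) ≠ ⊤ ∧
        (nest G r m a T (oneSubExp T :: l)).toReal = E (oneSubExp T :: l)) :
    ∃ L : List (List (Option ℕ) × (List ℝ → ℝ)),
      (∀ t ∈ L, t.1 ≠ [] ∧ GoodEnd t.1 ∧ ∃ m, t.1.length + m = N ∧ t.2 ∈ hyperlogSpan j m) ∧
      ∀ T l, 0 < T → Chain (oneSubExp T :: l) → l.length = j →
        nest G r m a T (oneSubExp T :: l) ≠ ⊤ ∧ (nest G r m a T (oneSubExp T :: l)).toReal =
          (L.map fun t => hyperlog t.1 (oneSubExp T :: l) * t.2 l).sum := by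
  obtain ⟨C, -, L, hL, hEL⟩ := hyperlogSpan_decomp hE
  refine ⟨L, hL, fun T l hT hc hl => ?_⟩
  obtain ⟨h1, h2⟩ := hval T l hT hc hl
  refine ⟨h1, ?_⟩
  have hC : C l = 0 := by
    refine constant_eq_zero (fun t ht => ⟨(hL t ht).1, (hL t ht).2.1⟩) hc
      (K := E (oneSubExp T :: l) / oneSubExp T) fun s hs0 hs => ?_
    obtain ⟨t, ht, rfl⟩ := exists_oneSubExp_eq hs0 (hs.trans_lt (oneSubExp_lt_one T))
    have hc' : Chain (oneSubExp t :: l) := by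
      refine ⟨List.pairwise_cons.2 ⟨fun x hx =>
        hs.trans_lt ((List.pairwise_cons.1 hc.1).1 x hx), hc.tail.1⟩, fun y hy => ?_⟩
      rcases List.mem_cons.1 hy with rfl | hy
      · exact ⟨hs0, oneSubExp_lt_one t⟩
      · exact hc.tail.2 y hy
    rw [← hEL _ l hc' hl, ← (hval t l ht hc' hl).2, abs_of_nonneg ENNReal.toReal_nonneg, ← h2]
    -- The endpoint enters twice, as a point of the list and as the upper limit: the first
    -- dependence gives the factor `s/s₀`, the second is monotone.
    have hle := (nest_le_of_sublinear hG r m a t hs0 hs [] l (by simp; omega)).trans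
      (mul_le_mul_right (nest_mono G r m a ht.le (oneSubExp_strictMono.le_iff_le.1 hs) _) _)
    rw [List.nil_append, List.nil_append] at hle
    have := ENNReal.toReal_mono (ENNReal.mul_ne_top ENNReal.ofReal_ne_top h1) hle
    rw [ENNReal.toReal_mul, ENNReal.toReal_ofReal (by have := oneSubExp_pos hT; positivity)] at this
    refine this.trans (le_of_eq ?_)
    ring
  rw [h2, hEL _ l hc hl, hC, zero_add]

lemma poleWord_append (l : List ℝ) (u v : List (Option ℕ)) :
    poleWord l (u ++ v) = poleWord l u ++ poleWord l v := List.map_append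

lemma poleWord_replicate {l : List ℝ} {i : ℕ} (hi : l.length ≤ i) (m : ℕ) :
    poleWord l (List.replicate m (some i)) = List.replicate m (some 1) := by
  rw [poleWord, List.map_replicate, Option.map_some, List.getD_eq_default _ _ hi, div_one]

lemma goodEnd_replicate_append {β : Type*} (m : ℕ) (x : β) {w : List (Option β)} (hw : GoodEnd w) : GoodEnd (List.replicate m (some x) ++ w) := by
  induction m with
  | zero => simpa using hw
  | succ m ih => rw [List.replicate_succ, List.cons_append]; exact ⟨by simp, ih⟩

/-- The integral of a letter and a power weight is an iterated integral. -/
lemma lintegral_power_pole {T : ℝ} (hT : 0 < T) {l : List ℝ} (hc : Chain (oneSubExp T :: l))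
    (m : ℕ) {o : Option ℕ} (ho : o = none ∨ o = some (l.length + 1)) {v : List (Option ℕ)}
    (hv : GoodEnd (o :: v)) :
    ∫⁻ t in Ioo 0 T, powerWeight (m + 1) (T - t) * (letterWeight (o.map fun _ => 1) t *
      evalSeries (wordSeries (poleWord (oneSubExp T :: l) v)) (oneSubExp t)) =
        ENNReal.ofReal (diagonalTotal (List.replicate m (some (l.length + 1)) ++ o :: v)
          (oneSubExp T :: l)) := by
  have e : o.map (fun _ => (1 : ℝ)) = o.map fun i => 1 / (oneSubExp T :: l).getD i 1 := by
    rcases ho with rfl | rfl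
    · rfl
    · rw [Option.map_some, Option.map_some, List.getD_eq_default _ _ (by simp), div_one]
  have e' : (o.map fun i => 1 / (oneSubExp T :: l).getD i 1) :: poleWord (oneSubExp T :: l) v =
    poleWord (oneSubExp T :: l) (o :: v) := rfl
  rw [e, lintegral_powerWeight_letterWeight m hT, ← evalSeries_diagonal
    (goodEnd_replicate_append m _ hv) _ hc, poleWord_append, poleWord_replicate (by simp),
    e']
  · rcases m with _ | m
    · rcases ho with rfl | rfl <;> simp
    · simp [List.replicate_succ]
  · rw [e']; exact hv.map _
  · rw [e']; exact fun β hβ => poleWord_nonneg hc _ β hβ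

/-- The value of the integral in `lintegral_omega_pole`. -/
def stepTotal (j m a : ℕ) (v : List (Option ℕ)) (l : List ℝ) : ℝ :=
  diagonalTotal (List.replicate m (some (j + 1)) ++ none :: v) l +
    if a = 0 then diagonalTotal (List.replicate m (some (j + 1)) ++ some (j + 1) :: v) l else 0

lemma head?_replicate_append_ne {j m : ℕ} {o : Option ℕ} (ho : o ≠ some 0) (v : List (Option ℕ)) :
    (List.replicate m (some (j + 1)) ++ o :: v).head? ≠ some (some 0) := by
  rcases m with _ | m
  · simpa using ho
  · simp [List.replicate_succ]

lemma stepTotal_mem (j m a : ℕ) {v : List (Option ℕ)} (hv : GoodEnd v) (hne : v ≠ []) :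
    stepTotal j m a v ∈ hyperlogSpan (j + 1) (m + 1 + v.length) := by
  have h : ∀ o : Option ℕ, o ≠ some 0 → GoodEnd (o :: v) →
      diagonalTotal (List.replicate m (some (j + 1)) ++ o :: v) ∈
        hyperlogSpan (j + 1) (m + 1 + v.length) := fun o ho hov => by
    have := diagonal_mem_hyperlogSpan j (goodEnd_replicate_append m (j + 1) hov)
      (head?_replicate_append_ne ho v)
    rwa [List.length_append, List.length_replicate, List.length_cons,
      show m + (v.length + 1) = m + 1 + v.length by omega] at this
  have h1 := h none (by simp) (goodEnd_cons.2 ⟨fun h => absurd h hne, hv⟩)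
  have h2 := h (some (j + 1)) (by simp) (goodEnd_cons.2 ⟨by simp, hv⟩)
  by_cases ha : a = 0
  · convert add_mem h1 h2 using 1
    ext l
    simp [stepTotal, ha]
  · convert h1 using 1
    ext l
    simp [stepTotal, ha]

/-- Integration up to the next point prepends one letter, or a sum of two when `a = 0`, and then a
block of `dx/(1-x)`. The endpoint is itself among the poles, so the result is a diagonal value. -/
lemma lintegral_omega_pole {T : ℝ} (hT : 0 < T) {l : List ℝ} (hc : Chain (oneSubExp T :: l))
    (m : ℕ) {a : ℕ} (ha : a = 0 ∨ a = 1) {v : List (Option ℕ)} (hv : GoodEnd v) (hne : v ≠ []) :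
    ∫⁻ t in Ioo 0 T, powerWeight (m + 1) (T - t) * omega a t *
      evalSeries (wordSeries (poleWord (oneSubExp T :: l) v)) (oneSubExp t) =
        ENNReal.ofReal (stepTotal l.length m a v (oneSubExp T :: l)) := by
  have h1 := lintegral_power_pole hT hc m (.inl rfl) (v := v) (goodEnd_cons.2 ⟨fun h => absurd h hne, hv⟩)
  have h2 := lintegral_power_pole hT hc m (.inr rfl) (v := v) (goodEnd_cons.2 ⟨by simp, hv⟩)
  rcases ha with rfl | rfl
  · rw [stepTotal, if_pos rfl, ENNReal.ofReal_add (diagonalTotal_nonneg _ hc)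
      (diagonalTotal_nonneg _ hc), ← h1, ← h2, ← lintegral_add_left]
    · refine setLIntegral_congr_fun measurableSet_Ioo fun t ht => ?_
      rw [omega_zero ht.1]
      simp only [Option.map_none, Option.map_some]
      ring
    · have h3 := (measurable_evalSeries (wordSeries (poleWord (oneSubExp T :: l) v))).comp
        measurable_oneSubExp
      exact ((measurable_powerWeight _).comp (measurable_const.sub measurable_id)).mul
        ((measurable_letterWeight _).mul h3)
  · rw [stepTotal, if_neg one_ne_zero, add_zero, ← h1]
    refine setLIntegral_congr_fun measurableSet_Ioo fun t ht => ?_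
    rw [omega_one, mul_assoc]
    rfl

lemma chain_cons {t T : ℝ} (ht : 0 < t) (h : t < T) {l : List ℝ} (hc : Chain (oneSubExp T :: l)) :
    Chain (oneSubExp t :: oneSubExp T :: l) := by
  have hlt := oneSubExp_strictMono h
  refine ⟨List.pairwise_cons.2 ⟨fun x hx => ?_, hc.1⟩, fun y hy => ?_⟩
  · rcases List.mem_cons.1 hx with rfl | hx
    · exact hlt
    · exact hlt.trans ((List.pairwise_cons.1 hc.1).1 x hx)
  · rcases List.mem_cons.1 hy with rfl | hy
    · exact ⟨oneSubExp_pos ht, oneSubExp_lt_one t⟩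
    · exact hc.2 y hy

/-- Induction from the innermost integral outwards: expand in the smallest point, integrate it up to
the next, and re-expand the diagonal values. Each integration adds 1 to the length and each power
its exponent. -/
theorem exists_nest_eq {G : List ℝ → ℝ≥0∞} {g : List ℝ → ℝ} (r : ℕ) {j N : ℕ}
    (hG : Sublinear (j + 1 + r) G) (hg : g ∈ hyperlogSpan (j + 1 + r) N)
    (hval : ∀ l, Chain l → l.length = j + 1 + r → G l ≠ ⊤ ∧ (G l).toReal = g l)
    (m : Fin (r + 1) → ℕ) (a : Fin r → ℕ) (ha : ∀ i, a i = 0 ∨ a i = 1) :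
    ∃ E ∈ hyperlogSpan (j + 1) (N + ∑ i, m i + r),
      ∀ T l, 0 < T → Chain (oneSubExp T :: l) → l.length = j →
        nest G r m a T (oneSubExp T :: l) ≠ ⊤ ∧
          (nest G r m a T (oneSubExp T :: l)).toReal = E (oneSubExp T :: l) := by
  induction r generalizing j with
  | zero =>
    -- Position `j` lies just beyond the list of the other points, so it denotes the default pole 1.
    have hgr : GoodEnd (List.replicate (m 0) (some j)) := by
      induction m 0 with
      | zero => trivial
      | succ m ih => exact goodEnd_cons.2 ⟨by simp, ih⟩
    have hH : hyperlog (List.replicate (m 0) (some j)) ∈ hyperlogSpan (j + 1) (m 0) :=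
      mem_hyperlogSpan_succ hgr (m := 0) (by simp) (const_mem_hyperlogSpan (x := 1)
        (Submodule.subset_span ⟨[], ⟨trivial, by simp⟩, rfl, by simp [unitTotal]⟩) j) (by simp)
    refine ⟨g * hyperlog (List.replicate (m 0) (some j)), ?_, fun T l hT hc hl => ?_⟩
    · have := hyperlogSpan_mul hg hH
      rwa [show N + m 0 = N + ∑ i, m i + 0 by simp] at this
    · obtain ⟨h1, h2⟩ := hval _ hc (by simp [hl])
      have h3 : powerWeight (m 0 + 1) T =
          ENNReal.ofReal (hyperlog (List.replicate (m 0) (some j)) (oneSubExp T :: l)) := by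
        rw [powerWeight_eq _ hT, ← evalSeries_poleWord hgr hc, poleWord_replicate hl.le]
      rw [nest, h3]
      refine ⟨ENNReal.mul_ne_top ENNReal.ofReal_ne_top h1, ?_⟩
      rw [ENNReal.toReal_mul, ENNReal.toReal_ofReal (hyperlog_nonneg _ hc), h2, mul_comm]
      rfl
  | succ r ih =>
    rw [show j + 1 + (r + 1) = j + 1 + 1 + r by omega] at hG hg hval
    obtain ⟨E, hE, hEv⟩ := ih (j := j + 1) hG hg hval (Fin.tail m) (Fin.tail a) fun i => ha _
    obtain ⟨L, hL, hLv⟩ := exists_nest_expansion hG hE hEv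
    refine ⟨fun l => (L.map fun t => stepTotal j (m 0) (a 0) t.1 l * t.2 l).sum, ?_,
      fun T l hT hc hl => ?_⟩
    · have : (L.map fun t => stepTotal j (m 0) (a 0) t.1 * t.2).sum ∈
          hyperlogSpan (j + 1) (N + ∑ i, m i + (r + 1)) := by
        refine list_sum_mem fun x hx => ?_
        rw [List.mem_map] at hx
        obtain ⟨t, ht, rfl⟩ := hx
        obtain ⟨h1, h2, k, h3, h4⟩ := hL t ht
        have := hyperlogSpan_mul (stepTotal_mem j (m 0) (a 0) h2 h1) h4
        rwa [show m 0 + 1 + t.1.length + k = N + ∑ i, m i + (r + 1) by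
          rw [Fin.sum_univ_succ]
          have : t.1.length + k = N + ∑ i : Fin (r + 1), m i.succ + r := h3
          omega] at this
      convert this using 1
      ext l
      rw [sum_map_apply]
      rfl
    · subst hl
      rw [nest]
      simp only [← mul_assoc]
      refine lintegral_combination measurableSet_Ioo
        (((measurable_powerWeight _).comp (measurable_const.sub measurable_id)).mul
          (measurable_omega _)) (l := oneSubExp T :: l) (fun t ht => ?_)
        (fun t ht => (hL t ht).2.1) (fun v => stepTotal l.length (m 0) (a 0) v (oneSubExp T :: l))
        (fun t ht => ?_) (fun t ht => lintegral_omega_pole hT hc _ (ha 0) (hL t ht).2.1 (hL t ht).1)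
        (fun t ht => ?_)
      · exact chain_cons ht.1 ht.2 hc
      · unfold stepTotal
        have h1 := fun v => diagonalTotal_nonneg v hc
        split_ifs
        · exact add_nonneg (h1 _) (h1 _)
        · exact add_nonneg (h1 _) le_rfl
      · exact hLv t _ ht.1 (chain_cons ht.1 ht.2 hc) (by simp)

/-- The outermost weight `omega 1` puts `dx/x` in front of every word. This gives convergence up to
the endpoint 1 and admissibility. -/
theorem lintegral_nest_mem {G : List ℝ → ℝ≥0∞} {g : List ℝ → ℝ} (r : ℕ) {N : ℕ}
    (hG : Sublinear (r + 1) G) (hg : g ∈ hyperlogSpan (r + 1) N)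
    (hval : ∀ l, Chain l → l.length = r + 1 → G l ≠ ⊤ ∧ (G l).toReal = g l)
    (m : Fin (r + 1) → ℕ) (a : Fin r → ℕ) (ha : ∀ i, a i = 0 ∨ a i = 1) :
    ∫⁻ T in Ioi 0, omega 1 T * nest G r m a T [oneSubExp T] ≠ ⊤ ∧
      (∫⁻ T in Ioi 0, omega 1 T * nest G r m a T [oneSubExp T]).toReal ∈
        wordSpan (N + ∑ i, m i + (r + 1)) := by
  rw [show r + 1 = 0 + 1 + r by omega] at hG hg hval
  obtain ⟨E, hE, hEv⟩ := exists_nest_eq r hG hg hval m a ha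
  obtain ⟨L, hL, hLv⟩ := exists_nest_expansion hG hE hEv
  have hch : ∀ T ∈ Ioi (0 : ℝ), Chain [oneSubExp T] := fun T hT =>
    ⟨by simp, by simpa using ⟨oneSubExp_pos hT, oneSubExp_lt_one T⟩⟩
  have hadm : ∀ t ∈ L, AdmissibleWord (none :: t.1.map (Option.map fun _ => ())) := fun t ht =>
    ⟨goodEnd_cons.2 ⟨by simp [(hL t ht).1], (hL t ht).2.1.map _⟩, by simp⟩
  have hun : ∀ v : List (Option ℕ), none :: poleWord [] v =
      (none :: v.map (Option.map fun _ => ())).map (Option.map fun _ => (1 : ℝ)) := fun v => by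
    simp only [poleWord, List.map_cons, Option.map_none, List.map_map, Option.map_comp_map]
    congr 3
    ext i
    simp
  obtain ⟨h1, h2⟩ := lintegral_combination measurableSet_Ioi (measurable_omega 1) (l := [])
    hch (fun t ht => (hL t ht).2.1) (fun v => unitTotal (none :: v.map (Option.map fun _ => ())))
    (fun t ht => total_nonneg (fun β hβ => ((hadm t ht).convergent.unit β hβ).1)) (fun t ht => by
      simp only [omega_one]
      have hc := (hadm t ht).convergent
      rw [← hun] at hc
      rw [represents_Ioi.lintegral_letterWeight hc.goodEnd (fun β hβ => (hc.unit β hβ).1),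
        evalSeries_wordSeries_one hc, unitTotal, hun])
    (fun T hT => hLv T [] hT (hch T hT) rfl)
  refine ⟨h1, h2 ▸ list_sum_mem fun x hx => ?_⟩
  rw [List.mem_map] at hx
  obtain ⟨t, ht, rfl⟩ := hx
  obtain ⟨-, -, k, h3, h4⟩ := hL t ht
  have := wordSpan_mul (Submodule.subset_span ⟨_, hadm t ht, rfl, rfl⟩) h4
  rwa [show (none :: t.1.map (Option.map fun _ => ())).length + k = N + ∑ i, m i + (r + 1) by
    simp only [List.length_cons, List.length_map]; omega] at this

end ArakawaKaneko

end

noncomputable section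

namespace ArakawaKaneko

open PowerSeries MeasureTheory Set
open scoped ENNReal

/-! ### Integrals over the orthant -/

lemma measurableSet_orthant (r : ℕ) : MeasurableSet (orthant r) := by
  have : orthant r = ⋂ j, {t | 0 < t j} := by ext; simp [orthant]
  rw [this]
  exact MeasurableSet.iInter fun j => measurableSet_lt measurable_const (measurable_pi_apply j)

@[fun_prop]
lemma measurable_tailSum {r : ℕ} (j : Fin r) : Measurable fun t : Fin r → ℝ => tailSum t j := by
  unfold tailSum
  fun_prop

lemma tailSum_pos {r : ℕ} {t : Fin r → ℝ} (ht : t ∈ orthant r) (j : Fin r) : 0 < tailSum t j :=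
  Finset.sum_pos (fun i _ => ht i) ⟨j, by simp⟩

lemma tailSum_cons_succ {r : ℕ} (t : ℝ) (x : Fin r → ℝ) (j : Fin r) :
    tailSum (Fin.cons t x : Fin (r + 1) → ℝ) j.succ = tailSum x j := by
  unfold tailSum
  rw [← Fin.map_succEmb_Ici, Finset.sum_map]
  simp

lemma tailSum_zero {r : ℕ} (t : Fin (r + 1) → ℝ) : tailSum t 0 = ∑ i, t i := by
  unfold tailSum
  congr 1
  ext i
  simp

lemma tailSum_cons {r : ℕ} (t : ℝ) (x : Fin (r + 1) → ℝ) :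
    tailSum (Fin.cons t x : Fin (r + 2) → ℝ) = Fin.cons (t + tailSum x 0) (tailSum x) := by
  ext j
  refine Fin.cases ?_ (fun j => ?_) j
  · rw [tailSum_zero, Fin.sum_univ_succ, tailSum_zero]; simp
  · rw [tailSum_cons_succ, Fin.cons_succ]

@[fun_prop]
lemma measurable_finCons {α : Type*} [MeasurableSpace α] {r : ℕ} {f : α → ℝ}
    {g : α → Fin r → ℝ} (hf : Measurable f) (hg : Measurable g) :
    Measurable fun x => (Fin.cons (f x) (g x) : Fin (r + 1) → ℝ) := by
  refine measurable_pi_lambda _ fun j => ?_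
  refine Fin.cases ?_ (fun j => ?_) j
  · simpa using hf
  · simp only [Fin.cons_succ]
    exact (measurable_pi_apply j).comp hg

lemma cons_mem_orthant {r : ℕ} {t : ℝ} {x : Fin r → ℝ} :
    (Fin.cons t x : Fin (r + 1) → ℝ) ∈ orthant (r + 1) ↔ 0 < t ∧ x ∈ orthant r := by
  simp [orthant, Fin.forall_fin_succ]

lemma lintegral_orthant_succ {r : ℕ} {f : (Fin (r + 1) → ℝ) → ℝ≥0∞} (hf : Measurable f) :
    ∫⁻ t in orthant (r + 1), f t =
      ∫⁻ t in Ioi 0, ∫⁻ x in orthant r, f (Fin.cons t x) := by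
  have hmp := (volume_preserving_piFinSuccAbove (fun _ : Fin (r + 1) => ℝ) 0).symm
  have hm := hf.indicator (measurableSet_orthant (r + 1))
  rw [← lintegral_indicator (measurableSet_orthant _), ← hmp.lintegral_comp hm,
    Measure.volume_eq_prod, lintegral_prod (fun a => (orthant (r + 1)).indicator f
      ((MeasurableEquiv.piFinSuccAbove (fun _ => ℝ) 0).symm a)) (hm.comp hmp.measurable).aemeasurable,
    ← lintegral_indicator measurableSet_Ioi]
  refine lintegral_congr fun t => ?_
  by_cases ht : t ∈ Ioi (0 : ℝ)
  · rw [indicator_of_mem ht, ← lintegral_indicator (measurableSet_orthant _)]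
    refine lintegral_congr fun x => ?_
    change (orthant (r + 1)).indicator f (Fin.insertNth 0 t x) = _
    rw [Fin.insertNth_zero']
    have h0 : (0 : ℝ) < t := ht
    by_cases hx : x ∈ orthant r
    · rw [indicator_of_mem hx, indicator_of_mem (cons_mem_orthant.2 ⟨ht, hx⟩)]
    · rw [indicator_of_notMem hx, indicator_of_notMem fun h => hx (cons_mem_orthant.1 h).2]
  · rw [indicator_of_notMem ht]
    refine lintegral_eq_zero_of_ae_eq_zero (Filter.Eventually.of_forall fun x => ?_)
    change (orthant (r + 1)).indicator f (Fin.insertNth 0 t x) = _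
    rw [Fin.insertNth_zero']
    exact indicator_of_notMem (fun h => ht (cons_mem_orthant.1 h).1) _

/-- The iterated integral over `T > x₀ > x₁ > ⋯ > 0`, with powers of the differences. -/
def inner : (r : ℕ) → (Fin (r + 1) → ℕ) → ℝ → ((Fin r → ℝ) → ℝ≥0∞) → ℝ≥0∞
  | 0, m, T, Ψ => powerWeight (m 0 + 1) T * Ψ Fin.elim0
  | r + 1, m, T, Ψ => ∫⁻ t in Ioo 0 T, powerWeight (m 0 + 1) (T - t) *
      inner r (Fin.tail m) t fun x => Ψ (Fin.cons t x)

lemma measurable_inner (r : ℕ) (m : Fin (r + 1) → ℕ) {α : Type*} [MeasurableSpace α] {f : α → ℝ}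
    (hf : Measurable f) {Ψ : α → (Fin r → ℝ) → ℝ≥0∞} (hΨ : Measurable (Function.uncurry Ψ)) :
    Measurable fun y => inner r m (f y) (Ψ y) := by
  induction r generalizing α with
  | zero =>
    simp only [inner]
    exact ((measurable_powerWeight _).comp hf).mul
      (hΨ.comp (measurable_id.prodMk measurable_const))
  | succ r ih =>
    simp only [inner, ← lintegral_indicator measurableSet_Ioo]
    have hin : Measurable fun p : α × ℝ =>
        inner r (Fin.tail m) p.2 fun x => Ψ p.1 (Fin.cons p.2 x) := by
      refine ih (Fin.tail m) measurable_snd (Ψ := fun p x => Ψ p.1 (Fin.cons p.2 x)) ?_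
      exact hΨ.comp (by fun_prop : Measurable fun q : (α × ℝ) × (Fin r → ℝ) =>
        (q.1.1, (Fin.cons q.1.2 q.2 : Fin (r + 1) → ℝ)))
    have hs : MeasurableSet {p : α × ℝ | 0 < p.2 ∧ p.2 < f p.1} :=
      (measurableSet_lt measurable_const measurable_snd).inter
        (measurableSet_lt measurable_snd (hf.comp measurable_fst))
    have hF : Measurable fun p : α × ℝ => powerWeight (m 0 + 1) (f p.1 - p.2) *
        inner r (Fin.tail m) p.2 fun x => Ψ p.1 (Fin.cons p.2 x) :=
      ((measurable_powerWeight _).comp ((hf.comp measurable_fst).sub measurable_snd)).mul hin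
    have h := Measurable.lintegral_prod_right' (ν := (volume : Measure ℝ)) (hF.indicator hs)
    refine (congrArg Measurable (funext fun y => lintegral_congr fun t => ?_)).mp h
    by_cases ht : t ∈ Ioo 0 (f y)
    · rw [indicator_of_mem ht, indicator_of_mem (show (y, t) ∈ _ from ht)]
    · rw [indicator_of_notMem ht, indicator_of_notMem (show (y, t) ∉ _ from ht)]

/-- The substitution `T = t + s`: the orthant becomes the region `0 < s < T`. -/
lemma lintegral_shear {w : ℝ → ℝ≥0∞} (hw : Measurable w) {H : ℝ → ℝ → ℝ≥0∞}
    (hH : Measurable (Function.uncurry H)) :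
    ∫⁻ t in Ioi 0, ∫⁻ s in Ioi 0, w t * H s (t + s) =
      ∫⁻ T in Ioi 0, ∫⁻ s in Ioo 0 T, w (T - s) * H s T := by
  have hH2 : ∀ {α : Type} [MeasurableSpace α] {u v : α → ℝ}, Measurable u → Measurable v →
      Measurable fun x => H (u x) (v x) := fun hu hv => hH.comp (hu.prodMk hv)
  rw [lintegral_lintegral_swap
    (by exact ((hw.comp measurable_fst).mul (hH2 measurable_snd (by fun_prop))).aemeasurable)]
  have h1 : ∀ s, ∫⁻ t in Ioi 0, w t * H s (t + s) =
      ∫⁻ T, (Ioi s).indicator (fun T => w (T - s) * H s T) T := fun s => by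
    rw [← lintegral_add_right_eq_self (fun T => (Ioi s).indicator _ T) s,
      ← lintegral_indicator measurableSet_Ioi]
    refine lintegral_congr fun t => ?_
    by_cases ht : t ∈ Ioi (0 : ℝ)
    · rw [indicator_of_mem ht, indicator_of_mem (show t + s ∈ Ioi s by simpa using ht),
        add_sub_cancel_right]
    · rw [indicator_of_notMem ht, indicator_of_notMem (show t + s ∉ Ioi s by simpa using ht)]
  have hs : MeasurableSet {p : ℝ × ℝ | p.1 < p.2} := measurableSet_lt measurable_fst measurable_snd
  simp only [h1]
  rw [lintegral_lintegral_swap]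
  · rw [← lintegral_indicator measurableSet_Ioi]
    refine lintegral_congr fun T => ?_
    by_cases hT : T ∈ Ioi (0 : ℝ)
    · rw [indicator_of_mem hT, ← lintegral_indicator measurableSet_Ioi,
        ← lintegral_indicator measurableSet_Ioo]
      refine lintegral_congr fun s => ?_
      by_cases h0 : 0 < s
      · rw [indicator_of_mem (show s ∈ Ioi 0 from h0)]
        by_cases h2 : s < T
        · rw [indicator_of_mem (show T ∈ Ioi s from h2),
            indicator_of_mem (show s ∈ Ioo 0 T from ⟨h0, h2⟩)]
        · rw [indicator_of_notMem (show T ∉ Ioi s from h2),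
            indicator_of_notMem fun h : s ∈ Ioo 0 T => h2 h.2]
      · rw [indicator_of_notMem (show s ∉ Ioi 0 from h0),
          indicator_of_notMem fun h : s ∈ Ioo 0 T => h0 h.1]
    · rw [indicator_of_notMem hT]
      rw [setLIntegral_congr_fun (g := fun _ => 0) measurableSet_Ioi fun s hs => ?_]
      · simp
      · exact indicator_of_notMem (fun h => hT (lt_trans hs h)) _
  · have hm : Measurable fun p : ℝ × ℝ => w (p.2 - p.1) * H p.1 p.2 :=
      (hw.comp (measurable_snd.sub measurable_fst)).mul hH
    exact (hm.indicator hs).aemeasurable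

/-- Passing to the tail sums turns the orthant into a simplex of decreasing variables and the powers
of `t_j` into powers of consecutive differences. -/
lemma lintegral_orthant_tailSum (r : ℕ) (m : Fin (r + 1) → ℕ) {Ψ : (Fin (r + 1) → ℝ) → ℝ≥0∞}
    (hΨ : Measurable Ψ) :
    ∫⁻ t in orthant (r + 1), (∏ j, powerWeight (m j + 1) (t j)) * Ψ (tailSum t) =
      ∫⁻ T in Ioi 0, inner r m T fun x => Ψ (Fin.cons T x) := by
  have hts : ∀ n, Measurable (tailSum : (Fin n → ℝ) → Fin n → ℝ) := fun n =>
    measurable_pi_lambda _ measurable_tailSum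
  have hpw : ∀ n (m : Fin n → ℕ), Measurable fun t : Fin n → ℝ =>
      ∏ j, powerWeight (m j + 1) (t j) := fun n m =>
    Finset.measurable_prod _ fun j _ => (measurable_powerWeight _).comp (measurable_pi_apply j)
  have hmm : ∀ n (m : Fin n → ℕ) {Ψ : (Fin n → ℝ) → ℝ≥0∞}, Measurable Ψ → Measurable fun t =>
      (∏ j, powerWeight (m j + 1) (t j)) * Ψ (tailSum t) := fun n m Ψ hΨ =>
    (hpw n m).mul (hΨ.comp (hts n))
  induction r with
  | zero =>
    rw [lintegral_orthant_succ (hmm _ m hΨ)]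
    refine setLIntegral_congr_fun measurableSet_Ioi fun t ht => ?_
    have h0 : orthant 0 = univ := by ext; simp [orthant]
    rw [h0, Measure.restrict_univ, Measure.volume_pi_eq_dirac Fin.elim0, lintegral_dirac, inner,
      Fin.prod_univ_succ, Finset.prod_of_isEmpty, mul_one, Fin.cons_zero]
    congr 2
    ext j
    rw [show j = 0 from Fin.ext (by omega), tailSum_zero]
    simp
  | succ r ih =>
    rw [lintegral_orthant_succ (hmm _ m hΨ)]
    have h1 : ∀ t : ℝ, ∫⁻ x in orthant (r + 1), (∏ j, powerWeight (m j + 1)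
        ((Fin.cons t x : Fin (r + 2) → ℝ) j)) * Ψ (tailSum (Fin.cons t x : Fin (r + 2) → ℝ)) =
        ∫⁻ s in Ioi 0, powerWeight (m 0 + 1) t *
          inner r (Fin.tail m) s fun x => Ψ (Fin.cons (t + s) (Fin.cons s x)) := fun t => by
      have hΨ' : Measurable fun x : Fin (r + 1) → ℝ =>
          Ψ (Fin.cons (t + x 0) x) := hΨ.comp (by fun_prop)
      have := ih (Fin.tail m) hΨ'
      simp only [Fin.cons_zero] at this
      have hin : Measurable fun s : ℝ =>
          inner r (Fin.tail m) s fun x => Ψ (Fin.cons (t + s) (Fin.cons s x)) :=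
        measurable_inner r (Fin.tail m) measurable_id
          (Ψ := fun s x => Ψ (Fin.cons (t + s) (Fin.cons s x))) (hΨ.comp (by fun_prop))
      rw [lintegral_const_mul _ hin, ← this, ← lintegral_const_mul _ (hmm _ (Fin.tail m) hΨ')]
      refine lintegral_congr fun x => ?_
      rw [Fin.prod_univ_succ, tailSum_cons, mul_assoc]
      simp [Fin.tail]
    simp only [h1]
    rw [lintegral_shear (w := powerWeight (m 0 + 1))
      (H := fun s T => inner r (Fin.tail m) s fun x => Ψ (Fin.cons T (Fin.cons s x)))
      (measurable_powerWeight _)]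
    · rfl
    · exact measurable_inner r (Fin.tail m) measurable_fst
        (Ψ := fun (p : ℝ × ℝ) x => Ψ (Fin.cons p.2 (Fin.cons p.1 x))) (hΨ.comp (by fun_prop))

/-- The constant `c` absorbs the weights of the variables already fixed. The variables decrease, so
putting each new point in front keeps the list increasing. -/
lemma inner_eq_nest (G : List ℝ → ℝ≥0∞) (r : ℕ) (m : Fin (r + 1) → ℕ) (a : Fin r → ℕ) (T : ℝ)
    (acc : List ℝ) {c : ℝ≥0∞} (hc : c ≠ ⊤) :
    inner r m T (fun x => c * ((∏ j, omega (a j) (x j)) *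
      G ((List.ofFn fun j => oneSubExp (x j)).reverse ++ acc))) = c * nest G r m a T acc := by
  induction r generalizing T acc c with
  | zero => simp [inner, nest]; ring
  | succ r ih =>
    rw [inner, nest, ← lintegral_const_mul' _ _ hc]
    refine lintegral_congr fun t => ?_
    have := ih (Fin.tail m) (Fin.tail a) t (oneSubExp t :: acc) (c := c * omega (a 0) t)
      (ENNReal.mul_ne_top hc ENNReal.ofReal_ne_top)
    rw [mul_left_comm, ← mul_assoc c, ← this]
    congr 2
    ext x
    simp only [Fin.prod_univ_succ, Fin.cons_zero, Fin.cons_succ, List.ofFn_succ, List.reverse_cons,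
      List.append_assoc, List.cons_append, List.nil_append, Fin.tail]
    ring

/-! ### Words formed from single letters separated by blocks of a fixed letter. -/

/-- The word `c^{m₀} β₁ c^{m₁} ⋯ β_r c^{m_r}`. -/
def blockWord {α : Type*} (c : α) : (r : ℕ) → (Fin (r + 1) → ℕ) → (Fin r → α) → List (Option α)
  | 0, m, _ => List.replicate (m 0) (some c)
  | r + 1, m, β => List.replicate (m 0) (some c) ++
      some (β 0) :: blockWord c r (Fin.tail m) (Fin.tail β)

lemma goodEnd_of_forall_ne_none {α : Type*} {w : List (Option α)} (h : ∀ x ∈ w, x ≠ none) :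
    GoodEnd w := by
  induction w with
  | nil => trivial
  | cons x w ih => exact goodEnd_cons.2 ⟨fun _ => h x (by simp), ih fun y hy => h y (by simp [hy])⟩

lemma mem_blockWord {α : Type*} {c : α} {r : ℕ} {m : Fin (r + 1) → ℕ} {β : Fin r → α}
    {x : Option α} (hx : x ∈ blockWord c r m β) : x = some c ∨ ∃ j, x = some (β j) := by
  induction r with
  | zero => exact .inl (List.eq_of_mem_replicate hx)
  | succ r ih =>
    rw [blockWord, List.mem_append, List.mem_cons] at hx
    rcases hx with h | rfl | h
    · exact .inl (List.eq_of_mem_replicate h)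
    · exact .inr ⟨0, rfl⟩
    · rcases ih h with h | ⟨j, h⟩
      · exact .inl h
      · exact .inr ⟨j.succ, h⟩

lemma goodEnd_cons_blockWord {α : Type*} (b c : α) {r : ℕ} (m : Fin (r + 1) → ℕ) (β : Fin r → α) :
    GoodEnd (some b :: blockWord c r m β) :=
  goodEnd_of_forall_ne_none fun x hx => by
    rcases List.mem_cons.1 hx with rfl | hx
    · simp
    · rcases mem_blockWord hx with rfl | ⟨j, rfl⟩ <;> simp

lemma length_blockWord {α : Type*} (c : α) {r : ℕ} (m : Fin (r + 1) → ℕ) (β : Fin r → α) :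
    (blockWord c r m β).length = ∑ j, m j + r := by
  induction r with
  | zero => simp [blockWord]
  | succ r ih =>
    rw [blockWord, List.length_append, List.length_cons, ih, List.length_replicate,
      Fin.sum_univ_succ (n := r + 1)]
    simp only [Fin.tail]
    omega

lemma map_blockWord {α γ : Type*} (f : α → γ) (c : α) {r : ℕ} (m : Fin (r + 1) → ℕ)
    (β : Fin r → α) :
    (blockWord c r m β).map (Option.map f) = blockWord (f c) r m fun j => f (β j) := by
  induction r with
  | zero => simp [blockWord]
  | succ r ih =>
    rw [blockWord, List.map_append, List.map_cons, ih, List.map_replicate]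
    rfl

lemma inner_letterWeight {r : ℕ} (m : Fin (r + 1) → ℕ) {β : Fin r → ℝ} (hβ : ∀ j, 0 ≤ β j)
    (hβ' : ∀ j, β j ≤ 1) {T : ℝ}
    (hT : 0 < T) {c : ℝ≥0∞} (hc : c ≠ ⊤) :
    inner r m T (fun x => c * ∏ j, letterWeight (some (β j)) (x j)) =
      c * evalSeries (wordSeries (blockWord 1 r m β)) (oneSubExp T) := by
  induction r generalizing T c with
  | zero => rw [inner, blockWord, powerWeight_eq _ hT]; simp [mul_comm]
  | succ r ih =>
    rw [inner, blockWord, ← lintegral_powerWeight_letterWeight _ hT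
      (goodEnd_cons_blockWord _ _ _ _), ← lintegral_const_mul' _ _ hc]
    · refine setLIntegral_congr_fun measurableSet_Ioo fun t ht => ?_
      have hlt : letterWeight (some (β 0)) t ≠ ⊤ := by
        rw [letterWeight_some (hβ 0) (hβ' 0) ht.1]
        exact ENNReal.ofReal_ne_top
      rw [mul_left_comm, ← mul_assoc c, ← ih (Fin.tail m) (β := Fin.tail β) (fun j => hβ _) (fun j => hβ' _) ht.1
        (ENNReal.mul_ne_top hc hlt)]
      congr 2
      ext x
      simp only [Fin.prod_univ_succ, Fin.cons_zero, Fin.cons_succ, Fin.tail]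
      ring
    · intro b hb
      rcases List.mem_cons.1 hb with h | h
      · exact (Option.some.inj h) ▸ hβ 0
      · rcases mem_blockWord h with h | ⟨j, h⟩
        · exact (Option.some.inj h) ▸ zero_le_one
        · exact (Option.some.inj h) ▸ hβ _

end ArakawaKaneko

end

noncomputable section

namespace ArakawaKaneko

open PowerSeries MeasureTheory Set
open scoped ENNReal

/-! ### The positive double integral -/

lemma coeff_geom_le {s s₀ : ℝ} (h0 : 0 < s) (hs : s ≤ s₀) (m : ℕ) :
    coeff m (geom s) ≤ s / s₀ * coeff m (geom s₀) := by
  rw [coeff_geom, coeff_geom]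
  rcases m with _ | m
  · simp
  · have h := pow_le_pow_left₀ h0.le hs m
    have := (h0.trans_le hs).ne'
    simp only [Nat.add_eq_zero_iff, one_ne_zero, and_false, if_false]
    calc s ^ (m + 1) = s * s ^ m := pow_succ' s m
      _ ≤ s * s₀ ^ m := mul_le_mul_of_nonneg_left h h0.le
      _ = s / s₀ * s₀ ^ (m + 1) := by field_simp; ring

/-- The letter has a numerator proportional to its parameter; this is the source of the linear bound
that makes `dy/y` integrable. -/
lemma letterWeight_some_le {s s₀ : ℝ} (h0 : 0 < s) (hs : s ≤ s₀) (t : ℝ) :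
    letterWeight (some s) t ≤ ENNReal.ofReal (s / s₀) * letterWeight (some s₀) t := by
  rw [letterWeight, letterWeight, mul_left_comm]
  refine mul_le_mul_right ?_ _
  rw [evalSeries, evalSeries, ← ENNReal.tsum_mul_left]
  refine ENNReal.tsum_le_tsum fun m => ?_
  rw [← mul_assoc, ← ENNReal.ofReal_mul (div_nonneg h0.le (h0.le.trans hs))]
  exact mul_le_mul_left (ENNReal.ofReal_le_ofReal (coeff_geom_le h0 hs m)) _

lemma measurable_letterWeight_some :
    Measurable fun p : ℝ × ℝ => letterWeight (some p.1) p.2 := by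
  have h := measurable_oneSubExp
  have h1 : ∀ m, Measurable fun p : ℝ × ℝ => ENNReal.ofReal (coeff m (geom p.1)) := fun m => by
    simp only [coeff_geom]
    split_ifs
    · fun_prop
    · fun_prop
  unfold letterWeight evalSeries letterSeries
  exact (by fun_prop : Measurable fun p : ℝ × ℝ =>
    ENNReal.ofReal (Real.exp (-p.2) / oneSubExp p.2)).mul
    (Measurable.tsum fun m => (h1 m).mul (by fun_prop))

/-- The integral over the second family of variables. -/
def letterIntegral {r : ℕ} (m : Fin (r + 1) → ℕ) (β : Fin (r + 1) → ℝ) : ℝ≥0∞ :=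
  ∫⁻ x in orthant (r + 1), (∏ j, powerWeight (m j + 1) (x j)) *
    ∏ j, letterWeight (some (β j)) (tailSum x j)

lemma measurable_prod_powerWeight {n : ℕ} (m : Fin n → ℕ) :
    Measurable fun t : Fin n → ℝ => ∏ j, powerWeight (m j + 1) (t j) :=
  Finset.measurable_prod _ fun j _ => (measurable_powerWeight _).comp (measurable_pi_apply j)

lemma measurable_letterIntegral {r : ℕ} (m : Fin (r + 1) → ℕ) : Measurable (letterIntegral m) := by
  have h1 : ∀ j, Measurable fun p : (Fin (r + 1) → ℝ) × (Fin (r + 1) → ℝ) =>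
      letterWeight (some (p.1 j)) (tailSum p.2 j) := fun j => by
    have h : Measurable fun p : (Fin (r + 1) → ℝ) × (Fin (r + 1) → ℝ) => (p.1 j, tailSum p.2 j) := by
      fun_prop
    have h' := Measurable.comp (g := fun p : ℝ × ℝ => letterWeight (some p.1) p.2)
      measurable_letterWeight_some h
    simpa only [Function.comp_def] using h'
  have h2 : Measurable fun p : (Fin (r + 1) → ℝ) × (Fin (r + 1) → ℝ) =>
      (∏ j, powerWeight (m j + 1) (p.2 j)) * ∏ j, letterWeight (some (p.1 j)) (tailSum p.2 j) :=
    ((measurable_prod_powerWeight m).comp measurable_snd).mul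
      (Finset.measurable_prod _ fun j _ => h1 j)
  exact h2.lintegral_prod_right'

/-- The outermost variable runs over `(0, ∞)`, that is up to the endpoint 1, and carries the first
letter. -/
lemma letterIntegral_eq {r : ℕ} (m : Fin (r + 1) → ℕ) {β : Fin (r + 1) → ℝ} (h0 : ∀ j, 0 ≤ β j)
    (h1 : ∀ j, β j ≤ 1) : letterIntegral m β =
      evalSeries (wordSeries (some (β 0) :: blockWord 1 r m (Fin.tail β))) 1 := by
  have hΨ : Measurable fun x : Fin (r + 1) → ℝ => ∏ j, letterWeight (some (β j)) (x j) :=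
    Finset.measurable_prod _ fun j _ => (measurable_letterWeight _).comp (measurable_pi_apply j)
  rw [letterIntegral, lintegral_orthant_tailSum r m hΨ,
    ← represents_Ioi.lintegral_letterWeight (goodEnd_cons_blockWord _ _ _ _)]
  · refine setLIntegral_congr_fun measurableSet_Ioi fun T hT => ?_
    have hlt : letterWeight (some (β 0)) T ≠ ⊤ := by
      rw [letterWeight_some (h0 0) (h1 0) hT]
      exact ENNReal.ofReal_ne_top
    rw [← inner_letterWeight m (β := Fin.tail β) (fun j => h0 _) (fun j => h1 _) hT hlt]
    congr 1
    ext x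
    rw [Fin.prod_univ_succ]
    simp [Fin.tail]
  · intro b hb
    rcases List.mem_cons.1 hb with h | h
    · exact (Option.some.inj h) ▸ h0 0
    · rcases mem_blockWord h with h | ⟨j, h⟩
      · exact (Option.some.inj h) ▸ zero_le_one
      · exact (Option.some.inj h) ▸ h0 _

/-! ### The word of the inner integral, with letters named by positions in an increasing list of
points. -/

section Label

variable {r : ℕ} (m : Fin (r + 1) → ℕ) (σ : Equiv.Perm (Fin (r + 1)))

/-- The word attached to `letterIntegral`, its letters being positions in a list. -/
def labelWord : List (Option ℕ) :=
  some (r - σ 0) :: blockWord (r + 1) r m fun j => r - σ j.succ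

lemma labelWord_map (l : List ℝ) (hl : l.length = r + 1) :
    (labelWord m σ).map (Option.map fun i => l.getD i 1) = some (l.getD (r - σ 0) 1) ::
      blockWord 1 r m (Fin.tail fun j => l.getD (r - σ j) 1) := by
  rw [labelWord, List.map_cons, map_blockWord, List.getD_eq_default _ _ hl.le]
  rfl

lemma letterIntegral_labels {l : List ℝ} (hc : Chain l) (hl : l.length = r + 1) :
    letterIntegral m (fun j => l.getD (r - σ j) 1) ≠ ⊤ ∧
      (letterIntegral m (fun j => l.getD (r - σ j) 1)).toReal =
        total ((labelWord m σ).map (Option.map fun i => l.getD i 1)) := by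
  have hlt : ∀ i, i < r + 1 → l.getD i 1 < 1 := fun i hi => by
    rw [List.getD_eq_getElem _ _ (by omega)]
    exact (hc.2 _ (List.getElem_mem _)).2
  have hle : ∀ i, l.getD i 1 ≤ 1 := fun i => by
    by_cases h : i < r + 1
    · exact (hlt i h).le
    · rw [List.getD_eq_default _ _ (by omega)]
  have hconv : Convergent ((labelWord m σ).map (Option.map fun i => l.getD i 1)) := by
    refine ⟨fun β hβ => ?_, fun β hβ => ?_, (goodEnd_cons_blockWord _ _ _ _).map _⟩
    · rw [List.mem_map] at hβ
      obtain ⟨_ | i, -, hi⟩ := hβ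
      · simp at hi
      · simp only [Option.map_some, Option.some.injEq] at hi
        exact hi ▸ ⟨(hc.getD_pos i).le, hle i⟩
    · simp only [labelWord, List.map_cons, Option.map_some, List.head?_cons,
        Option.some.injEq] at hβ
      exact hβ ▸ hlt _ (by omega)
  have e := letterIntegral_eq m (β := fun j => l.getD (r - σ j) 1) (fun j => (hc.getD_pos _).le)
    (fun j => hle _)
  rw [← labelWord_map m σ l hl, evalSeries_wordSeries_one hconv] at e
  rw [e]
  exact ⟨ENNReal.ofReal_ne_top, ENNReal.toReal_ofReal (total_nonneg fun β hβ =>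
    (hconv.unit β hβ).1)⟩

/-- As `σ` is a bijection, each point is the parameter of exactly one letter, and that letter
supplies the factor `s/s₀`. -/
lemma sublinear_letterIntegral :
    Sublinear (r + 1) fun l => letterIntegral m fun j => l.getD (r - σ j) 1 := by
  intro p s s₀ acc h0 hs hlen
  simp only [letterIntegral]
  rw [← lintegral_const_mul' _ _ ENNReal.ofReal_ne_top]
  refine setLIntegral_mono' (measurableSet_orthant _) fun x _ => ?_
  rw [mul_left_comm]
  refine mul_le_mul_right ?_ _
  set j₀ := σ.symm ⟨r - p.length, by omega⟩ with hj₀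
  have hj : r - (σ j₀ : ℕ) = p.length := by
    rw [hj₀, Equiv.apply_symm_apply]
    simp only
    omega
  have hget : ∀ u : ℝ, (p ++ u :: acc).getD p.length 1 = u := fun u => by
    rw [List.getD_append_right _ _ _ _ le_rfl]; simp
  rw [← Finset.mul_prod_erase _ _ (Finset.mem_univ j₀),
    ← Finset.mul_prod_erase _ _ (Finset.mem_univ j₀), hj, hget, hget, ← mul_assoc]
  refine mul_le_mul' (letterWeight_some_le h0 hs _) (le_of_eq ?_)
  refine Finset.prod_congr rfl fun j hjm => ?_
  have hne : r - (σ j : ℕ) ≠ p.length := fun h => by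
    refine (Finset.mem_erase.1 hjm).1 (σ.injective (Fin.ext ?_))
    have := (σ j).2
    have := (σ j₀).2
    omega
  congr 2
  rcases lt_or_gt_of_ne hne with h | h
  · rw [List.getD_append _ _ _ _ h, List.getD_append _ _ _ _ h]
  · rw [List.getD_append_right _ _ _ _ h.le, List.getD_append_right _ _ _ _ h.le]
    obtain ⟨d, hd⟩ : ∃ d, r - (σ j : ℕ) - p.length = d + 1 := ⟨_, (Nat.succ_pred (by omega)).symm⟩
    rw [hd, List.getD_cons_succ, List.getD_cons_succ]

end Label

/-- The double integral representing the `η` function. -/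
def doubleIntegral {r : ℕ} (k n : Fin r → ℕ) (σ : Equiv.Perm (Fin r)) (a b : Fin r → ℕ) : ℝ≥0∞ :=
  ∫⁻ t in orthant r, ∫⁻ x in orthant r,
    ((∏ j, powerWeight (n j) (t j)) * ∏ j, powerWeight (k j) (x j)) *
      ENNReal.ofReal ((∏ j, Real.exp (-(a j * tailSum t j))) * (∏ j, Real.exp (-(b j * tailSum x j)))
        * ∏ j, (1 - oneSubExp (tailSum x j) * oneSubExp (tailSum t (σ j)))⁻¹)

/-- Tonelli, and reindexing the product of kernels by `σ`: each kernel is symmetric in the two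
points it couples. -/
lemma doubleIntegral_symm {r : ℕ} (k n : Fin r → ℕ) (σ : Equiv.Perm (Fin r)) (a b : Fin r → ℕ) :
    doubleIntegral k n σ a b = doubleIntegral n k σ⁻¹ b a := by
  have h0 := measurable_oneSubExp
  have h1 := measurable_powerWeight
  rw [doubleIntegral, lintegral_lintegral_swap (by unfold Function.uncurry; fun_prop),
    doubleIntegral]
  refine lintegral_congr fun x => lintegral_congr fun t => ?_
  have e : ∏ j, (1 - oneSubExp (tailSum x j) * oneSubExp (tailSum t (σ j)))⁻¹ =
      ∏ j, (1 - oneSubExp (tailSum t j) * oneSubExp (tailSum x (σ⁻¹ j)))⁻¹ := by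
    rw [← Equiv.prod_comp σ fun j =>
      (1 - oneSubExp (tailSum t j) * oneSubExp (tailSum x (σ⁻¹ j)))⁻¹]
    simp [mul_comm]
  rw [e, mul_comm (∏ j, powerWeight (n j) (t j)), mul_comm (∏ j, Real.exp (-(a j * _)))]

lemma getD_reverse_ofFn {r : ℕ} (f : Fin (r + 1) → ℝ) (i : Fin (r + 1)) (d : ℝ) :
    (List.ofFn f).reverse.getD (r - i) d = f i := by
  rw [List.getD_eq_getElem _ _ (by simp), List.getElem_reverse, List.getElem_ofFn]
  congr 1
  ext
  simp only [List.length_ofFn]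
  omega

/-- To complete the kernels to letters one multiplies and divides by `∏ (1 - e^{-T_j})`. The
denominators turn `e^{-a_j T_j}` into `omega (a_j)`. -/
lemma lintegral_letters_eq {r : ℕ} (m : Fin (r + 1) → ℕ) {k : Fin (r + 1) → ℕ}
    (hk : ∀ j, k j = m j + 1) (σ : Equiv.Perm (Fin (r + 1))) (a : Fin (r + 1) → ℕ)
    {t : Fin (r + 1) → ℝ} (ht : t ∈ orthant (r + 1)) :
    ∫⁻ x in orthant (r + 1), (∏ j, powerWeight (k j) (x j)) *
      ENNReal.ofReal ((∏ j, Real.exp (-(a j * tailSum t j))) *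
        (∏ j, Real.exp (-(((1 : ℕ) : ℝ) * tailSum x j)))
        * ∏ j, (1 - oneSubExp (tailSum x j) * oneSubExp (tailSum t (σ j)))⁻¹) =
    (∏ j, omega (a j) (tailSum t j)) * letterIntegral m fun j => oneSubExp (tailSum t (σ j)) := by
  have hy : ∀ j, 0 < oneSubExp (tailSum t j) := fun j => oneSubExp_pos (tailSum_pos ht j)
  rw [letterIntegral, ← lintegral_const_mul' _ _
    (ENNReal.prod_ne_top fun j _ => omega_ne_top _ _)]
  refine setLIntegral_congr_fun (measurableSet_orthant _) fun x hx => ?_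
  have h1 : ∀ j, letterWeight (some (oneSubExp (tailSum t (σ j)))) (tailSum x j) =
      ENNReal.ofReal (oneSubExp (tailSum t (σ j)) * Real.exp (-tailSum x j) /
        (1 - oneSubExp (tailSum t (σ j)) * oneSubExp (tailSum x j))) := fun j =>
    letterWeight_some (hy _).le (oneSubExp_lt_one _).le (tailSum_pos hx j)
  have hnn : ∀ j, 0 ≤ oneSubExp (tailSum t (σ j)) * Real.exp (-tailSum x j) /
        (1 - oneSubExp (tailSum t (σ j)) * oneSubExp (tailSum x j)) := fun j => by
    have h2 := oneSubExp_pos (tailSum_pos hx j)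
    have h3 := oneSubExp_lt_one (tailSum x j)
    have h4 := oneSubExp_lt_one (tailSum t (σ j))
    have := hy (σ j)
    have : 0 ≤ 1 - oneSubExp (tailSum t (σ j)) * oneSubExp (tailSum x j) := by nlinarith
    positivity
  have hnn' : ∀ j, 0 ≤ Real.exp (-(a j * tailSum t j)) / oneSubExp (tailSum t j) := fun j => by
    have := hy j
    positivity
  simp only [hk, h1, omega]
  rw [mul_left_comm, ← ENNReal.ofReal_prod_of_nonneg fun j _ => hnn j,
    ← ENNReal.ofReal_prod_of_nonneg fun j _ => hnn' j,
    ← ENNReal.ofReal_mul (Finset.prod_nonneg fun j _ => hnn' j)]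
  congr 2
  have e : ∏ j, (oneSubExp (tailSum t (σ j)) * Real.exp (-tailSum x j) /
        (1 - oneSubExp (tailSum t (σ j)) * oneSubExp (tailSum x j))) =
      (∏ j, oneSubExp (tailSum t j)) * ((∏ j, Real.exp (-(((1 : ℕ) : ℝ) * tailSum x j))) *
        ∏ j, (1 - oneSubExp (tailSum x j) * oneSubExp (tailSum t (σ j)))⁻¹) := by
    rw [← Equiv.prod_comp σ fun j => oneSubExp (tailSum t j), ← Finset.prod_mul_distrib,
      ← Finset.prod_mul_distrib]
    refine Finset.prod_congr rfl fun j _ => ?_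
    rw [Nat.cast_one, one_mul, div_eq_mul_inv, mul_assoc, mul_comm (oneSubExp (tailSum x j))]
  rw [e, Finset.prod_div_distrib]
  have := (Finset.prod_pos fun j (_ : j ∈ Finset.univ) => hy j).ne'
  field_simp

/-- The inner integral is a word of length `∑ k_j` in the points, and eliminating these adds `∑
n_j`. The condition `a 0 = 1` makes the outermost weight `dx/x`. -/
theorem doubleIntegral_mem {r : ℕ} (k n : Fin (r + 1) → ℕ) (hk : ∀ j, 1 ≤ k j) (hn : ∀ j, 1 ≤ n j)
    (σ : Equiv.Perm (Fin (r + 1))) (a : Fin (r + 1) → ℕ) (ha : ∀ j, a j = 0 ∨ a j = 1)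
    (ha0 : a 0 = 1) :
    doubleIntegral k n σ a (fun _ => 1) ≠ ⊤ ∧
      (doubleIntegral k n σ a fun _ => 1).toReal ∈ wordSpan ((∑ j, k j) + ∑ j, n j) := by
  obtain ⟨k', hk'⟩ : ∃ k' : Fin (r + 1) → ℕ, ∀ j, k j = k' j + 1 :=
    ⟨fun j => k j - 1, fun j => by have := hk j; simp only; omega⟩
  obtain ⟨n', hn'⟩ : ∃ n' : Fin (r + 1) → ℕ, ∀ j, n j = n' j + 1 :=
    ⟨fun j => n j - 1, fun j => by have := hn j; simp only; omega⟩
  set G : List ℝ → ℝ≥0∞ := fun l => letterIntegral k' fun j => l.getD (r - σ j) 1 with hG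
  have key := lintegral_nest_mem (G := G) r (sublinear_letterIntegral k' σ)
    (word_mem_hyperlogSpan (r + 1) (w := labelWord k' σ) (goodEnd_cons_blockWord _ _ _ _)
      fun i hi => by
        simp only [labelWord, List.head?_cons, Option.some.injEq] at hi
        omega)
    (fun l hc hl => letterIntegral_labels k' σ hc hl) n' (Fin.tail a) fun i => ha _
  have hlen : (labelWord k' σ).length + ∑ i, n' i + (r + 1) = (∑ j, k j) + ∑ j, n j := by
    simp only [hk', hn', labelWord, List.length_cons, length_blockWord, Finset.sum_add_distrib]
    simp
    omega
  rw [hlen] at key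
  have e : doubleIntegral k n σ a (fun _ => 1) =
      ∫⁻ T in Ioi 0, omega 1 T * nest G r n' (Fin.tail a) T [oneSubExp T] := by
    have hΨ : Measurable fun T : Fin (r + 1) → ℝ =>
        (∏ j, omega (a j) (T j)) * letterIntegral k' fun j => oneSubExp (T (σ j)) := by
      have h0 := measurable_oneSubExp
      refine (Finset.measurable_prod _ fun j _ =>
        (measurable_omega _).comp (measurable_pi_apply j)).mul
        ((measurable_letterIntegral k').comp (by fun_prop))
    have h1 : doubleIntegral k n σ a (fun _ => 1) = ∫⁻ t in orthant (r + 1),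
        (∏ j, powerWeight (n' j + 1) (t j)) * ((∏ j, omega (a j) (tailSum t j)) *
          letterIntegral k' fun j => oneSubExp (tailSum t (σ j))) := by
      refine setLIntegral_congr_fun (measurableSet_orthant _) fun t ht => ?_
      rw [← lintegral_letters_eq k' hk' σ a ht, ← lintegral_const_mul']
      · simp only [hn', mul_assoc]
      · exact ENNReal.prod_ne_top fun j _ => ENNReal.ofReal_ne_top
    rw [h1, lintegral_orthant_tailSum r n' hΨ]
    refine setLIntegral_congr_fun measurableSet_Ioi fun T hT => ?_
    rw [← inner_eq_nest G r n' (Fin.tail a) T [oneSubExp T]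
      (omega_ne_top 1 T)]
    congr 1
    ext x
    rw [Fin.prod_univ_succ, ha0, hG, mul_assoc]
    have h2 : ∀ j, oneSubExp ((Fin.cons T x : Fin (r + 1) → ℝ) (σ j)) =
        ((List.ofFn fun j => oneSubExp (x j)).reverse ++ [oneSubExp T]).getD (r - σ j) 1 := by
      intro j
      rw [← getD_reverse_ofFn (fun i => oneSubExp ((Fin.cons T x : Fin (r + 1) → ℝ) i)) (σ j) 1,
        List.ofFn_succ, List.reverse_cons]
      simp
    simp only [h2]
    simp [Fin.tail]
  rwa [e]

end ArakawaKaneko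

end

noncomputable section

namespace ArakawaKaneko

open MeasureTheory Set
open scoped ENNReal

/-! ### The integral representation of the multiple polylogarithm -/

/-- The weight `∏ x_j ^ (k_j - 1) / (k_j - 1)! · ∏ exp (-b_j X_j)`. -/
def expWeight {r : ℕ} (k b : Fin r → ℕ) (x : Fin r → ℝ) : ℝ :=
  (∏ j, x j ^ (k j - 1) / ((k j - 1).factorial : ℝ)) * ∏ j, Real.exp (-(b j * tailSum x j))

lemma sum_mul_tailSum {r : ℕ} (l : Fin r → ℝ) (x : Fin r → ℝ) :
    ∑ j, l j * tailSum x j = ∑ j, (∑ i ∈ Finset.Iic j, l i) * x j := by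
  simp only [tailSum, Finset.mul_sum, Finset.sum_mul]
  exact Finset.sum_comm' (by simp)

/-- Since `∑ l_j X_j = ∑ (l_1 + ⋯ + l_j) x_j`, the weight splits into one-variable Gamma integrands
with the denominators of the polylogarithm as rates. -/
lemma expWeight_eq {r : ℕ} (k l : Fin r → ℕ) (x : Fin r → ℝ) :
    expWeight k l x = ∏ j, (x j ^ (k j - 1) / ((k j - 1).factorial : ℝ) *
      Real.exp (-(((∑ i ∈ Finset.Iic j, l i : ℕ) : ℝ) * x j))) := by
  rw [expWeight, Finset.prod_mul_distrib, ← Real.exp_sum, ← Real.exp_sum, Finset.sum_neg_distrib,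
    Finset.sum_neg_distrib, sum_mul_tailSum]
  push_cast
  rfl

lemma integrableOn_pow_mul_exp (k : ℕ) {L : ℝ} (hL : 0 < L) :
    IntegrableOn (fun x : ℝ => x ^ (k - 1) / ((k - 1).factorial : ℝ) * Real.exp (-(L * x)))
      (Ioi 0) := by
  have h := integrableOn_rpow_mul_exp_neg_mul_rpow (p := 1) (s := ((k - 1 : ℕ) : ℝ)) (b := L)
    (by have : (0 : ℝ) ≤ ((k - 1 : ℕ) : ℝ) := Nat.cast_nonneg _
        linarith) one_pos hL
  refine IntegrableOn.congr_fun (h.div_const ((k - 1).factorial : ℝ)) (fun x _ => ?_)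
    measurableSet_Ioi
  simp only [Real.rpow_natCast, Real.rpow_one]
  rw [neg_mul]
  ring

lemma integral_pow_mul_exp {k : ℕ} (hk : 1 ≤ k) {L : ℝ} (hL : 0 < L) :
    ∫ x in Ioi (0 : ℝ), x ^ (k - 1) / ((k - 1).factorial : ℝ) * Real.exp (-(L * x)) =
      1 / L ^ k := by
  have h := Real.integral_rpow_mul_exp_neg_mul_Ioi (a := k) (r := L)
    (by exact_mod_cast hk) hL
  obtain ⟨m, rfl⟩ : ∃ m, k = m + 1 := ⟨k - 1, by omega⟩
  have hf : ((m.factorial : ℕ) : ℝ) ≠ 0 := by positivity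
  rw [Real.rpow_natCast, show ((m + 1 : ℕ) : ℝ) - 1 = (m : ℝ) by push_cast; ring,
    show Real.Gamma ((m + 1 : ℕ) : ℝ) = m.factorial by
      push_cast; exact Real.Gamma_nat_eq_factorial m] at h
  simp only [Real.rpow_natCast] at h
  simp only [Nat.add_sub_cancel]
  rw [show (fun x : ℝ => x ^ m / (m.factorial : ℝ) * Real.exp (-(L * x))) =
    fun x => (m.factorial : ℝ)⁻¹ * (x ^ m * Real.exp (-(L * x))) by ext x; ring,
    integral_const_mul, h]
  field_simp
  rw [div_pow, one_pow]
  field_simp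

lemma volume_restrict_orthant (r : ℕ) :
    (volume : Measure (Fin r → ℝ)).restrict (orthant r) =
      Measure.pi fun _ => volume.restrict (Ioi 0) := by
  rw [show orthant r = univ.pi fun _ => Ioi 0 by ext; simp [orthant], volume_pi,
    Measure.restrict_pi_pi]

lemma one_le_sum_Iic {r : ℕ} {l : Fin (r + 1) → ℕ} (h : 1 ≤ l 0) (j : Fin (r + 1)) :
    1 ≤ ∑ i ∈ Finset.Iic j, l i :=
  h.trans (Finset.single_le_sum (f := l) (fun _ _ => Nat.zero_le _) (by simp))

lemma integrableOn_expWeight {r : ℕ} (k : Fin (r + 1) → ℕ) {l : Fin (r + 1) → ℕ}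
    (h : 1 ≤ l 0) : IntegrableOn (expWeight k l) (orthant (r + 1)) := by
  rw [IntegrableOn, volume_restrict_orthant, funext (expWeight_eq k l)]
  exact Integrable.fintype_prod fun j =>
    integrableOn_pow_mul_exp (k j) (by exact_mod_cast one_le_sum_Iic h j)

lemma integral_expWeight {r : ℕ} {k : Fin (r + 1) → ℕ} (hk : ∀ j, 1 ≤ k j)
    {l : Fin (r + 1) → ℕ} (h : 1 ≤ l 0) :
    ∫ x in orthant (r + 1), expWeight k l x =
      ∏ j, 1 / ((∑ i ∈ Finset.Iic j, l i : ℕ) : ℝ) ^ k j := by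
  rw [volume_restrict_orthant, funext (expWeight_eq k l),
    integral_fintype_prod_eq_prod fun j (y : ℝ) => y ^ (k j - 1) / ((k j - 1).factorial : ℝ) *
      Real.exp (-(((∑ i ∈ Finset.Iic j, l i : ℕ) : ℝ) * y))]
  exact Finset.prod_congr rfl fun j _ =>
    integral_pow_mul_exp (hk j) (by exact_mod_cast one_le_sum_Iic h j)

lemma expWeight_nonneg {r : ℕ} (k b : Fin r → ℕ) {x : Fin r → ℝ} (hx : x ∈ orthant r) :
    0 ≤ expWeight k b x := by
  have : ∀ j, 0 ≤ x j := fun j => (hx j).le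
  unfold expWeight
  exact mul_nonneg (Finset.prod_nonneg fun j _ => by have := this j; positivity)
    (Finset.prod_nonneg fun j _ => by positivity)

lemma hasSum_prod_pi {r : ℕ} {f : Fin r → ℕ → ℂ} (hf : ∀ j, Summable fun m => ‖f j m‖) :
    (Summable fun l : Fin r → ℕ => ‖∏ j, f j (l j)‖) ∧
      HasSum (fun l : Fin r → ℕ => ∏ j, f j (l j)) (∏ j, ∑' m, f j m) := by
  induction r with
  | zero =>
    refine ⟨(hasSum_fintype _).summable, ?_⟩
    simp
  | succ r ih =>
    obtain ⟨h1, h2⟩ := ih fun j => hf j.succ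
    have hs := (hf 0).mul_norm h1
    have hs' := (hf 0).of_norm.hasSum.mul h2 hs.of_norm
    let e : ℕ × (Fin r → ℕ) ≃ (Fin (r + 1) → ℕ) := Fin.consEquiv fun _ => ℕ
    have he : ∀ p : ℕ × (Fin r → ℕ), ∏ j, f j (e p j) = f 0 p.1 * ∏ j, f j.succ (p.2 j) :=
      fun p => by
        rw [Fin.prod_univ_succ]
        simp [e, Fin.consEquiv]
    refine ⟨?_, ?_⟩
    · rw [← e.summable_iff]
      refine hs.congr fun p => ?_
      rw [Function.comp_apply, he]
    · rw [← e.hasSum_iff, Fin.prod_univ_succ]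
      exact (congrArg (HasSum · _) (funext fun p => he p)).mpr hs'

lemma tsum_prod_pow {r : ℕ} (b : Fin r → ℕ) {c : Fin r → ℂ} (hc : ∀ j, ‖c j‖ < 1) :
    ∑' l : {l : Fin r → ℕ // ∀ j, b j ≤ l j}, ∏ j, c j ^ l.1 j =
      (∏ j, c j ^ b j) * ∏ j, (1 - c j)⁻¹ := by
  let e : (Fin r → ℕ) ≃ {l : Fin r → ℕ // ∀ j, b j ≤ l j} :=
    { toFun := fun l => ⟨fun j => b j + l j, fun j => Nat.le_add_right _ _⟩
      invFun := fun l j => l.1 j - b j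
      left_inv := fun l => by ext j; simp
      right_inv := fun l => by ext j; simp [l.2 j] }
  rw [← e.tsum_eq]
  have h : ∀ l, ∏ j, c j ^ (e l).1 j = (∏ j, c j ^ b j) * ∏ j, c j ^ l j := fun l => by
    rw [← Finset.prod_mul_distrib]
    exact Finset.prod_congr rfl fun j _ => pow_add _ _ _
  simp only [h]
  rw [tsum_mul_left, (hasSum_prod_pi fun j => by
    simpa using summable_geometric_of_lt_one (norm_nonneg _) (hc j)).2.tsum_eq]
  simp only [tsum_geometric_of_norm_lt_one (hc _)]

/-- The integral representation of the multiple polylogarithm. -/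
def liIntegral {r : ℕ} (k b : Fin r → ℕ) (z : Fin r → ℂ) : ℂ :=
  (∏ j, z j ^ b j) * ∫ x in orthant r, (expWeight k b x : ℂ) *
    ∏ j, (1 - z j * (Real.exp (-tailSum x j) : ℂ))⁻¹

/-- The geometric series are integrated term by term. This is justified by the norm bound `∏
|z_j|^{l_j}`, all rates being at least 1 because `b_1 ≥ 1`. -/
lemma liIntegral_eq_liSeries {r : ℕ} {k : Fin (r + 1) → ℕ} (hk : ∀ j, 1 ≤ k j)
    {b : Fin (r + 1) → ℕ} (hb : 1 ≤ b 0) {z : Fin (r + 1) → ℂ} (hz : ∀ j, ‖z j‖ < 1) :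
    liIntegral k b z = liSeries (fun j => (k j : ℂ)) b z := by
  let F : {l : Fin (r + 1) → ℕ // ∀ j, b j ≤ l j} → (Fin (r + 1) → ℝ) → ℂ := fun l x =>
    (expWeight k l.1 x : ℂ) * ∏ j, z j ^ l.1 j
  have hl0 : ∀ l : {l : Fin (r + 1) → ℕ // ∀ j, b j ≤ l j}, 1 ≤ l.1 0 := fun l => hb.trans (l.2 0)
  have hint : ∀ l, Integrable (F l) (volume.restrict (orthant (r + 1))) := fun l =>
    ((integrableOn_expWeight k (hl0 l)).ofReal).mul_const _
  have hnorm : ∀ l, ∫ x in orthant (r + 1), ‖F l x‖ =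
      (∏ j, 1 / ((∑ i ∈ Finset.Iic j, l.1 i : ℕ) : ℝ) ^ k j) * ‖∏ j, z j ^ l.1 j‖ := fun l => by
    rw [← integral_expWeight hk (hl0 l), ← integral_mul_const]
    refine setIntegral_congr_fun (measurableSet_orthant _) fun x hx => ?_
    simp only [F, norm_mul, Complex.norm_real, Real.norm_of_nonneg (expWeight_nonneg k l.1 hx)]
  have hs := (hasSum_prod_pi (f := fun j m => z j ^ m) fun j => by
    simpa using summable_geometric_of_lt_one (norm_nonneg _) (hz j)).1
  have hsum : Summable fun l => ∫ x in orthant (r + 1), ‖F l x‖ := by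
    simp only [hnorm]
    refine Summable.of_nonneg_of_le (fun l => by positivity) (fun l => ?_)
      (hs.comp_injective Subtype.val_injective)
    refine mul_le_of_le_one_left (norm_nonneg _) (Finset.prod_le_one (fun j _ => by positivity)
      fun j _ => ?_)
    have : (1 : ℝ) ≤ ((∑ i ∈ Finset.Iic j, l.1 i : ℕ) : ℝ) := by
      exact_mod_cast one_le_sum_Iic (hl0 l) j
    rw [one_div]
    exact inv_le_one_of_one_le₀ (one_le_pow₀ this)
  have key := (hasSum_integral_of_summable_integral_norm hint hsum).tsum_eq
  have h1 : ∀ l, ∫ x in orthant (r + 1), F l x =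
      ∏ j, z j ^ l.1 j / (((∑ i ∈ Finset.Iic j, l.1 i : ℕ) : ℂ) ^ (k j : ℂ)) := fun l => by
    simp only [F]
    rw [integral_mul_const, integral_complex_ofReal, integral_expWeight hk (hl0 l)]
    push_cast
    rw [← Finset.prod_mul_distrib]
    refine Finset.prod_congr rfl fun j _ => ?_
    rw [Complex.cpow_natCast]
    ring
  simp only [h1] at key
  rw [liSeries, key, liIntegral, ← integral_const_mul]
  refine setIntegral_congr_fun (measurableSet_orthant _) fun x hx => ?_
  have hc : ∀ j, ‖z j * (Real.exp (-tailSum x j) : ℂ)‖ < 1 := fun j => by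
    rw [norm_mul, Complex.norm_real, Real.norm_of_nonneg (Real.exp_pos _).le]
    have h2 : Real.exp (-tailSum x j) ≤ 1 := Real.exp_le_one_iff.2 (by
      have := tailSum_pos hx j; linarith)
    have := Real.exp_pos (-tailSum x j)
    nlinarith [norm_nonneg (z j), hz j]
  have h3 : ∀ l : {l : Fin (r + 1) → ℕ // ∀ j, b j ≤ l j}, F l x =
      ((∏ j, x j ^ (k j - 1) / ((k j - 1).factorial : ℝ) : ℝ) : ℂ) *
        ∏ j, (z j * (Real.exp (-tailSum x j) : ℂ)) ^ l.1 j := fun l => by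
    simp only [F, expWeight, mul_pow, Finset.prod_mul_distrib]
    push_cast
    rw [mul_assoc, mul_comm (∏ j, z j ^ l.1 j)]
    congr 2
    refine Finset.prod_congr rfl fun j _ => ?_
    rw [← Complex.exp_nat_mul]
    congr 1
    ring
  simp only [h3]
  rw [tsum_mul_left, tsum_prod_pow b hc]
  simp only [expWeight, mul_pow, Finset.prod_mul_distrib]
  push_cast
  have h4 : ∏ j, Complex.exp (-(tailSum x j : ℂ)) ^ b j =
      ∏ j, Complex.exp (-((b j : ℂ) * (tailSum x j : ℂ))) :=
    Finset.prod_congr rfl fun j _ => by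
      rw [← Complex.exp_nat_mul]
      congr 1
      ring
  rw [h4]
  ring

/-! ### Analytic continuation -/

lemma one_sub_mul_ne_zero {r : ℕ} {z : Fin r → ℂ} (hz : z ∈ slitDomain r) (j : Fin r) {p : ℝ}
    (h0 : 0 ≤ p) (h1 : p ≤ 1) : 1 - z j * (p : ℂ) ≠ 0 := fun h => by
  have hp : p ≠ 0 := by
    rintro rfl
    simp at h
  have hp' : (p : ℂ) ≠ 0 := by exact_mod_cast hp
  refine hz j (1 / p) ((one_le_div (lt_of_le_of_ne h0 hp.symm)).2 h1) ?_
  push_cast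
  rw [eq_div_iff hp']
  exact (sub_eq_zero.1 h).symm

lemma isOpen_slitDomain (r : ℕ) : IsOpen (slitDomain r) := by
  have h : slitDomain r = univ.pi fun _ => ((fun x : ℝ => (x : ℂ)) '' Ici 1)ᶜ := by
    ext z
    simp only [slitDomain, mem_ofPred_eq, mem_pi, mem_univ, true_implies, mem_compl_iff, mem_image,
      mem_Ici, not_exists, not_and]
    exact forall_congr' fun j => forall₂_congr fun x _ => ⟨fun h e => h e.symm, fun h e => h e.symm⟩
  rw [h]
  exact isOpen_set_pi finite_univ fun _ _ =>
    (Complex.isometry_ofReal.isClosedEmbedding.isClosedMap _ isClosed_Ici).isOpen_compl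

/-- Integration against `w` is a bounded functional on the Banach algebra of continuous functions on
the cube `[0,1]^r`. The integrand is a product of inverses of units depending affinely on `z`, and
inversion is analytic on units. -/
lemma analyticOnNhd_integral_prod_inv {r : ℕ} {w : (Fin r → ℝ) → ℝ}
    (hw : IntegrableOn w (orthant r)) :
    AnalyticOnNhd ℂ (fun z : Fin r → ℂ => ∫ x in orthant r, (w x : ℂ) *
      ∏ j, (1 - z j * (Real.exp (-tailSum x j) : ℂ))⁻¹) (slitDomain r) := by
  let K := Fin r → Icc (0 : ℝ) 1
  -- The projection only makes the map total: on the orthant the exponentials already lie in `[0,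
  -- 1]`.
  let p : (Fin r → ℝ) → K := fun x j => projIcc 0 1 zero_le_one (Real.exp (-tailSum x j))
  have hp : Measurable p := measurable_pi_lambda _ fun j =>
    continuous_projIcc.measurable.comp (by fun_prop)
  have hpe : ∀ x ∈ orthant r, ∀ j, (p x j : ℝ) = Real.exp (-tailSum x j) := fun x hx j => by
    refine congrArg Subtype.val (projIcc_of_mem zero_le_one ⟨(Real.exp_pos _).le, ?_⟩)
    exact Real.exp_le_one_iff.2 (by have := tailSum_pos hx j; linarith)
  have hint : ∀ f : C(K, ℂ), Integrable (fun x => (w x : ℂ) * f (p x))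
      (volume.restrict (orthant r)) := fun f =>
    Integrable.mul_bdd (c := ‖f‖) hw.ofReal
      (f.continuous.measurable.comp hp).aestronglyMeasurable
      (Filter.Eventually.of_forall fun x => f.norm_coe_le_norm _)
  let L₀ : C(K, ℂ) →ₗ[ℂ] ℂ :=
    { toFun := fun f => ∫ x in orthant r, (w x : ℂ) * f (p x)
      map_add' := fun f g => by
        simp only [ContinuousMap.add_apply, mul_add]
        exact integral_add (hint f) (hint g)
      map_smul' := fun c f => by
        simp only [ContinuousMap.smul_apply, smul_eq_mul, RingHom.id_apply]
        rw [← integral_const_mul]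
        exact integral_congr_ae (Filter.Eventually.of_forall fun x => mul_left_comm _ _ _) }
  let L : C(K, ℂ) →L[ℂ] ℂ := L₀.mkContinuous (∫ x in orthant r, ‖w x‖) fun f => by
    change ‖∫ x in orthant r, (w x : ℂ) * f (p x)‖ ≤ _
    rw [← integral_mul_const]
    refine norm_integral_le_of_norm_le (hw.norm.mul_const _)
      (Filter.Eventually.of_forall fun x => ?_)
    rw [norm_mul, Complex.norm_real]
    exact mul_le_mul_of_nonneg_left (f.norm_coe_le_norm _) (norm_nonneg _)
  let coord : Fin r → C(K, ℂ) := fun j =>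
    ⟨fun y => ((y j : ℝ) : ℂ), by fun_prop⟩
  let D : Fin r → (Fin r → ℂ) → C(K, ℂ) := fun j z => 1 - z j • coord j
  have hD : ∀ j, ∀ z ∈ slitDomain r, IsUnit (D j z) := fun j z hz => by
    rw [ContinuousMap.isUnit_iff_forall_ne_zero]
    intro y
    exact one_sub_mul_ne_zero hz j (y j).2.1 (y j).2.2
  have hH : AnalyticOnNhd ℂ (fun z => L (∏ j, Ring.inverse (D j z))) (slitDomain r) := by
    intro z hz
    refine (L.analyticAt _).fun_comp (f := fun z => ∏ j, Ring.inverse (D j z))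
      (Finset.analyticAt_fun_prod _ fun j _ => ?_)
    have h1 : AnalyticAt ℂ (D j) z := analyticAt_const.sub
      (((ContinuousLinearMap.proj (R := ℂ) (φ := fun _ : Fin r => ℂ) j).analyticAt z).smul
        analyticAt_const)
    exact (analyticOnNhd_inverse (𝕜 := ℂ) (A := C(K, ℂ)) (D j z) (hD j z hz)).fun_comp h1
  refine hH.congr (isOpen_slitDomain r) fun z hz => ?_
  change ∫ x in orthant r, (w x : ℂ) * (∏ j, Ring.inverse (D j z)) (p x) = _
  refine setIntegral_congr_fun (measurableSet_orthant r) fun x hx => ?_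
  rw [ContinuousMap.prod_apply]
  congr 1
  refine Finset.prod_congr rfl fun j _ => ?_
  have h1 := congrArg (fun f : C(K, ℂ) => f (p x)) (Ring.mul_inverse_cancel _ (hD j z hz))
  have h2 : D j z (p x) = 1 - z j * (Real.exp (-tailSum x j) : ℂ) := by
    change 1 - z j * ((p x j : ℝ) : ℂ) = _
    rw [hpe x hx]
  simp only [ContinuousMap.mul_apply, ContinuousMap.one_apply, h2] at h1
  exact eq_inv_of_mul_eq_one_right h1

lemma isLiContinuation_liIntegral {r : ℕ} {k : Fin (r + 1) → ℕ} (hk : ∀ j, 1 ≤ k j)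
    {b : Fin (r + 1) → ℕ} (hb : 1 ≤ b 0) :
    IsLiContinuation (fun j => (k j : ℂ)) b (liIntegral k b) := by
  refine ⟨?_, fun z hz => liIntegral_eq_liSeries hk hb hz⟩
  refine AnalyticOnNhd.mul (fun z _ => Finset.analyticAt_fun_prod _ fun j _ => ?_)
    (analyticOnNhd_integral_prod_inv (integrableOn_expWeight k hb))
  exact ((ContinuousLinearMap.proj (R := ℂ) (φ := fun _ : Fin (r + 1) => ℂ) j).analyticAt z).pow _

lemma multiLi_eq_liIntegral {r : ℕ} {k : Fin (r + 1) → ℕ} (hk : ∀ j, 1 ≤ k j)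
    {b : Fin (r + 1) → ℕ} (hb : 1 ≤ b 0) {z : Fin (r + 1) → ℂ} (hz : z ∈ slitDomain (r + 1)) :
    multiLi (fun j => (k j : ℂ)) b z = liIntegral k b z :=
  (multiLi_spec ⟨_, isLiContinuation_liIntegral hk hb⟩).eqOn (isLiContinuation_liIntegral hk hb) hz

/-! ### The `η` function as a positive double integral -/

/-- The inner integral of `doubleIntegral`. -/
def innerIntegral {r : ℕ} (k n : Fin r → ℕ) (σ : Equiv.Perm (Fin r)) (a b : Fin r → ℕ)
    (t : Fin r → ℝ) : ℝ≥0∞ :=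
  ∫⁻ x in orthant r,
    ((∏ j, powerWeight (n j) (t j)) * ∏ j, powerWeight (k j) (x j)) *
      ENNReal.ofReal ((∏ j, Real.exp (-(a j * tailSum t j))) * (∏ j, Real.exp (-(b j * tailSum x j)))
        * ∏ j, (1 - oneSubExp (tailSum x j) * oneSubExp (tailSum t (σ j)))⁻¹)

lemma measurable_innerIntegral {r : ℕ} (k n : Fin r → ℕ) (σ : Equiv.Perm (Fin r))
    (a b : Fin r → ℕ) : Measurable (innerIntegral k n σ a b) := by
  have h0 := measurable_oneSubExp
  have h1 := measurable_powerWeight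
  unfold innerIntegral
  exact Measurable.lintegral_prod_right' (f := fun p : (Fin r → ℝ) × (Fin r → ℝ) =>
    ((∏ j, powerWeight (n j) (p.1 j)) * ∏ j, powerWeight (k j) (p.2 j)) *
      ENNReal.ofReal ((∏ j, Real.exp (-(a j * tailSum p.1 j))) *
        (∏ j, Real.exp (-(b j * tailSum p.2 j)))
        * ∏ j, (1 - oneSubExp (tailSum p.2 j) * oneSubExp (tailSum p.1 (σ j)))⁻¹)) (by fun_prop)

lemma one_sub_oneSubExp_mul_pos {x : ℝ} (hx : 0 < x) (t : ℝ) :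
    0 < 1 - oneSubExp x * oneSubExp t := by
  have h1 := oneSubExp_pos hx
  have h2 := oneSubExp_lt_one x
  have h3 := oneSubExp_lt_one t
  nlinarith

/-- No finiteness is needed: for a nonnegative measurable function the Bochner integral is the
`toReal` of the Lebesgue integral, both being 0 in the divergent case. -/
lemma toReal_innerIntegral {r : ℕ} (k n : Fin r → ℕ) (σ : Equiv.Perm (Fin r)) (a b : Fin r → ℕ)
    {t : Fin r → ℝ} (ht : t ∈ orthant r) :
    (innerIntegral k n σ a b t).toReal =
      (∏ j, t j ^ (n j - 1) / ((n j - 1).factorial : ℝ)) * (∏ j, Real.exp (-(a j * tailSum t j))) *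
        ∫ x in orthant r, expWeight k b x *
          ∏ j, (1 - oneSubExp (tailSum x j) * oneSubExp (tailSum t (σ j)))⁻¹ := by
  have hpos : ∀ x ∈ orthant r,
      0 ≤ ∏ j, (1 - oneSubExp (tailSum x j) * oneSubExp (tailSum t (σ j)))⁻¹ := fun x hx =>
    Finset.prod_nonneg fun j _ => inv_nonneg.2
      (one_sub_oneSubExp_mul_pos (tailSum_pos hx j) _).le
  have hpw : ∀ (m : Fin r → ℕ), ∀ x ∈ orthant r, ∏ j, powerWeight (m j) (x j) =
      ENNReal.ofReal (∏ j, x j ^ (m j - 1) / ((m j - 1).factorial : ℝ)) := fun m x hx => by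
    rw [ENNReal.ofReal_prod_of_nonneg fun j _ => by have := (hx j).le; positivity]
    rfl
  have hnn : ∀ (m : Fin r → ℕ), ∀ x ∈ orthant r,
      0 ≤ ∏ j, x j ^ (m j - 1) / ((m j - 1).factorial : ℝ) := fun m x hx =>
    Finset.prod_nonneg fun j _ => by have := (hx j).le; positivity
  have h0 := measurable_oneSubExp
  rw [← integral_const_mul, integral_eq_lintegral_of_nonneg_ae]
  · congr 1
    refine setLIntegral_congr_fun (measurableSet_orthant r) fun x hx => ?_
    rw [hpw n t ht, hpw k x hx, ← ENNReal.ofReal_mul (hnn n t ht),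
      ← ENNReal.ofReal_mul (mul_nonneg (hnn n t ht) (hnn k x hx))]
    congr 1
    unfold expWeight
    ring
  · refine (ae_restrict_iff' (measurableSet_orthant r)).2
      (Filter.Eventually.of_forall fun x hx => ?_)
    exact mul_nonneg (mul_nonneg (hnn n t ht) (Finset.prod_nonneg fun j _ => (Real.exp_pos _).le))
      (mul_nonneg (expWeight_nonneg k b hx) (hpos x hx))
  · unfold expWeight
    exact Measurable.aestronglyMeasurable (by fun_prop)

/-- The denominators `(1 - e^{T})^{b_j}` cancel the prefactor of the integral for `Li`. Each kernel
releases a factor `e^{-T_σ(j)}`, and their product turns `e^{(1 - a_j) T_j}` into `e^{-a_j T_j}`. -/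
lemma etaIntegrand_eq {r : ℕ} {k : Fin (r + 1) → ℕ} (hk : ∀ j, 1 ≤ k j) {n : Fin (r + 1) → ℕ}
    (hn : ∀ j, 1 ≤ n j) (σ : Equiv.Perm (Fin (r + 1))) (a : Fin (r + 1) → ℕ)
    {b : Fin (r + 1) → ℕ} (hb : 1 ≤ b 0) {t : Fin (r + 1) → ℝ} (ht : t ∈ orthant (r + 1)) :
    etaIntegrand (fun j => (k j : ℂ)) (fun j => (n j : ℂ)) σ a b t =
      (((∏ j, ((n j - 1).factorial : ℝ)) * (innerIntegral k n σ a b t).toReal : ℝ) : ℂ) := by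
  have hT : ∀ j, 1 < Real.exp (tailSum t j) := fun j => Real.one_lt_exp_iff.2 (tailSum_pos ht j)
  have hz : (fun j => 1 - (Real.exp (tailSum t (σ j)) : ℂ)) ∈ slitDomain (r + 1) := by
    intro j x hx h
    have h' : 1 - Real.exp (tailSum t (σ j)) = x := by
      have h2 : 1 - (Real.exp (tailSum t (σ j)) : ℂ) = x := h
      exact_mod_cast h2
    linarith [hT (σ j)]
  have hz0 : ∏ j, (1 - (Real.exp (tailSum t (σ j)) : ℂ)) ^ b j ≠ 0 :=
    Finset.prod_ne_zero_iff.2 fun j _ => pow_ne_zero _ fun h => by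
      have h' : 1 - Real.exp (tailSum t (σ j)) = 0 := by exact_mod_cast h
      linarith [hT (σ j)]
  rw [etaIntegrand, multiLi_eq_liIntegral hk hb hz, liIntegral, mul_div_cancel_left₀ _ hz0,
    toReal_innerIntegral _ _ _ _ _ ht]
  have h1 : ∫ x in orthant (r + 1), (expWeight k b x : ℂ) * ∏ j,
      (1 - (1 - (Real.exp (tailSum t (σ j)) : ℂ)) * (Real.exp (-tailSum x j) : ℂ))⁻¹ =
      ((∏ j, Real.exp (-tailSum t j) : ℝ) : ℂ) * ((∫ x in orthant (r + 1), expWeight k b x *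
        ∏ j, (1 - oneSubExp (tailSum x j) * oneSubExp (tailSum t (σ j)))⁻¹ : ℝ) : ℂ) := by
    rw [← integral_complex_ofReal, ← integral_const_mul]
    refine setIntegral_congr_fun (measurableSet_orthant _) fun x _ => ?_
    have h2 : ∀ j, (1 - (1 - Real.exp (tailSum t (σ j))) * Real.exp (-tailSum x j))⁻¹ =
        Real.exp (-tailSum t (σ j)) *
          (1 - oneSubExp (tailSum x j) * oneSubExp (tailSum t (σ j)))⁻¹ := fun j => by
      rw [oneSubExp, oneSubExp, Real.exp_neg (tailSum t (σ j)), ← mul_inv]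
      congr 1
      have := (Real.exp_pos (tailSum t (σ j))).ne'
      field_simp
      ring
    have h3 : ∏ j, (1 - (1 - (Real.exp (tailSum t (σ j)) : ℂ)) * (Real.exp (-tailSum x j) : ℂ))⁻¹ =
        ((∏ j, (1 - (1 - Real.exp (tailSum t (σ j))) * Real.exp (-tailSum x j))⁻¹ : ℝ) : ℂ) := by
      push_cast
      rfl
    rw [h3]
    simp only [h2]
    rw [Finset.prod_mul_distrib, Equiv.prod_comp σ fun j => Real.exp (-tailSum t j)]
    push_cast
    ring
  rw [h1]
  have h4 : ∏ j, ((t j : ℂ) ^ ((n j : ℂ) - 1) *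
      (Real.exp ((1 - (a j : ℝ)) * tailSum t j) : ℂ)) =
      ((∏ j, (t j ^ (n j - 1) * Real.exp ((1 - (a j : ℝ)) * tailSum t j)) : ℝ) : ℂ) := by
    push_cast
    refine Finset.prod_congr rfl fun j _ => ?_
    have : (n j : ℂ) - 1 = ((n j - 1 : ℕ) : ℂ) := by rw [Nat.cast_sub (hn j)]; simp
    rw [this, Complex.cpow_natCast]
  rw [h4, ← Complex.ofReal_mul, ← Complex.ofReal_mul]
  congr 1
  rw [Finset.prod_div_distrib, ← mul_assoc, ← mul_assoc, ← mul_assoc, Finset.prod_mul_distrib]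
  have hf : ∏ j, ((n j - 1).factorial : ℝ) ≠ 0 :=
    Finset.prod_ne_zero_iff.2 fun j _ => by positivity
  rw [mul_div_cancel₀ _ hf, mul_assoc (∏ j, t j ^ (n j - 1)), ← Finset.prod_mul_distrib]
  congr 2
  refine Finset.prod_congr rfl fun j _ => ?_
  rw [← Real.exp_add]
  congr 1
  ring

theorem eta_eq_doubleIntegral {r : ℕ} {k : Fin (r + 1) → ℕ} (hk : ∀ j, 1 ≤ k j)
    {n : Fin (r + 1) → ℕ} (hn : ∀ j, 1 ≤ n j) (σ : Equiv.Perm (Fin (r + 1)))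
    (a : Fin (r + 1) → ℕ) {b : Fin (r + 1) → ℕ} (hb : 1 ≤ b 0)
    (hfin : doubleIntegral k n σ a b ≠ ⊤) :
    EtaConverges (fun j => (k j : ℂ)) (fun j => (n j : ℂ)) σ a b ∧
      eta (fun j => (k j : ℂ)) (fun j => (n j : ℂ)) σ a b =
        ((doubleIntegral k n σ a b).toReal : ℂ) := by
  have hm := measurable_innerIntegral k n σ a b
  have hd : doubleIntegral k n σ a b = ∫⁻ t in orthant (r + 1), innerIntegral k n σ a b t := rfl
  have hi : IntegrableOn (fun t => (innerIntegral k n σ a b t).toReal) (orthant (r + 1)) :=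
    integrable_toReal_of_lintegral_ne_top hm.aemeasurable hfin
  have heq : EqOn (etaIntegrand (fun j => (k j : ℂ)) (fun j => (n j : ℂ)) σ a b)
      (fun t => (((∏ j, ((n j - 1).factorial : ℝ)) * (innerIntegral k n σ a b t).toReal : ℝ) : ℂ))
      (orthant (r + 1)) := fun t ht => etaIntegrand_eq hk hn σ a hb ht
  refine ⟨⟨⟨_, isLiContinuation_liIntegral hk hb⟩, ?_⟩, ?_⟩
  · exact IntegrableOn.congr_fun (hi.const_mul _).ofReal heq.symm (measurableSet_orthant _)
  · rw [eta, setIntegral_congr_fun (measurableSet_orthant _) heq, integral_complex_ofReal,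
      integral_const_mul, integral_toReal hm.aemeasurable (ae_lt_top hm hfin), ← hd]
    have hG : ∏ j, 1 / Complex.Gamma (n j : ℂ) =
        ((∏ j, ((n j - 1).factorial : ℝ) : ℝ) : ℂ)⁻¹ := by
      push_cast
      rw [← Finset.prod_inv_distrib]
      refine Finset.prod_congr rfl fun j _ => ?_
      have : (n j : ℂ) = ((n j - 1 : ℕ) : ℂ) + 1 := by rw [Nat.cast_sub (hn j)]; simp
      rw [this, Complex.Gamma_nat_eq_factorial, one_div]
    rw [hG, Complex.ofReal_mul, inv_mul_cancel_left₀]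
    rw [Complex.ofReal_ne_zero]
    exact Finset.prod_ne_zero_iff.2 fun j _ => by positivity

end ArakawaKaneko

end

/-! ### The main theorem. -/

theorem theorem4p3 {r : ℕ} [NeZero r] (k n : Fin r → ℕ)
    (hk : ∀ j, 1 ≤ k j) (hn : ∀ j, 1 ≤ n j)
    (σ : Equiv.Perm (Fin r)) (a : Fin r → ℕ)
    (ha : ∀ j, a j = 0 ∨ a j = 1) (ha1 : a 0 = 1) (haσ : a (σ⁻¹ 0) = 1) :
    (ArakawaKaneko.EtaConverges (fun j => (k j : ℂ)) (fun j => (n j : ℂ)) σ a (fun _ => 1) ∧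
      ArakawaKaneko.etaStar (fun j => (k j : ℂ)) (fun j => (n j : ℂ)) σ a ∈
        ArakawaKaneko.mzvSpan ((∑ j, k j) + (∑ j, n j))) ∧
    (ArakawaKaneko.EtaConverges (fun j => (k j : ℂ)) (fun j => (n j : ℂ)) σ (fun _ => 1) a ∧
      ArakawaKaneko.etaStarStar (fun j => (k j : ℂ)) (fun j => (n j : ℂ)) σ a ∈
        ArakawaKaneko.mzvSpan ((∑ j, k j) + (∑ j, n j))) := by
  obtain ⟨r, rfl⟩ : ∃ m, r = m + 1 := ⟨r - 1, by have := NeZero.ne r; omega⟩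
  obtain ⟨h1, h2⟩ := ArakawaKaneko.doubleIntegral_mem k n hk hn σ a ha ha1
  -- For `η⋆⋆` the roles of `k` and `n` are exchanged, so that the all-ones vector again sits on the
  -- inner variables; `doubleIntegral_symm` translates back.
  obtain ⟨h3, h4⟩ := ArakawaKaneko.doubleIntegral_mem n k hn hk σ⁻¹ a ha ha1
  rw [ArakawaKaneko.doubleIntegral_symm, inv_inv] at h3 h4
  rw [add_comm] at h4
  obtain ⟨e1, e2⟩ := ArakawaKaneko.eta_eq_doubleIntegral hk hn σ a (b := fun _ => 1) le_rfl h1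
  obtain ⟨e3, e4⟩ := ArakawaKaneko.eta_eq_doubleIntegral hk hn σ (fun _ => 1) ha1.ge h3
  refine ⟨⟨e1, ?_⟩, e3, ?_⟩
  · rw [ArakawaKaneko.etaStar, e2]
    exact ArakawaKaneko.ofReal_mem_mzvSpan h2
  · rw [ArakawaKaneko.etaStarStar, e4]
    exact ArakawaKaneko.ofReal_mem_mzvSpan h4
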